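/- **Setting.** A measurable function $v:\mathbb R\to[1,\infty)$ is called *admissible* if there is $M$ with $v(s+t)\le M(v(s)+v(t))$ for all $s,t\in\mathbb R$, and *strongly admissible* if in addition $1/v\in L^2(\mathbb R)$. For $\omega>0$ let $S_\omega=\{z\in\mathbb C: |\operatorname{Im} z|<\omega\}$, let $S_0=\mathbb R$, and let $\overline S_\omega=\{z\in\mathbb C:|\operatorname{Im}z|\le\omega\}$ for $\omega\ge 0$. Write $(\tau_zf)(w)=f(w-z)$ and $f_{|r}(s)=f(s+\mathrm ir)$. Let $L^2_{v,\omega}(\mathbb R)=\{g\in L^2(\mathbb R): v\,\mathrm e^{\omega|\cdot|}g\in L^2(\mathbb R)\}$ and $$W^2_v(S_\omega)=\{\hat g: g\in L^2_{v,\omega}(\mathbb R)\},\qquad \|\hat g\|_{W^2_v(S_\omega)}=\|v\,\mathrm e^{\omega|\cdot|}g\|_{L^2},$$ where $\hat g(z)=\int_{\mathbb R}g(s)\mathrm e^{-\mathrm isz}\,\mathrm ds$ for $z\in S_\omega$; for $\omega=0$ this is the Fourier transform on $L^2(\mathbb R)$, and functions on $S_0=\mathbb R$ are identified if they agree almost everywhere.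 For $h=\hat g\in W^2_v(S_\omega)$ write $h^\vee=g$. With $G(z)=\mathrm e^{-z^2}$, the *generalized Hörmander space* $\mathrm{H\ddot or}^2_v(S_\omega)$ consists of all functions $f$ on $S_\omega$ such that $\tau_tG\cdot f\in W^2_v(S_\omega)$ for all $t\in\mathbb R$ and $$\|f\|_{\mathrm{H\ddot or}^2_v(S_\omega)}:=\sup_{t\in\mathbb R}\|\tau_tG\cdot f\|_{W^2_v(S_\omega)}<\infty .$$ For $\theta>0$ let $H^\infty_0(S_\theta)$ be the space of holomorphic $\varphi:S_\theta\to\mathbb C$ such that for every $\alpha>0$ there is $C$ with $|\varphi(z)|\le C(1+|\operatorname{Re}z|)^{-\alpha}$ on $S_\theta$. **Theorem.** Let $\omega\ge0$ and let $v:\mathbb R\to[1,\infty)$ be strongly admissible. a) The space $\mathrm{H\ddot or}^2_v(S_\omega)$ embeds continuously into the space $\mathrm{UC_b}(\overline S_\omega)$ of bounded, uniformly continuous functions on $\overline S_\omega$ with the supremum norm: there is a constant $C$ such that each $f\in\mathrm{H\ddot or}^2_v(S_\omega)$ has a bounded, uniformly continuous extension to $\overline S_\omega$ (for $\omega=0$: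 a bounded, uniformly continuous representative) with supremum norm at most $C\|f\|_{\mathrm{H\ddot or}^2_v(S_\omega)}$. b) Let $\omega>0$. There are constants $c,C>0$ such that the following holds. Each $f\in\mathrm{H\ddot or}^2_v(S_\omega)$ extends continuously to $\overline S_\omega$, the boundary functions $f_{|\pm\omega}$ of the extension belong to $\mathrm{H\ddot or}^2_v(\mathbb R)=\mathrm{H\ddot or}^2_v(S_0)$, and $$c\bigl(\|f_{|\omega}\|_{\mathrm{H\ddot or}^2_v(\mathbb R)}+\|f_{|-\omega}\|_{\mathrm{H\ddot or}^2_v(\mathbb R)}\bigr)\le\|f\|_{\mathrm{H\ddot or}^2_v(S_\omega)}\le C\bigl(\|f_{|\omega}\|_{\mathrm{H\ddot or}^2_v(\mathbb R)}+\|f_{|-\omega}\|_{\mathrm{H\ddot or}^2_v(\mathbb R)}\bigr).$$ Conversely, if $f$ is a bounded holomorphic function on $S_\omega$ whose boundary values $f_{|\pm\omega}(s)=\lim_{y\nearrow\omega}f(s\pm\mathrm iy)$ (existing for almost every $s\in\mathbb R$) belong to $\mathrm{H\ddot or}^2_v(\mathbb R)$, then $f\in\mathrm{H\ddot or}^2_v(S_\omega)$,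 with the same norm estimates. c) There is $c>0$ such that $\mathrm{H\ddot or}^2_v(S_\omega)$ with the norm $c\,\|\cdot\|_{\mathrm{H\ddot or}^2_v(S_\omega)}$ is a Banach algebra with respect to pointwise multiplication (that is, it is complete, closed under products, and the norm is submultiplicative). d) Let $\theta>0$ and $\varphi\in H^\infty_0(S_{\theta+\omega})$. For each $f\in\mathrm{H\ddot or}^2_v(S_\omega)$, continuously extended to $\overline S_\omega$ as in a), and each $z\in S_\theta\cap\overline S_\omega$, one has $\tau_z\varphi\cdot f\in W^2_v(S_\omega)$, the function $s\mapsto(\tau_z\varphi\cdot f)^\vee(s)\,\mathrm e^{-\mathrm isz}$ is integrable, and $$\varphi(0)\,f(z)=\int_{\mathbb R}(\tau_z\varphi\cdot f)^\vee(s)\,\mathrm e^{-\mathrm isz}\,\mathrm ds .$$ -/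

import Mathlib

open MeasureTheory Filter Topology
open scoped ENNReal FourierTransform

namespace HorStrip

noncomputable section

/-- Admissible weights `v : ℝ → [1, ∞)`. -/
structure IsAdmissible (v : ℝ → ℝ) : Prop where
  measurable : Measurable v
  one_le : ∀ s, 1 ≤ v s
  quasi_subadditive : ∃ M : ℝ, ∀ s t, v (s + t) ≤ M * (v s + v t)

/-- Strongly admissible weights: in addition `1 / v ∈ L²(ℝ)`. -/
structure IsStronglyAdmissible (v : ℝ → ℝ) : Prop extends IsAdmissible v where
  inv_memLp : MemLp (fun s => (v s)⁻¹) 2 volume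

/-- The horizontal strip `S_ω`: open if `ω > 0`, and the real line if `ω = 0`. -/
def strip (ω : ℝ) : Set ℂ := if ω = 0 then {z | z.im = 0} else {z | |z.im| < ω}

/-- The closed strip. -/
def closedStrip (ω : ℝ) : Set ℂ := {z | |z.im| ≤ ω}

/-- The filter that governs equality of functions on `S_ω`. Functions on `S_ω` are represented by
functions `ℂ → ℂ`, and `f`, `g` represent the same object iff `f =ᶠ[stripFilter ω] g`: for `ω > 0`
this is equality at every point of `S_ω`, for `ω = 0` it is equality almost everywhere on `ℝ`. -/
def stripFilter (ω : ℝ) : Filter ℂ :=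
  if ω = 0 then Filter.map (fun x : ℝ => (x : ℂ)) (ae volume) else 𝓟 (strip ω)

/-- Translation `(τ_z f)(w) = f (w - z)`. -/
def translate (z : ℂ) (f : ℂ → ℂ) : ℂ → ℂ := fun w => f (w - z)

/-- The Gaussian function `exp (-z²)`. -/
def gaussian : ℂ → ℂ := fun z => Complex.exp (-z ^ 2)

/-- A function on `ℝ` as a function on `ℂ`, of which only the values on `ℝ = S_0` matter. -/
def ofLine (b : ℝ → ℂ) : ℂ → ℂ := fun z => b z.re

/-- The function `f_{|r} : s ↦ f (s + i r)` on the real line. -/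
def ordinate (f : ℂ → ℂ) (r : ℝ) : ℝ → ℂ := fun s => f (s + r * Complex.I)

/-- The weight function `v(s) exp(ω |s|)` times `g`. -/
def weighted (v : ℝ → ℝ) (ω : ℝ) (g : ℝ → ℂ) : ℝ → ℂ :=
  fun s => ((v s * Real.exp (ω * |s|) : ℝ) : ℂ) * g s

/-- The weighted space `L²_{v,ω}(ℝ)`. -/
structure MemWeightedL2 (v : ℝ → ℝ) (ω : ℝ) (g : ℝ → ℂ) : Prop where
  memLp : MemLp g 2 volume
  weighted_memLp : MemLp (weighted v ω g) 2 volume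

/-- `h` is, on `S_ω`, the Fourier transform `ĝ(z) = ∫ g(s) exp(-i s z) ds` of `g ∈ L²_{v,ω}(ℝ)`;
equivalently, `g` is the inverse Fourier transform `h^∨` of `h`. For `ω > 0` the formula
holds pointwise on `S_ω`, for `ω = 0` the Fourier transform is the one on `L²(ℝ)` (Plancherel),
which in Mathlib is normalized with the kernel `exp(-2π i s x)`. -/
def IsFourierOnStrip (ω : ℝ) (g : ℝ → ℂ) (h : ℂ → ℂ) : Prop :=
  if ω = 0 then
    ∃ hg : MemLp g 2 (volume : Measure ℝ),
      ∀ᵐ x : ℝ, h x = (𝓕 (hg.toLp g) : Lp ℂ 2 (volume : Measure ℝ)) (x / (2 * Real.pi))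
  else
    ∀ z ∈ strip ω, h z = ∫ s : ℝ, g s * Complex.exp (-Complex.I * s * z)

/-- `g = h^∨` with `g ∈ L²_{v,ω}(ℝ)`. -/
def IsSobolevTransform (v : ℝ → ℝ) (ω : ℝ) (h : ℂ → ℂ) (g : ℝ → ℂ) : Prop :=
  MemWeightedL2 v ω g ∧ IsFourierOnStrip ω g h

/-- Membership in the generalized Sobolev space `W²_v(S_ω)`. -/
def MemSobolev (v : ℝ → ℝ) (ω : ℝ) (h : ℂ → ℂ) : Prop :=
  ∃ g : ℝ → ℂ, IsSobolevTransform v ω h g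

/-- The norm `‖h‖ = ‖v exp(ω |·|) h^∨‖_{L²}` of `W²_v(S_ω)`, with value `∞` outside of the space
(`g = h^∨` is unique almost everywhere, so the infimum is over one value). -/
def sobolevENorm (v : ℝ → ℝ) (ω : ℝ) (h : ℂ → ℂ) : ℝ≥0∞ :=
  ⨅ (g : ℝ → ℂ) (_ : IsSobolevTransform v ω h g), eLpNorm (weighted v ω g) 2 volume

/-- The (extended) norm of the generalized Hörmander space `Hör²_v(S_ω; ψ)`. -/
def horENormWith (v : ℝ → ℝ) (ω : ℝ) (ψ f : ℂ → ℂ) : ℝ≥0∞ :=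
  ⨆ t : ℝ, sobolevENorm v ω (translate t ψ * f)

/-- Membership in the generalized Hörmander space `Hör²_v(S_ω; ψ)` with localizer `ψ`. -/
def MemHorWith (v : ℝ → ℝ) (ω : ℝ) (ψ f : ℂ → ℂ) : Prop :=
  (∀ t : ℝ, MemSobolev v ω (translate t ψ * f)) ∧ horENormWith v ω ψ f < ∞

/-- The generalized Hörmander space `Hör²_v(S_ω)`. -/
def MemHor (v : ℝ → ℝ) (ω : ℝ) (f : ℂ → ℂ) : Prop := MemHorWith v ω gaussian f

/-- The canonical norm of `Hör²_v(S_ω)`. -/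
def horNorm (v : ℝ → ℝ) (ω : ℝ) (f : ℂ → ℂ) : ℝ := (horENormWith v ω gaussian f).toReal

/-- The space `Hör²_v(ℝ)`, for functions on the real line. -/
def MemHorLine (v : ℝ → ℝ) (b : ℝ → ℂ) : Prop := MemHor v 0 (ofLine b)

/-- The norm of `Hör²_v(ℝ)`. -/
def horNormLine (v : ℝ → ℝ) (b : ℝ → ℂ) : ℝ := horNorm v 0 (ofLine b)

/-- `F` is a continuous function on the closed strip which extends `f` (for `ω = 0`: which is a
continuous representative of `f`). -/
structure IsContinuousExtension (ω : ℝ) (f F : ℂ → ℂ) : Prop where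
  continuousOn : ContinuousOn F (closedStrip ω)
  eq_on : f =ᶠ[stripFilter ω] F

/-- The space `H^∞(S_ω)` of bounded holomorphic functions. -/
def MemHInfty (ω : ℝ) (f : ℂ → ℂ) : Prop :=
  DifferentiableOn ℂ f (strip ω) ∧ ∃ C : ℝ, ∀ z ∈ strip ω, ‖f z‖ ≤ C

/-- The holomorphic Schwartz functions on `S_θ` (`θ > 0`). -/
def IsHolSchwartz (θ : ℝ) (φ : ℂ → ℂ) : Prop :=
  DifferentiableOn ℂ φ (strip θ) ∧
    ∀ α : ℝ, 0 < α → ∃ C : ℝ, ∀ z ∈ strip θ, ‖φ z‖ ≤ C / (1 + |z.re|) ^ α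

/-- `bp` and `bm` are the boundary values `f_{|ω}` and `f_{|-ω}` of `f ∈ H^∞(S_ω)`, `ω > 0`, as
limits along vertical lines at almost every boundary point. -/
def HasBoundaryValues (ω : ℝ) (f : ℂ → ℂ) (bp bm : ℝ → ℂ) : Prop :=
  (∀ᵐ s : ℝ, Tendsto (fun y : ℝ => ordinate f y s) (𝓝[<] ω) (𝓝 (bp s))) ∧
  (∀ᵐ s : ℝ, Tendsto (fun y : ℝ => ordinate f y s) (𝓝[>] (-ω)) (𝓝 (bm s)))

/-- The functions in `S`, identified when they are equal along the filter `l`, form a complex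
Banach algebra under pointwise operations and the norm `N`. -/
structure IsBanachFunctionAlgebra (l : Filter ℂ) (S : Set (ℂ → ℂ)) (N : (ℂ → ℂ) → ℝ) :
    Prop where
  congr : ∀ f ∈ S, ∀ g, f =ᶠ[l] g → g ∈ S ∧ N g = N f
  zero_mem : 0 ∈ S
  add_mem : ∀ f ∈ S, ∀ g ∈ S, f + g ∈ S
  smul_mem : ∀ (c : ℂ), ∀ f ∈ S, c • f ∈ S
  mul_mem : ∀ f ∈ S, ∀ g ∈ S, f * g ∈ S
  norm_nonneg : ∀ f ∈ S, 0 ≤ N f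
  norm_eq_zero : ∀ f ∈ S, N f = 0 → f =ᶠ[l] 0
  norm_add_le : ∀ f ∈ S, ∀ g ∈ S, N (f + g) ≤ N f + N g
  norm_smul : ∀ (c : ℂ), ∀ f ∈ S, N (c • f) = ‖c‖ * N f
  norm_mul_le : ∀ f ∈ S, ∀ g ∈ S, N (f * g) ≤ N f * N g
  complete : ∀ u : ℕ → ℂ → ℂ, (∀ n, u n ∈ S) →
    (∀ ε : ℝ, 0 < ε → ∃ n₀, ∀ m ≥ n₀, ∀ n ≥ n₀, N (u m - u n) < ε) →
    ∃ f ∈ S, Tendsto (fun n => N (u n - f)) atTop (𝓝 0)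

end

end HorStrip

/-! Everything is read off the local transforms g_t = (τ_t G · f)^∨, which lie in L²_{v,ω} with a
bound uniform in t. Since 1/v ∈ L², Cauchy–Schwarz puts e^{ω|s|} g_t in L¹. Hence the Fourier
integral of g_t converges up to the closed strip and has there a modulus of continuity depending
only on v and the norm. At a point z the choice t = Re z makes division by the Gaussian harmless.
This gives the extension F and a) (`IsHorFamily.enorm_le`, `IsHorFamily.uniformContinuousOn`).

The engine for c) and d) is the change of localizers `exists_localizer_bound`: if Φ is holomorphic
on a slightly wider strip, |Im z| < ω + ε, and decays quadratically about t₀, then (Φ F)^∨ lies in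
L²_{v,ω}, with a bound independent of t₀. One writes Φ F as a constant times ∫ (τ_t G Φ)(τ_t G F)
dt, so that the transforms convolve. Shifting contours shows that (τ_t G Φ)^∨(r) is of size
(1+(t-t₀)²)⁻¹ e^{-(ω+ε)|r|}. An admissible weight grows at most polynomially, so v(r) e^{-ε|r|} is
integrable, and Minkowski's inequality finishes.

For products, the Gaussian is split into two equal square roots, one for each factor, and L²_{v,ω}
is a convolution algebra because v is quasi-subadditive and 1/v ∈ L²
(`exists_weightedNorm_invFourier_mul_le`). For completeness, the extensions converge uniformly, so
the local transforms converge pointwise, and Fatou's lemma gives convergence in norm. The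
representation formula is the change of localizers for Φ = τ_z φ, evaluated at z.

For b), passing from the real line to Im z = σ multiplies a transform by e^{σs}. Moving the Gaussian
back to the real line costs a translation by 2σ and a constant, both bounded on L²_v. The norms are
equivalent because e^{ω|s|} dominates each of e^{±ωs} and is dominated by their sum. For the
converse the contour is moved to the edge of the strip by dominated convergence. -/

namespace HorStrip

noncomputable section

/-! ### Fourier inversion in the normalization e^{-isz} -/

/-- The Fourier transform `∫ g(s) exp(-i s z) ds` at a complex frequency. -/
def fourierC (g : ℝ → ℂ) (z : ℂ) : ℂ := ∫ s : ℝ, g s * Complex.exp (-Complex.I * s * z)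

/-- The inverse Fourier transform `(2π)⁻¹ ∫ h(x) exp(i s x) dx`. -/
def invFourier (h : ℝ → ℂ) (s : ℝ) : ℂ :=
  (2 * Real.pi : ℂ)⁻¹ * ∫ x : ℝ, h x * Complex.exp (Complex.I * s * x)

lemma fourierC_ofReal (g : ℝ → ℂ) (x : ℝ) : fourierC g x = 𝓕 g (x / (2 * Real.pi)) := by
  rw [fourierC, Real.fourier_real_eq_integral_exp_smul]
  congr 1; ext s
  rw [smul_eq_mul, mul_comm]
  congr 2
  push_cast
  field_simp

lemma integral_comp_two_pi (h : ℝ → ℂ) :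
    (2 * Real.pi : ℂ)⁻¹ * ∫ x : ℝ, h x = ∫ u : ℝ, h (2 * Real.pi * u) := by
  rw [Measure.integral_comp_mul_left h (2 * Real.pi), abs_of_pos (by positivity)]
  rw [Complex.real_smul]; push_cast; rfl

lemma invFourier_eq (h : ℝ → ℂ) : invFourier h = 𝓕⁻ (fun u : ℝ => h (2 * Real.pi * u)) := by
  ext s
  rw [invFourier, integral_comp_two_pi (fun x => h x * Complex.exp (Complex.I * s * x)),
    Real.fourierInv_eq']
  congr 1; ext u
  rw [smul_eq_mul, mul_comm]
  congr 2
  push_cast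
  simp [mul_comm]; ring

lemma integral_fourier_mul {f g : ℝ → ℂ} (hf : Integrable f) (hg : Integrable g) :
    ∫ x, 𝓕 f x * g x = ∫ x, f x * 𝓕 g x := by
  simpa using! (VectorFourier.integral_fourierIntegral_smul_eq_flip (L := innerₗ ℝ)
      Real.continuous_fourierChar continuous_inner hf hg)

lemma continuous_fourier {f : ℝ → ℂ} (hf : Integrable f) : Continuous (𝓕 f) :=
  VectorFourier.fourierIntegral_continuous Real.continuous_fourierChar
    (innerSL ℝ).continuous₂ hf

lemma ae_eq_of_integral_schwartz {f f' : ℝ → ℂ} (hf : LocallyIntegrable f)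
    (hf' : LocallyIntegrable f')
    (h : ∀ g : SchwartzMap ℝ ℂ, ∫ x, f x * g x = ∫ x, f' x * g x) : f =ᵐ[volume] f' := by
  apply ae_eq_of_integral_contDiff_smul_eq hf hf'
  intro g g_smooth g_cpt
  have hg₁ : HasCompactSupport (Complex.ofRealCLM ∘ g) := g_cpt.comp_left rfl
  have hg₂ : ContDiff ℝ ((⊤ : ℕ∞) : WithTop ℕ∞) (Complex.ofRealCLM ∘ g) := by fun_prop
  simpa [mul_comm] using h (hg₁.toSchwartzMap hg₂)

/-- **Fourier inversion** almost everywhere. -/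
lemma fourierInv_fourier_ae_eq {f : ℝ → ℂ} (hf : Integrable f) (h'f : Integrable (𝓕 f)) :
    𝓕⁻ (𝓕 f) =ᵐ[volume] f := by
  have hc : Continuous (𝓕⁻ (𝓕 f)) := by
    have : 𝓕⁻ (𝓕 f) = fun x => 𝓕 (𝓕 f) (-x) := by ext x; rw [Real.fourierInv_eq_fourier_neg]
    rw [this]
    exact (continuous_fourier h'f).comp continuous_neg
  apply ae_eq_of_integral_schwartz hc.locallyIntegrable hf.locallyIntegrable
  intro g
  have h1 : ∫ x, 𝓕⁻ (𝓕 f) x * g x = ∫ x, 𝓕 (𝓕 f) x * g (-x) := by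
    rw [← integral_neg_eq_self]
    simp [Real.fourierInv_eq_fourier_neg]
  -- Both transforms are moved onto the Schwartz test function, where inversion is available.
  rw [h1, integral_fourier_mul h'f (g.integrable.comp_neg),
    integral_fourier_mul hf]
  · congr 1; ext x
    rw [← Real.fourierInv_eq_fourier_comp_neg, ← SchwartzMap.fourierInv_coe,
      ← SchwartzMap.fourier_coe, FourierTransform.fourier_fourierInv_eq]
  · rw [← Real.fourierInv_eq_fourier_comp_neg, ← SchwartzMap.fourierInv_coe]
    exact SchwartzMap.integrable _

lemma integrable_comp_two_pi {h : ℝ → ℂ} (hh : Integrable h) :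
    Integrable fun u : ℝ => h (2 * Real.pi * u) :=
  hh.comp_mul_left' (by positivity)

lemma invFourier_fourierC_ae_eq {g : ℝ → ℂ} (hg : Integrable g)
    (h : Integrable fun x : ℝ => fourierC g x) :
    invFourier (fun x => fourierC g x) =ᵐ[volume] g := by
  have e : (fun u : ℝ => fourierC g ((2 * Real.pi * u : ℝ) : ℂ)) = 𝓕 g := by
    ext u; rw [fourierC_ofReal]; field_simp
  have h2 := integrable_comp_two_pi h
  rw [e] at h2
  rw [invFourier_eq, e]
  exact fourierInv_fourier_ae_eq hg h2

lemma fourierC_invFourier {h : ℝ → ℂ} (hc : Continuous h) (hi : Integrable h)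
    (h' : Integrable (invFourier h)) (x : ℝ) : fourierC (invFourier h) x = h x := by
  have hF : Integrable (𝓕 (fun u : ℝ => h (2 * Real.pi * u))) := by
    rw [invFourier_eq] at h'
    have := h'.comp_neg
    simpa [Real.fourierInv_eq_fourier_neg] using this
  rw [fourierC_ofReal, invFourier_eq,
    Continuous.fourier_fourierInv_eq (by fun_prop) (integrable_comp_two_pi hi) hF]
  field_simp

/-- The Fourier transform on `L²` is given by the integral formula on `L¹ ∩ L²`. -/
lemma fourier_toLp_ae_eq {g : ℝ → ℂ} (hg : MemLp g 2 (volume : Measure ℝ)) (hi : Integrable g) :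
    (𝓕 (hg.toLp g) : Lp ℂ 2 (volume : Measure ℝ)) =ᵐ[volume] 𝓕 g := by
  apply ae_eq_of_integral_schwartz ((Lp.memLp _).locallyIntegrable (by norm_num))
    (continuous_fourier hi).locallyIntegrable
  intro φ
  -- The two transforms are compared as tempered distributions: on a test function φ both equal the
  -- integral of g against the transform of φ.
  have h1 := congrArg (fun T => T φ) (Lp.fourier_toTemperedDistribution_eq (hg.toLp g))
  simp only [TemperedDistribution.fourier_apply, Lp.toTemperedDistribution_apply,
    smul_eq_mul] at h1
  rw [integral_fourier_mul hi φ.integrable]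
  simp_rw [mul_comm _ (φ _)]
  rw [← h1]
  apply integral_congr_ae
  filter_upwards [hg.coeFn_toLp] with x hx
  rw [hx, SchwartzMap.fourier_coe, mul_comm]

/-- Integrability lets the L² transform be computed by the integral, so that from here on the cases
ω = 0 and ω > 0 are one statement about `stripFilter`. -/
lemma isFourierOnStrip_iff {ω : ℝ} {g : ℝ → ℂ} {h : ℂ → ℂ} (hg : MemLp g 2 (volume : Measure ℝ))
    (hi : Integrable g) : IsFourierOnStrip ω g h ↔ h =ᶠ[stripFilter ω] fourierC g := by
  unfold IsFourierOnStrip stripFilter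
  split_ifs with h0
  · have key : ∀ᵐ x : ℝ, (𝓕 (hg.toLp g) : Lp ℂ 2 (volume : Measure ℝ)) (x / (2 * Real.pi)) =
        fourierC g x := by
      -- Rescaling by (2π)⁻¹ preserves null sets, so the almost everywhere identity can be pulled
      -- back.
      have hq : Measure.QuasiMeasurePreserving (fun x : ℝ => x * (2 * Real.pi)⁻¹) :=
        ⟨by fun_prop, by
          rw [Real.map_volume_mul_right (by positivity)]
          exact Measure.smul_absolutelyContinuous⟩
      filter_upwards [hq.ae (fourier_toLp_ae_eq hg hi)] with x hx
      rw [fourierC_ofReal, div_eq_mul_inv, hx]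
    rw [EventuallyEq, eventually_map]
    constructor
    · rintro ⟨hg', H⟩
      filter_upwards [H, key] with x h1 h2
      rw [h1, ← h2]
    · intro H
      refine ⟨hg, ?_⟩
      filter_upwards [H, key] with x h1 h2
      rw [h1, ← h2]
  · rw [EventuallyEq, eventually_principal]; rfl

/-! ### Growth of admissible weights -/

section Weights

variable {v : ℝ → ℝ}

lemma IsAdmissible.pos (hv : IsAdmissible v) (s : ℝ) : 0 < v s := by linarith [hv.one_le s]

lemma IsAdmissible.exists_subadditive (hv : IsAdmissible v) :
    ∃ M : ℝ, 1 ≤ M ∧ ∀ s t, v (s + t) ≤ M * (v s + v t) := by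
  obtain ⟨M, hM⟩ := hv.quasi_subadditive
  refine ⟨max M 1, le_max_right _ _, fun s t => (hM s t).trans ?_⟩
  have := hv.pos s
  have := hv.pos t
  gcongr
  exact le_max_left _ _

/-- Admissible weights are quasi-submultiplicative. -/
lemma IsAdmissible.exists_submultiplicative (hv : IsAdmissible v) :
    ∃ M : ℝ, 1 ≤ M ∧ ∀ s t, v (s + t) ≤ M * (v s * v t) := by
  obtain ⟨M, hM1, hM⟩ := hv.exists_subadditive
  refine ⟨2 * M, by linarith, fun s t => (hM s t).trans ?_⟩
  have h1 := hv.one_le s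
  have h2 := hv.one_le t
  rw [mul_assoc, mul_left_comm]
  gcongr
  nlinarith

/-- Admissible weights are locally bounded. -/
lemma IsAdmissible.locally_bounded (hv : IsAdmissible v) {R : ℝ} (hR : 0 < R) :
    ∃ K : ℝ, ∀ t, |t| ≤ R → v t ≤ K := by
  obtain ⟨M, hM1, hM⟩ := hv.exists_subadditive
  -- A Steinhaus-type argument: for large N the set where v > N has measure less than R in the
  -- window [-2R, 2R]. It and its reflection r ↦ t - r therefore cannot cover [-R, R], and some s
  -- has both v(s) and v(t - s) at most N. The window is doubled because t - s ranges over [-2R,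
  -- 2R].
  set E : ℕ → Set ℝ := fun N => {s | s ∈ Set.Icc (-(2 * R)) (2 * R) ∧ (N : ℝ) < v s} with hE
  have hEm : ∀ N, MeasurableSet (E N) := fun N =>
    measurableSet_Icc.inter (measurableSet_lt measurable_const hv.measurable)
  have hlim : Tendsto (fun N => volume (E N)) atTop (𝓝 (volume (⋂ N, E N))) := by
    apply tendsto_measure_iInter_atTop (fun N => (hEm N).nullMeasurableSet)
    · intro m n hmn s hs
      exact ⟨hs.1, lt_of_le_of_lt (by exact_mod_cast hmn) hs.2⟩
    · refine ⟨0, ne_top_of_le_ne_top ?_ (measure_mono (fun s hs => hs.1))⟩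
      simp
  have hemp : (⋂ N, E N) = ∅ := by
    ext s
    simp only [Set.mem_iInter, Set.mem_empty_iff_false, iff_false, not_forall]
    obtain ⟨N, hN⟩ := exists_nat_gt (v s)
    exact ⟨N, fun h => absurd h.2 (by linarith)⟩
  rw [hemp, measure_empty] at hlim
  obtain ⟨N, hN⟩ := (hlim.eventually (gt_mem_nhds (show (0 : ℝ≥0∞) < ENNReal.ofReal R by
    simpa using hR))).exists
  refine ⟨M * (N + N), fun t ht => ?_⟩
  have hpre : volume ((fun s => t - s) ⁻¹' E N) = volume (E N) :=
    (Measure.measurePreserving_sub_left volume t).measure_preimage (hEm N).nullMeasurableSet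
  have hlt : volume (E N ∪ (fun s => t - s) ⁻¹' E N) < volume (Set.Icc (-R) R) := by
    calc _ ≤ volume (E N) + volume ((fun s => t - s) ⁻¹' E N) := measure_union_le _ _
      _ < ENNReal.ofReal R + ENNReal.ofReal R := by
        rw [hpre]; exact ENNReal.add_lt_add hN hN
      _ = volume (Set.Icc (-R) R) := by
        rw [Real.volume_Icc, ← ENNReal.ofReal_add hR.le hR.le]; congr 1; ring
  obtain ⟨s, hs, hs'⟩ : ∃ s ∈ Set.Icc (-R) R, s ∉ E N ∪ (fun s => t - s) ⁻¹' E N := by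
    by_contra! hcon
    exact absurd (measure_mono (μ := volume) hcon) (not_le.2 hlt)
  simp only [Set.mem_union, not_or] at hs'
  obtain ⟨h1, h2⟩ := hs'
  rw [abs_le] at ht
  have h1' : v s ≤ N := by
    by_contra! hc
    exact h1 ⟨⟨by linarith [hs.1], by linarith [hs.2]⟩, hc⟩
  have h2' : v (t - s) ≤ N := by
    by_contra! hc
    exact h2 ⟨⟨by linarith [hs.2], by linarith [hs.1]⟩, hc⟩
  calc v t = v (s + (t - s)) := by ring_nf
    _ ≤ M * (v s + v (t - s)) := hM _ _
    _ ≤ _ := by gcongr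

/-- Admissible weights grow at most polynomially. -/
lemma IsAdmissible.exists_polynomial_bound (hv : IsAdmissible v) :
    ∃ K : ℝ, 0 ≤ K ∧ ∃ n : ℕ, ∀ s, v s ≤ K * (1 + |s|) ^ n := by
  obtain ⟨M, hM1, hM⟩ := hv.exists_subadditive
  obtain ⟨K, hK⟩ := hv.locally_bounded one_pos
  -- Halving the argument costs the factor 2M < 2^n, so each dyadic scale contributes a factor 2^n
  -- and the growth has degree at most n.
  obtain ⟨n, hn⟩ := pow_unbounded_of_one_lt (2 * M) (one_lt_two (α := ℝ))
  have hK0 : 0 ≤ K := (hv.pos 0).le.trans (hK 0 (by simp))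
  have key : ∀ k : ℕ, ∀ s, |s| ≤ 2 ^ k → v s ≤ K * (2 ^ n) ^ k := by
    intro k
    induction k with
    | zero => intro s hs; simpa using hK s (by simpa using hs)
    | succ k ih =>
      intro s hs
      have h2 : |s / 2| ≤ 2 ^ k := by
        rw [abs_div, abs_two, div_le_iff₀ two_pos, ← pow_succ]; exact hs
      calc v s = v (s / 2 + s / 2) := by ring_nf
        _ ≤ M * (v (s / 2) + v (s / 2)) := hM _ _
        _ = 2 * M * v (s / 2) := by ring
        _ ≤ 2 ^ n * (K * (2 ^ n) ^ k) := by
          gcongr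
          · exact (hv.pos _).le
          · exact ih _ h2
        _ = _ := by ring
  refine ⟨K * 2 ^ n, by positivity, n, fun s => ?_⟩
  obtain ⟨k, hk1, hk2⟩ := exists_nat_pow_near (x := 1 + |s|) (by simp) (one_lt_two (α := ℝ))
  calc v s ≤ K * (2 ^ n) ^ (k + 1) := key _ _ (by linarith)
    _ = K * 2 ^ n * (2 ^ k) ^ n := by rw [pow_succ, pow_right_comm]; ring
    _ ≤ _ := by gcongr

lemma IsAdmissible.exists_exp_bound (hv : IsAdmissible v) {ε : ℝ} (hε : 0 < ε) :
    ∃ C : ℝ, 0 ≤ C ∧ ∀ s, v s * Real.exp (-(ε * |s|)) ≤ C * (1 + s ^ 2)⁻¹ := by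
  obtain ⟨K, hK0, n, hK⟩ := hv.exists_polynomial_bound
  refine ⟨K * ((n + 2).factorial / ε ^ (n + 2) * Real.exp ε), by positivity, fun s => ?_⟩
  -- Of the power n + 2, the part n absorbs the growth of v and the remaining 2 yields the
  -- integrable factor (1 + s²)⁻¹.
  have hpow := Real.pow_div_factorial_le_exp (x := ε * (1 + |s|)) (by positivity) (n + 2)
  rw [div_le_iff₀ (by positivity), mul_pow] at hpow
  have h1 : (1 + |s|) ^ (n + 2) ≤
      (n + 2).factorial / ε ^ (n + 2) * Real.exp ε * Real.exp (ε * |s|) := by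
    rw [mul_assoc, ← Real.exp_add, div_mul_eq_mul_div, le_div_iff₀ (by positivity)]
    calc _ = ε ^ (n + 2) * (1 + |s|) ^ (n + 2) := by ring
      _ ≤ _ := hpow
      _ = _ := by ring_nf
  have h2 : 1 + s ^ 2 ≤ (1 + |s|) ^ 2 := by nlinarith [abs_nonneg s, sq_abs s]
  rw [Real.exp_neg, ← div_eq_mul_inv, ← div_eq_mul_inv, div_le_div_iff₀ (Real.exp_pos _)
    (by positivity)]
  calc v s * (1 + s ^ 2) ≤ (K * (1 + |s|) ^ n) * (1 + |s|) ^ 2 := by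
        gcongr
        · exact hK s
    _ = K * (1 + |s|) ^ (n + 2) := by ring
    _ ≤ _ := by rw [mul_assoc K]; gcongr

lemma IsAdmissible.integrable_mul_exp (hv : IsAdmissible v) {ε : ℝ} (hε : 0 < ε) :
    Integrable fun s => v s * Real.exp (-(ε * |s|)) := by
  obtain ⟨C, hC, h⟩ := hv.exists_exp_bound hε
  refine (integrable_inv_one_add_sq.const_mul C).mono' ?_ (Eventually.of_forall fun s => ?_)
  · exact (hv.measurable.mul (by fun_prop)).aestronglyMeasurable
  · rw [Real.norm_of_nonneg (mul_nonneg (hv.pos s).le (Real.exp_pos _).le)]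
    exact h s

end Weights

/-! ### The weighted L² spaces -/

section WeightedL2

variable {v : ℝ → ℝ} {ω : ℝ}

/-- The norm of the weighted space `L²_{v,ω}(ℝ)`. -/
def weightedNorm (v : ℝ → ℝ) (ω : ℝ) (g : ℝ → ℂ) : ℝ≥0∞ := eLpNorm (weighted v ω g) 2 volume

lemma aestronglyMeasurable_weighted (hv : IsAdmissible v) {g : ℝ → ℂ}
    (hg : AEStronglyMeasurable g) : AEStronglyMeasurable (weighted v ω g) := by
  refine AEStronglyMeasurable.mul ?_ hg
  have : Measurable fun s : ℝ => ((v s * Real.exp (ω * |s|) : ℝ) : ℂ) := by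
    have := hv.measurable
    fun_prop
  exact this.aestronglyMeasurable

lemma enorm_weighted (hv : IsAdmissible v) (g : ℝ → ℂ) (s : ℝ) :
    ‖weighted v ω g s‖ₑ = ENNReal.ofReal (v s * Real.exp (ω * |s|)) * ‖g s‖ₑ := by
  rw [weighted, enorm_mul, ← ofReal_norm, Complex.norm_real, Real.norm_of_nonneg
    (mul_nonneg (hv.pos s).le (Real.exp_pos _).le)]

lemma norm_weighted (hv : IsAdmissible v) (g : ℝ → ℂ) (s : ℝ) :
    ‖weighted v ω g s‖ = v s * Real.exp (ω * |s|) * ‖g s‖ := by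
  rw [weighted, norm_mul, Complex.norm_real, Real.norm_of_nonneg
    (mul_nonneg (hv.pos s).le (Real.exp_pos _).le)]

lemma memWeightedL2_of_lt_top (hv : IsAdmissible v) (hω : 0 ≤ ω) {g : ℝ → ℂ}
    (hg : AEStronglyMeasurable g) (h : weightedNorm v ω g < ∞) : MemWeightedL2 v ω g := by
  have h2 : MemLp (weighted v ω g) 2 volume := ⟨aestronglyMeasurable_weighted hv hg, h⟩
  refine ⟨h2.mono hg (Eventually.of_forall fun s => ?_), h2⟩
  rw [norm_weighted hv]
  have : 1 ≤ v s * Real.exp (ω * |s|) :=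
    one_le_mul_of_one_le_of_one_le (hv.one_le s) (Real.one_le_exp (by positivity))
  exact le_mul_of_one_le_left (norm_nonneg _) this

lemma MemWeightedL2.weightedNorm_lt_top {g : ℝ → ℂ} (hg : MemWeightedL2 v ω g) :
    weightedNorm v ω g < ∞ := hg.weighted_memLp.2

lemma weightedNorm_congr {g g' : ℝ → ℂ} (h : g =ᵐ[volume] g') :
    weightedNorm v ω g = weightedNorm v ω g' := by
  apply eLpNorm_congr_ae
  filter_upwards [h] with s hs
  rw [weighted, weighted, hs]

lemma weighted_add (g h : ℝ → ℂ) :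
    weighted v ω (g + h) = weighted v ω g + weighted v ω h := by
  ext s; simp [weighted, mul_add]

lemma weighted_smul (c : ℂ) (g : ℝ → ℂ) :
    weighted v ω (c • g) = c • weighted v ω g := by
  ext s; simp [weighted]; ring

lemma weightedNorm_add_le (hv : IsAdmissible v) {g h : ℝ → ℂ} (hg : AEStronglyMeasurable g)
    (hh : AEStronglyMeasurable h) :
    weightedNorm v ω (g + h) ≤ weightedNorm v ω g + weightedNorm v ω h := by
  rw [weightedNorm, weighted_add]
  exact eLpNorm_add_le (aestronglyMeasurable_weighted hv hg)
    (aestronglyMeasurable_weighted hv hh) (by norm_num)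

lemma weightedNorm_smul (c : ℂ) (g : ℝ → ℂ) :
    weightedNorm v ω (c • g) = ‖c‖ₑ * weightedNorm v ω g := by
  rw [weightedNorm, weighted_smul, eLpNorm_const_smul]; rfl

/-- Cauchy–Schwarz against the weight. -/
lemma lintegral_exp_mul_le (hv : IsAdmissible v) {g : ℝ → ℂ} (hg : AEStronglyMeasurable g)
    {a : ℝ → ℝ} (ha : Measurable a) (ha0 : ∀ s, 0 ≤ a s) :
    ∫⁻ s, ENNReal.ofReal (a s * Real.exp (ω * |s|)) * ‖g s‖ₑ ≤
      eLpNorm (fun s => a s * (v s)⁻¹) 2 volume * weightedNorm v ω g := by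
  have h := eLpNorm_smul_le_mul_eLpNorm (r := 1) (p := 2) (q := 2) (μ := (volume : Measure ℝ))
    (aestronglyMeasurable_weighted (ω := ω) hv hg)
    (φ := fun s => a s * (v s)⁻¹) (ha.mul hv.measurable.inv).aestronglyMeasurable
  rw [eLpNorm_one_eq_lintegral_enorm] at h
  refine le_trans (le_of_eq ?_) h
  congr 1; ext s
  have h0 := hv.pos s
  have h1 := ha0 s
  rw [Pi.smul_apply', enorm_smul, enorm_weighted hv, ← mul_assoc,
    Real.enorm_of_nonneg (by positivity), ← ENNReal.ofReal_mul (by positivity)]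
  congr 2
  field_simp

/-- The constant of the embedding of `L²_{v,ω}` into `L¹` with weight `exp(ω|s|)`. -/
def invWeightNorm (v : ℝ → ℝ) : ℝ≥0∞ := eLpNorm (fun s => (v s)⁻¹) 2 volume

lemma IsStronglyAdmissible.invWeightNorm_lt_top (hv : IsStronglyAdmissible v) :
    invWeightNorm v < ∞ := hv.inv_memLp.2

lemma lintegral_exp_mul_le' (hv : IsAdmissible v) {g : ℝ → ℂ} (hg : AEStronglyMeasurable g) :
    ∫⁻ s, ENNReal.ofReal (Real.exp (ω * |s|)) * ‖g s‖ₑ ≤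
      invWeightNorm v * weightedNorm v ω g := by
  simpa [invWeightNorm] using lintegral_exp_mul_le (ω := ω) hv hg
    (a := fun _ => 1) measurable_const (fun _ => zero_le_one)

lemma integrable_exp_mul (hv : IsStronglyAdmissible v) {g : ℝ → ℂ} (hg : MemWeightedL2 v ω g) :
    Integrable fun s => Real.exp (ω * |s|) * ‖g s‖ := by
  refine ⟨(by fun_prop : Continuous fun s : ℝ => Real.exp (ω * |s|)).aestronglyMeasurable.mul
    hg.memLp.1.norm, ?_⟩
  rw [hasFiniteIntegral_iff_enorm]
  refine lt_of_le_of_lt (le_of_eq ?_) ((lintegral_exp_mul_le' hv.toIsAdmissible hg.memLp.1).trans_lt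
    (ENNReal.mul_lt_top hv.invWeightNorm_lt_top hg.weightedNorm_lt_top))
  congr 1; ext s
  rw [enorm_mul, enorm_norm, ← ofReal_norm, Real.norm_of_nonneg (Real.exp_pos _).le]

end WeightedL2

/-! ### Fourier integrals on strips -/

section FourierC

variable {ω : ℝ} {g : ℝ → ℂ}

lemma norm_exp_kernel (s : ℝ) (z : ℂ) :
    ‖Complex.exp (-Complex.I * s * z)‖ = Real.exp (s * z.im) := by
  rw [Complex.norm_exp]; congr 1; simp

lemma norm_exp_kernel_le {z : ℂ} (hz : z ∈ closedStrip ω) (s : ℝ) :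
    ‖Complex.exp (-Complex.I * s * z)‖ ≤ Real.exp (ω * |s|) := by
  rw [norm_exp_kernel]
  refine Real.exp_le_exp.2 ?_
  calc s * z.im ≤ |s| * |z.im| := by rw [← abs_mul]; exact le_abs_self _
    _ ≤ |s| * ω := by gcongr; exact hz
    _ = _ := mul_comm _ _

lemma integrable_kernel (hg : AEStronglyMeasurable g)
    (hi : Integrable fun s => Real.exp (ω * |s|) * ‖g s‖) {z : ℂ} (hz : z ∈ closedStrip ω) :
    Integrable fun s : ℝ => g s * Complex.exp (-Complex.I * s * z) := by
  refine hi.mono' (hg.mul (Continuous.aestronglyMeasurable (by fun_prop)))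
    (Eventually.of_forall fun s => ?_)
  rw [norm_mul, mul_comm]
  gcongr
  exact norm_exp_kernel_le hz s

lemma integrable_of_exp (hω : 0 ≤ ω) (hg : AEStronglyMeasurable g)
    (hi : Integrable fun s => Real.exp (ω * |s|) * ‖g s‖) : Integrable g := by
  refine hi.mono' hg (Eventually.of_forall fun s => ?_)
  exact le_mul_of_one_le_left (norm_nonneg _) (Real.one_le_exp (by positivity))

lemma hasDerivAt_kernel (s : ℝ) (z : ℂ) :
    HasDerivAt (fun z : ℂ => Complex.exp (-Complex.I * s * z))
      (-Complex.I * s * Complex.exp (-Complex.I * s * z)) z := by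
  have := ((hasDerivAt_id z).const_mul (-Complex.I * s)).cexp
  simpa [mul_comm] using this

lemma convex_closedStrip (ω : ℝ) : Convex ℝ (closedStrip ω) := by
  have : closedStrip ω = Complex.imLm ⁻¹' Set.Icc (-ω) ω := by
    ext z; simp [closedStrip, abs_le]
  rw [this]
  exact (convex_Icc _ _).linear_preimage _

/-- The trivial bound and the mean value inequality are combined: the minimum tends to 0 with z - w
for each s and stays at most 2, which is what dominated convergence needs in `tendsto_modulus`. -/
lemma norm_kernel_sub_le {z w : ℂ} (hz : z ∈ closedStrip ω) (hw : w ∈ closedStrip ω) (s : ℝ) :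
    ‖Complex.exp (-Complex.I * s * z) - Complex.exp (-Complex.I * s * w)‖ ≤
      min 2 (|s| * ‖z - w‖) * Real.exp (ω * |s|) := by
  rw [min_mul_of_nonneg _ _ (Real.exp_pos _).le, le_min_iff]
  constructor
  · refine (norm_sub_le _ _).trans ?_
    linarith [norm_exp_kernel_le hz s, norm_exp_kernel_le hw s]
  · have := (convex_closedStrip ω).norm_image_sub_le_of_norm_hasDerivWithin_le
      (f := fun z : ℂ => Complex.exp (-Complex.I * s * z))
      (C := |s| * Real.exp (ω * |s|))
      (fun x _ => (hasDerivAt_kernel s x).hasDerivWithinAt) (fun x hx => by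
        rw [norm_mul, norm_mul, norm_neg, Complex.norm_I, one_mul, Complex.norm_real]
        exact mul_le_mul_of_nonneg_left (norm_exp_kernel_le hx s) (abs_nonneg s)) hw hz
    refine this.trans (le_of_eq (by ring))

/-- The Fourier transform of a function with exponential decay is holomorphic. -/
lemma differentiableOn_fourierC (hg : AEStronglyMeasurable g)
    (hi : Integrable fun s => Real.exp (ω * |s|) * ‖g s‖) :
    DifferentiableOn ℂ (fourierC g) {z | |z.im| < ω} := by
  intro z hz
  -- On the ball of radius r about z the kernel is at most e^{(ω-r)|s|}, and the factor |s| coming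
  -- from the derivative is absorbed by r⁻¹ e^{r|s|}.
  set r : ℝ := (ω - |z.im|) / 2 with hr
  have hr0 : 0 < r := by have : |z.im| < ω := hz; linarith
  have hb : ∀ w ∈ Metric.ball z r, |w.im| ≤ ω - r := by
    intro w hw
    have h1 : |w.im - z.im| < r := by
      have := Complex.abs_im_le_norm (w - z)
      rw [Metric.mem_ball, dist_eq_norm] at hw
      rw [Complex.sub_im] at this
      linarith
    have h2 : |w.im| ≤ |w.im - z.im| + |z.im| := by
      simpa using abs_add_le (w.im - z.im) z.im
    linarith
  have hzs : z ∈ closedStrip ω := (show |z.im| < ω from hz).le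
  refine (hasDerivAt_integral_of_dominated_loc_of_deriv_le (𝕜 := ℂ)
    (F := fun (w : ℂ) (s : ℝ) => g s * Complex.exp (-Complex.I * s * w))
    (F' := fun (w : ℂ) (s : ℝ) => g s * (-Complex.I * s * Complex.exp (-Complex.I * s * w)))
    (bound := fun s => r⁻¹ * (Real.exp (ω * |s|) * ‖g s‖))
    (Metric.ball_mem_nhds z hr0) (Eventually.of_forall fun w => ?_)
    (integrable_kernel hg hi hzs) ?_ (Eventually.of_forall fun s w hw => ?_)
    (hi.const_mul _) (Eventually.of_forall fun s w _ => (hasDerivAt_kernel s w).const_mul (g s))).2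
    |>.differentiableAt.differentiableWithinAt
  · exact hg.mul (Continuous.aestronglyMeasurable (by fun_prop))
  · exact hg.mul (Continuous.aestronglyMeasurable (by fun_prop))
  · rw [norm_mul, norm_mul, norm_mul, norm_neg, Complex.norm_I, one_mul, Complex.norm_real,
      mul_comm, ← mul_assoc]
    refine mul_le_mul_of_nonneg_right ?_ (norm_nonneg _)
    calc ‖s‖ * ‖Complex.exp (-Complex.I * s * w)‖
        ≤ (r⁻¹ * Real.exp (r * |s|)) * Real.exp ((ω - r) * |s|) := by
          gcongr
          · rw [inv_mul_eq_div, le_div_iff₀ hr0, Real.norm_eq_abs]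
            linarith [Real.add_one_le_exp (r * |s|)]
          · exact norm_exp_kernel_le (ω := ω - r) (hb w hw) s
      _ = _ := by rw [mul_assoc, ← Real.exp_add]; ring_nf

end FourierC

/-! ### A common modulus of continuity -/

section Modulus

variable {v : ℝ → ℝ} {ω : ℝ}

/-- A common modulus of continuity for Fourier transforms of the unit ball of `L²_{v,ω}`. -/
def modulus (v : ℝ → ℝ) (δ : ℝ) : ℝ≥0∞ :=
  eLpNorm (fun s => min 2 (|s| * δ) * (v s)⁻¹) 2 volume

/-- Dominated convergence with majorant 2/v, square integrable by strong admissibility. -/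
lemma tendsto_modulus (hv : IsStronglyAdmissible v) :
    Tendsto (modulus v) (𝓝[≥] 0) (𝓝 0) := by
  have h0 : (2 : ℝ≥0∞) ≠ 0 := by norm_num
  have h2 : (2 : ℝ≥0∞) ≠ ∞ := by norm_num
  have hA : Tendsto (fun δ : ℝ => ∫⁻ s, ‖min 2 (|s| * δ) * (v s)⁻¹‖ₑ ^ (2 : ℝ)) (𝓝[≥] 0)
      (𝓝 (∫⁻ _ : ℝ, 0)) := by
    refine tendsto_lintegral_filter_of_dominated_convergence
      (fun s => (2 * ‖(v s)⁻¹‖ₑ) ^ (2 : ℝ)) (Eventually.of_forall fun δ => ?_) ?_ ?_ ?_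
    · have := hv.measurable
      fun_prop
    · filter_upwards [self_mem_nhdsWithin] with δ hδ
      refine Eventually.of_forall fun s => ?_
      rw [enorm_mul]
      gcongr
      rw [← ofReal_norm, Real.norm_of_nonneg
        (le_min zero_le_two (mul_nonneg (abs_nonneg _) hδ))]
      calc ENNReal.ofReal (min 2 (|s| * δ)) ≤ ENNReal.ofReal 2 := by gcongr; exact min_le_left _ _
        _ = 2 := by simp
    · have h := hv.invWeightNorm_lt_top
      simp_rw [ENNReal.mul_rpow_of_nonneg _ _ zero_le_two]
      rw [lintegral_const_mul _ (by have := hv.measurable; fun_prop)]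
      refine ENNReal.mul_ne_top (by simp) ?_
      rw [invWeightNorm, eLpNorm_eq_lintegral_rpow_enorm_toReal h0 h2] at h
      simp only [ENNReal.toReal_ofNat] at h
      exact ((ENNReal.rpow_lt_top_iff_of_pos (by norm_num)).1 h).ne
    · refine Eventually.of_forall fun s => ?_
      have : Tendsto (fun δ : ℝ => ‖min 2 (|s| * δ) * (v s)⁻¹‖ₑ ^ (2 : ℝ)) (𝓝 0)
          (𝓝 (‖min 2 (|s| * 0) * (v s)⁻¹‖ₑ ^ (2 : ℝ))) := by
        apply Continuous.tendsto
        fun_prop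
      simp only [mul_zero, zero_le_two, inf_of_le_right, zero_mul, enorm_zero,
        ENNReal.zero_rpow_of_pos two_pos] at this
      exact this.mono_left nhdsWithin_le_nhds
  have hB := hA.ennrpow_const (1 / 2)
  simp only [lintegral_zero] at hB
  rw [ENNReal.zero_rpow_of_pos (by norm_num)] at hB
  refine hB.congr fun δ => ?_
  rw [modulus, eLpNorm_eq_lintegral_rpow_enorm_toReal h0 h2]
  simp

lemma enorm_fourierC_sub_le (hv : IsStronglyAdmissible v) {g : ℝ → ℂ} (hg : MemWeightedL2 v ω g)
    {z w : ℂ} (hz : z ∈ closedStrip ω) (hw : w ∈ closedStrip ω) :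
    ‖fourierC g z - fourierC g w‖ₑ ≤ modulus v ‖z - w‖ * weightedNorm v ω g := by
  have hi := integrable_exp_mul hv hg
  rw [fourierC, fourierC, ← integral_sub (integrable_kernel hg.memLp.1 hi hz)
    (integrable_kernel hg.memLp.1 hi hw)]
  refine (enorm_integral_le_lintegral_enorm _).trans (le_trans ?_
    (lintegral_exp_mul_le (a := fun s => min 2 (|s| * ‖z - w‖)) hv.toIsAdmissible hg.memLp.1
    (by fun_prop) (fun s => by positivity)))
  gcongr with s
  rw [← mul_sub, enorm_mul, mul_comm]
  gcongr
  rw [← ofReal_norm]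
  gcongr
  exact norm_kernel_sub_le hz hw s

lemma enorm_fourierC_le (hv : IsStronglyAdmissible v) {g : ℝ → ℂ} (hg : MemWeightedL2 v ω g)
    {z : ℂ} (hz : z ∈ closedStrip ω) :
    ‖fourierC g z‖ₑ ≤ invWeightNorm v * weightedNorm v ω g := by
  refine (enorm_integral_le_lintegral_enorm _).trans (le_trans ?_
    (lintegral_exp_mul_le' hv.toIsAdmissible hg.memLp.1))
  gcongr with s
  rw [enorm_mul, mul_comm]
  gcongr
  rw [← ofReal_norm]
  gcongr
  exact norm_exp_kernel_le hz s

lemma continuousOn_fourierC (hv : IsStronglyAdmissible v) {g : ℝ → ℂ}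
    (hg : MemWeightedL2 v ω g) : ContinuousOn (fourierC g) (closedStrip ω) := by
  intro z hz
  have hi := integrable_exp_mul hv hg
  refine continuousWithinAt_of_dominated
    (bound := fun s => Real.exp (ω * |s|) * ‖g s‖) (Eventually.of_forall fun w => ?_) ?_ hi
    (Eventually.of_forall fun s => by fun_prop)
  · exact hg.memLp.1.mul (Continuous.aestronglyMeasurable (by fun_prop))
  · filter_upwards [self_mem_nhdsWithin] with w hw
    refine Eventually.of_forall fun s => ?_
    rw [norm_mul, mul_comm]
    gcongr
    exact norm_exp_kernel_le hw s

end Modulus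

/-! ### Equality on the strip and on its closure -/

section StripFilter

variable {ω : ℝ}

lemma ofReal_mem_closedStrip (hω : 0 ≤ ω) (x : ℝ) : (x : ℂ) ∈ closedStrip ω := by
  simpa [closedStrip] using hω

lemma strip_eq (hω : 0 < ω) : strip ω = {z | |z.im| < ω} := by
  rw [strip, if_neg hω.ne']

lemma stripFilter_eq (hω : 0 < ω) : stripFilter ω = 𝓟 {z | |z.im| < ω} := by
  rw [stripFilter, if_neg hω.ne', strip_eq hω]

lemma isOpen_openStrip (ω : ℝ) : IsOpen {z : ℂ | |z.im| < ω} :=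
  isOpen_lt (by fun_prop) continuous_const

lemma closedStrip_subset_closure (hω : 0 < ω) : closedStrip ω ⊆ closure {z : ℂ | |z.im| < ω} := by
  have h1 : {z : ℂ | |z.im| < ω} = Complex.im ⁻¹' Set.Ioo (-ω) ω := by
    ext z; exact abs_lt (α := ℝ)
  intro z hz
  rw [h1, ← Complex.isOpenMap_im.preimage_closure_eq_closure_preimage Complex.continuous_im,
    closure_Ioo (by linarith)]
  exact abs_le.1 hz

lemma continuous_comp_ofReal (hω : 0 ≤ ω) {F : ℂ → ℂ} (hF : ContinuousOn F (closedStrip ω)) :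
    Continuous fun x : ℝ => F x :=
  hF.comp_continuous Complex.continuous_ofReal (ofReal_mem_closedStrip hω)

/-- Equality in `S_ω` of functions that are continuous on the closed strip extends to the closed
strip. -/
lemma eqOn_closedStrip (hω : 0 ≤ ω) {A B : ℂ → ℂ} (hA : ContinuousOn A (closedStrip ω))
    (hB : ContinuousOn B (closedStrip ω)) (h : A =ᶠ[stripFilter ω] B) :
    Set.EqOn A B (closedStrip ω) := by
  rcases hω.eq_or_lt with rfl | hpos
  · rw [stripFilter, if_pos rfl, EventuallyEq, eventually_map] at h
    have h2 := ((continuous_comp_ofReal le_rfl hA).ae_eq_iff_eq volume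
      (continuous_comp_ofReal le_rfl hB)).1 h
    intro z hz
    have hz0 : z.im = 0 := by simpa [closedStrip] using hz
    have : z = (z.re : ℂ) := by apply Complex.ext <;> simp [hz0]
    rw [this]
    exact congrFun h2 z.re
  · rw [stripFilter_eq hpos, EventuallyEq, eventually_principal] at h
    exact Set.EqOn.of_subset_closure h hA hB (fun z hz => (show |z.im| < ω from hz).le)
      (closedStrip_subset_closure hpos)

lemma eventuallyEq_of_eqOn (hω : 0 ≤ ω) {A B : ℂ → ℂ} (h : Set.EqOn A B (closedStrip ω)) :
    A =ᶠ[stripFilter ω] B := by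
  rcases hω.eq_or_lt with rfl | hpos
  · rw [stripFilter, if_pos rfl, EventuallyEq, eventually_map]
    exact Eventually.of_forall fun x => h (ofReal_mem_closedStrip le_rfl x)
  · rw [stripFilter_eq hpos, EventuallyEq, eventually_principal]
    intro z hz
    exact h (show |z.im| < ω from hz).le

end StripFilter

/-! ### Uniqueness of the inverse transform -/

section Sobolev

variable {v : ℝ → ℝ} {ω : ℝ}

lemma MemWeightedL2.integrable (hv : IsStronglyAdmissible v) (hω : 0 ≤ ω) {g : ℝ → ℂ}
    (hg : MemWeightedL2 v ω g) : Integrable g :=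
  integrable_of_exp hω hg.memLp.1 (integrable_exp_mul hv hg)

lemma isSobolevTransform_iff (hv : IsStronglyAdmissible v) (hω : 0 ≤ ω) {h : ℂ → ℂ} {g : ℝ → ℂ} :
    IsSobolevTransform v ω h g ↔ MemWeightedL2 v ω g ∧ h =ᶠ[stripFilter ω] fourierC g :=
  and_congr_right fun hg => isFourierOnStrip_iff hg.memLp (hg.integrable hv hω)

lemma MemWeightedL2.congr {g g' : ℝ → ℂ} (hg : MemWeightedL2 v ω g) (h : g =ᵐ[volume] g') :
    MemWeightedL2 v ω g' := by
  refine ⟨hg.memLp.ae_eq h, hg.weighted_memLp.ae_eq ?_⟩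
  filter_upwards [h] with s hs
  rw [weighted, weighted, hs]

lemma fourierC_congr {g g' : ℝ → ℂ} (h : g =ᵐ[volume] g') : fourierC g = fourierC g' := by
  ext z
  apply integral_congr_ae
  filter_upwards [h] with s hs
  rw [hs]

lemma fourierC_sub {g g' : ℝ → ℂ} (hg : AEStronglyMeasurable g)
    (hi : Integrable fun s => Real.exp (ω * |s|) * ‖g s‖) (hg' : AEStronglyMeasurable g')
    (hi' : Integrable fun s => Real.exp (ω * |s|) * ‖g' s‖) {z : ℂ} (hz : z ∈ closedStrip ω) :
    fourierC (g - g') z = fourierC g z - fourierC g' z := by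
  rw [fourierC, fourierC, fourierC, ← integral_sub (integrable_kernel hg hi hz)
    (integrable_kernel hg' hi' hz)]
  simp [sub_mul]

lemma fourierC_add {g g' : ℝ → ℂ} (hg : AEStronglyMeasurable g)
    (hi : Integrable fun s => Real.exp (ω * |s|) * ‖g s‖) (hg' : AEStronglyMeasurable g')
    (hi' : Integrable fun s => Real.exp (ω * |s|) * ‖g' s‖) {z : ℂ} (hz : z ∈ closedStrip ω) :
    fourierC (g + g') z = fourierC g z + fourierC g' z := by
  rw [fourierC, fourierC, fourierC, ← integral_add (integrable_kernel hg hi hz)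
    (integrable_kernel hg' hi' hz)]
  simp [add_mul]

lemma fourierC_smul (c : ℂ) (g : ℝ → ℂ) (z : ℂ) : fourierC (c • g) z = c * fourierC g z := by
  rw [fourierC, fourierC, ← integral_const_mul]
  simp [mul_assoc]

/-- The Fourier transform is injective on `L¹`. -/
lemma ae_eq_of_fourierC_eq {g g' : ℝ → ℂ} (hg : Integrable g) (hg' : Integrable g')
    (h : ∀ x : ℝ, fourierC g x = fourierC g' x) : g =ᵐ[volume] g' := by
  have h0 : (fun x : ℝ => fourierC (g - g') x) = fun _ => 0 := by
    ext x
    rw [fourierC_sub (ω := 0) hg.1 (by simpa using hg.norm) hg'.1 (by simpa using hg'.norm)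
      (ofReal_mem_closedStrip le_rfl x), h x, sub_self]
  have h1 := invFourier_fourierC_ae_eq (hg.sub hg') (by
    rw [h0]; exact integrable_zero _ _ _)
  rw [h0] at h1
  filter_upwards [h1] with s hs
  simp only [invFourier, zero_mul, integral_zero, mul_zero, Pi.sub_apply] at hs
  exact (sub_eq_zero.1 hs.symm)

lemma IsSobolevTransform.ae_eq (hv : IsStronglyAdmissible v) (hω : 0 ≤ ω) {h : ℂ → ℂ}
    {g g' : ℝ → ℂ} (hg : IsSobolevTransform v ω h g) (hg' : IsSobolevTransform v ω h g') :
    g =ᵐ[volume] g' := by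
  rw [isSobolevTransform_iff hv hω] at hg hg'
  have h1 := eqOn_closedStrip hω (continuousOn_fourierC hv hg.1) (continuousOn_fourierC hv hg'.1)
    (hg.2.symm.trans hg'.2)
  exact ae_eq_of_fourierC_eq (hg.1.integrable hv hω) (hg'.1.integrable hv hω)
    fun x => h1 (ofReal_mem_closedStrip hω x)

lemma sobolevENorm_eq (hv : IsStronglyAdmissible v) (hω : 0 ≤ ω) {h : ℂ → ℂ} {g : ℝ → ℂ}
    (hg : IsSobolevTransform v ω h g) : sobolevENorm v ω h = weightedNorm v ω g := by
  apply le_antisymm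
  · exact iInf₂_le g hg
  · refine le_iInf₂ fun g' hg' => le_of_eq ?_
    exact weightedNorm_congr (hg.ae_eq hv hω hg')

end Sobolev

/-! ### Continuous extensions and families of local transforms -/

section Hormander

variable {v : ℝ → ℝ} {ω : ℝ}

/-- The canonical norm of `Hör²_v(S_ω)` with values in `[0, ∞]`. -/
def horENorm (v : ℝ → ℝ) (ω : ℝ) (f : ℂ → ℂ) : ℝ≥0∞ := horENormWith v ω gaussian f

/-- `g t` is the inverse Fourier transform of `τ_t G · F`, where `F` is continuous on the closed
strip. -/
structure IsHorFamily (v : ℝ → ℝ) (ω : ℝ) (F : ℂ → ℂ) (g : ℝ → ℝ → ℂ) : Prop where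
  continuousOn : ContinuousOn F (closedStrip ω)
  memWeightedL2 : ∀ t, MemWeightedL2 v ω (g t)
  eqOn : ∀ t : ℝ, ∀ z ∈ closedStrip ω, gaussian (z - t) * F z = fourierC (g t) z

lemma gaussian_ne_zero (z : ℂ) : gaussian z ≠ 0 := Complex.exp_ne_zero _

lemma continuous_gaussian : Continuous gaussian := by unfold gaussian; fun_prop

lemma differentiable_gaussian : Differentiable ℂ gaussian := by unfold gaussian; fun_prop

lemma MemHor.exists_transform {f : ℂ → ℂ} (hf : MemHor v ω f) :
    ∃ g : ℝ → ℝ → ℂ, ∀ t : ℝ, IsSobolevTransform v ω (translate t gaussian * f) (g t) :=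
  ⟨fun t => (hf.1 t).choose, fun t => (hf.1 t).choose_spec⟩

/-- The Gaussian has no zeros, so the single transform at t = 0 already determines an extension to
the closed strip. The identities for the other t then pass to the boundary by continuity. -/
lemma MemHor.exists_family (hv : IsStronglyAdmissible v) (hω : 0 ≤ ω) {f : ℂ → ℂ}
    (hf : MemHor v ω f) :
    ∃ F g, IsHorFamily v ω F g ∧ f =ᶠ[stripFilter ω] F := by
  obtain ⟨g, hg⟩ := hf.exists_transform
  simp_rw [isSobolevTransform_iff hv hω] at hg
  set F : ℂ → ℂ := fun z => (gaussian z)⁻¹ * fourierC (g 0) z with hF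
  have hfF : f =ᶠ[stripFilter ω] F := by
    filter_upwards [(hg 0).2] with z hz
    rw [hF]
    simp only [← hz, Pi.mul_apply, translate, Complex.ofReal_zero, sub_zero]
    rw [inv_mul_cancel_left₀ (gaussian_ne_zero z)]
  have hFc : ContinuousOn F (closedStrip ω) :=
    (continuous_gaussian.continuousOn.inv₀ fun z _ => gaussian_ne_zero z).mul
      (continuousOn_fourierC hv (hg 0).1)
  refine ⟨F, g, ⟨hFc, fun t => (hg t).1, fun t => ?_⟩, hfF⟩
  apply eqOn_closedStrip hω _ (continuousOn_fourierC hv (hg t).1)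
  · filter_upwards [(hg t).2, hfF] with z h1 h2
    rw [← h1, ← h2]; rfl
  · exact (continuous_gaussian.comp (by fun_prop : Continuous fun z : ℂ => z - t)).continuousOn.mul
      hFc

lemma IsHorFamily.isSobolevTransform (hv : IsStronglyAdmissible v) (hω : 0 ≤ ω) {f F : ℂ → ℂ}
    {g : ℝ → ℝ → ℂ} (hF : IsHorFamily v ω F g) (e : f =ᶠ[stripFilter ω] F) (t : ℝ) :
    IsSobolevTransform v ω (translate t gaussian * f) (g t) := by
  rw [isSobolevTransform_iff hv hω]
  refine ⟨hF.memWeightedL2 t, ?_⟩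
  filter_upwards [e, eventuallyEq_of_eqOn hω (hF.eqOn t)] with z h1 h2
  rw [← h2, Pi.mul_apply, h1]; rfl

lemma IsHorFamily.horENorm_eq (hv : IsStronglyAdmissible v) (hω : 0 ≤ ω) {f F : ℂ → ℂ}
    {g : ℝ → ℝ → ℂ} (hF : IsHorFamily v ω F g) (e : f =ᶠ[stripFilter ω] F) :
    horENorm v ω f = ⨆ t, weightedNorm v ω (g t) :=
  iSup_congr fun t => sobolevENorm_eq hv hω (hF.isSobolevTransform hv hω e t)

lemma IsHorFamily.weightedNorm_le (hv : IsStronglyAdmissible v) (hω : 0 ≤ ω) {f F : ℂ → ℂ}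
    {g : ℝ → ℝ → ℂ} (hF : IsHorFamily v ω F g) (e : f =ᶠ[stripFilter ω] F) (t : ℝ) :
    weightedNorm v ω (g t) ≤ horENorm v ω f := by
  rw [hF.horENorm_eq hv hω e]
  exact le_iSup (fun t => weightedNorm v ω (g t)) t

lemma MemHor.horENorm_lt_top {f : ℂ → ℂ} (hf : MemHor v ω f) : horENorm v ω f < ∞ := hf.2

/-- A criterion for membership in the Hörmander space. -/
lemma memHor_of_forall (hv : IsStronglyAdmissible v) (hω : 0 ≤ ω) {f : ℂ → ℂ} {B : ℝ≥0∞}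
    (hB : B < ∞) (h : ∀ t : ℝ, ∃ g, IsSobolevTransform v ω (translate t gaussian * f) g ∧
      weightedNorm v ω g ≤ B) : MemHor v ω f ∧ horENorm v ω f ≤ B := by
  have : horENorm v ω f ≤ B := by
    refine iSup_le fun t => ?_
    obtain ⟨g, hg, hgB⟩ := h t
    rwa [sobolevENorm_eq hv hω hg]
  exact ⟨⟨fun t => ⟨_, (h t).choose_spec.1⟩, this.trans_lt hB⟩, this⟩

lemma MemHor.congr (hv : IsStronglyAdmissible v) (hω : 0 ≤ ω) {f f' : ℂ → ℂ}
    (hf : MemHor v ω f) (e : f =ᶠ[stripFilter ω] f') :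
    MemHor v ω f' ∧ horENorm v ω f' = horENorm v ω f := by
  obtain ⟨F, g, hF, hfF⟩ := hf.exists_family hv hω
  have e' := e.symm.trans hfF
  have h1 : horENorm v ω f' = horENorm v ω f := by
    rw [hF.horENorm_eq hv hω e', hF.horENorm_eq hv hω hfF]
  refine ⟨⟨fun t => ⟨_, hF.isSobolevTransform hv hω e' t⟩, ?_⟩, h1⟩
  exact h1.trans_lt hf.horENorm_lt_top

end Hormander

/-! ### Embedding into the bounded uniformly continuous functions -/

section Embedding

variable {v : ℝ → ℝ} {ω : ℝ} {f F : ℂ → ℂ} {g : ℝ → ℝ → ℂ}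

lemma gaussian_inv (z : ℂ) : (gaussian z)⁻¹ = Complex.exp (z ^ 2) := by
  rw [gaussian, ← Complex.exp_neg, neg_neg]

/-- Here (z - Re z)² = -(Im z)². Localizing at t = Re z therefore makes the inverse Gaussian bounded
by 1, uniformly in z. -/
lemma norm_exp_sq_sub_re_le (z : ℂ) : ‖Complex.exp ((z - z.re) ^ 2)‖ ≤ 1 := by
  rw [Complex.norm_exp, Real.exp_le_one_iff]
  simp [sq]
  nlinarith

lemma IsHorFamily.eq_exp_mul (hF : IsHorFamily v ω F g) (t : ℝ) {z : ℂ}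
    (hz : z ∈ closedStrip ω) : F z = Complex.exp ((z - t) ^ 2) * fourierC (g t) z := by
  rw [← hF.eqOn t z hz, ← gaussian_inv, inv_mul_cancel_left₀ (gaussian_ne_zero _)]

lemma IsHorFamily.enorm_le (hv : IsStronglyAdmissible v) (hF : IsHorFamily v ω F g)
    {B : ℝ≥0∞} (hB : ∀ t, weightedNorm v ω (g t) ≤ B) {z : ℂ} (hz : z ∈ closedStrip ω) :
    ‖F z‖ₑ ≤ invWeightNorm v * B := by
  rw [hF.eq_exp_mul z.re hz, enorm_mul]
  calc _ ≤ 1 * (invWeightNorm v * weightedNorm v ω (g z.re)) := by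
        gcongr
        · rw [← ofReal_norm, ← ENNReal.ofReal_one]
          exact ENNReal.ofReal_le_ofReal (norm_exp_sq_sub_re_le z)
        · exact enorm_fourierC_le hv (hF.memWeightedL2 _) hz
    _ ≤ _ := by rw [one_mul]; gcongr; exact hB _

lemma IsHorFamily.enorm_sub_le (hv : IsStronglyAdmissible v) (hF : IsHorFamily v ω F g)
    {B : ℝ≥0∞} (hB : ∀ t, weightedNorm v ω (g t) ≤ B) {z w : ℂ} (hz : z ∈ closedStrip ω)
    (hw : w ∈ closedStrip ω) :
    ‖F z - F w‖ₑ ≤ modulus v ‖z - w‖ * B +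
      invWeightNorm v * B * ‖Complex.exp ((z - z.re) ^ 2) - Complex.exp ((w - z.re) ^ 2)‖ₑ := by
  set t := z.re
  have e : F z - F w = Complex.exp ((z - t) ^ 2) * (fourierC (g t) z - fourierC (g t) w) +
      fourierC (g t) w * (Complex.exp ((z - t) ^ 2) - Complex.exp ((w - t) ^ 2)) := by
    rw [hF.eq_exp_mul t hz, hF.eq_exp_mul t hw]; ring
  rw [e]
  refine (enorm_add_le _ _).trans ?_
  rw [enorm_mul, enorm_mul]
  refine add_le_add ?_ (mul_le_mul_left ?_ _)
  · calc _ ≤ 1 * (modulus v ‖z - w‖ * weightedNorm v ω (g t)) := by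
          gcongr
          · rw [← ofReal_norm, ← ENNReal.ofReal_one]
            exact ENNReal.ofReal_le_ofReal (norm_exp_sq_sub_re_le z)
          · exact enorm_fourierC_sub_le hv (hF.memWeightedL2 _) hz hw
      _ ≤ _ := by rw [one_mul]; gcongr; exact hB _
  · refine (enorm_fourierC_le hv (hF.memWeightedL2 _) hw).trans ?_
    gcongr; exact hB _

lemma IsHorFamily.uniformContinuousOn (hv : IsStronglyAdmissible v) (hF : IsHorFamily v ω F g)
    {B : ℝ≥0∞} (hBt : B < ∞) (hB : ∀ t, weightedNorm v ω (g t) ≤ B) :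
    UniformContinuousOn F (closedStrip ω) := by
  rw [EMetric.uniformContinuousOn_iff]
  intro ε hε
  have h1 : Tendsto (fun δ => modulus v δ * B) (𝓝[≥] 0) (𝓝 0) := by
    simpa using ENNReal.Tendsto.mul_const (tendsto_modulus hv) (b := B) (Or.inr hBt.ne)
  have hε2 : 0 < ε / 2 := ENNReal.half_pos hε.ne'
  obtain ⟨δ₁, hδ₁, hm⟩ : ∃ δ₁ > 0, ∀ δ, 0 ≤ δ → δ < δ₁ → modulus v δ * B < ε / 2 := by
    have := h1.eventually (gt_mem_nhds hε2)
    rw [eventually_nhdsWithin_iff, Metric.eventually_nhds_iff] at this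
    obtain ⟨δ₁, h, H⟩ := this
    exact ⟨δ₁, h, fun δ h0 hδ => H (by simpa [abs_of_nonneg h0] using hδ) h0⟩
  set D := invWeightNorm v * B
  have hD : D < ∞ := ENNReal.mul_lt_top hv.invWeightNorm_lt_top hBt
  -- Recentred at Re z, both points lie in a fixed compact ball once |z - w| < 1, so the inverse
  -- Gaussians are uniformly close independently of Re z.
  have h2 : UniformContinuousOn (fun u : ℂ => Complex.exp (u ^ 2))
      (Metric.closedBall 0 (|ω| + 1)) :=
    (isCompact_closedBall _ _).uniformContinuousOn_of_continuous (by fun_prop)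
  rw [EMetric.uniformContinuousOn_iff] at h2
  -- The summand 1 keeps the divisor away from zero.
  have hη : 0 < ε / 2 / (D + 1) := ENNReal.div_pos hε2.ne' (by simp [hD.ne])
  obtain ⟨δ₂, hδ₂, he⟩ := h2 _ hη
  refine ⟨min (min (ENNReal.ofReal δ₁) δ₂) 1, by simp [hδ₁, hδ₂], fun {z} hz {w} hw hzw => ?_⟩
  rw [lt_min_iff, lt_min_iff] at hzw
  obtain ⟨⟨hzw1, hzw2⟩, hzw3⟩ := hzw
  rw [edist_eq_enorm_sub] at hzw1 hzw3 ⊢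
  have hn1 : ‖z - w‖ < δ₁ := by
    rwa [← ofReal_norm, ENNReal.ofReal_lt_ofReal_iff hδ₁] at hzw1
  have hn3 : ‖z - w‖ < 1 := by
    rwa [← ofReal_norm, ← ENNReal.ofReal_one, ENNReal.ofReal_lt_ofReal_iff one_pos] at hzw3
  have hzb : ‖z - z.re‖ ≤ |ω| := by
    have : z - z.re = z.im * Complex.I := by
      apply Complex.ext <;> simp
    rw [this, norm_mul, Complex.norm_I, mul_one, Complex.norm_real]
    exact le_trans hz (le_abs_self _)
  have hwb : ‖w - z.re‖ ≤ |ω| + 1 := by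
    have : w - z.re = (z - z.re) - (z - w) := by ring
    rw [this]
    exact (norm_sub_le _ _).trans (by linarith)
  have h3 := he (a := z - z.re) (by simpa using hzb.trans (by linarith))
    (b := w - z.re) (by simpa using hwb)
    (by rwa [edist_sub_right])
  rw [edist_eq_enorm_sub] at h3
  calc ‖F z - F w‖ₑ ≤ _ := hF.enorm_sub_le hv hB hz hw
    _ < ε / 2 + ε / 2 := by
      refine ENNReal.add_lt_add_of_lt_of_le ?_ (hm _ (norm_nonneg _) hn1) ?_
      · exact ENNReal.mul_ne_top hD.ne enorm_ne_top
      · calc _ ≤ (D + 1) * (ε / 2 / (D + 1)) := by gcongr; exact le_self_add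
          _ = ε / 2 := ENNReal.mul_div_cancel (by simp) (by simp [hD.ne])
    _ = ε := ENNReal.add_halves ε

end Embedding

/-! ### The identity theorem on strips -/

section Identity

lemma isPreconnected_openStrip (a : ℝ) : IsPreconnected {z : ℂ | |z.im| < a} := by
  have : {z : ℂ | |z.im| < a} = Complex.imLm ⁻¹' Set.Ioo (-a) a := by
    ext z; exact abs_lt (α := ℝ)
  rw [this]
  exact ((convex_Ioo _ _).linear_preimage _).isPreconnected

/-- The identity theorem: holomorphic functions on a strip that agree on the real line agree. -/
lemma eqOn_strip_of_eq_real {a : ℝ} (ha : 0 < a) {A B : ℂ → ℂ}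
    (hA : DifferentiableOn ℂ A {z | |z.im| < a}) (hB : DifferentiableOn ℂ B {z | |z.im| < a})
    (h : ∀ x : ℝ, A x = B x) : Set.EqOn A B {z | |z.im| < a} := by
  refine (hA.analyticOnNhd (isOpen_openStrip a)).eqOn_of_preconnected_of_frequently_eq
    (hB.analyticOnNhd (isOpen_openStrip a)) (isPreconnected_openStrip a) (z₀ := 0) (by simpa) ?_
  have ht : Tendsto (fun x : ℝ => (x : ℂ)) (𝓝[≠] 0) (𝓝[≠] 0) := by
    refine tendsto_nhdsWithin_of_tendsto_nhds_of_eventually_within _ ?_ ?_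
    · exact (Complex.continuous_ofReal.tendsto' 0 0 (by simp)).mono_left nhdsWithin_le_nhds
    · filter_upwards [self_mem_nhdsWithin] with x hx
      simpa using hx
  exact ht.frequently (Eventually.of_forall h).frequently

end Identity

/-! ### Contour shifts and exponential decay -/

section Contour

variable {a B t₀ : ℝ} {h : ℂ → ℂ}

lemma integrable_inv_one_add_sq_sub (t₀ : ℝ) : Integrable fun x : ℝ => (1 + (x - t₀) ^ 2)⁻¹ :=
  integrable_inv_one_add_sq.comp_sub_right t₀

lemma integral_inv_one_add_sq_sub (t₀ : ℝ) : ∫ x : ℝ, (1 + (x - t₀) ^ 2)⁻¹ = Real.pi := by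
  rw [integral_sub_right_eq_self (fun x : ℝ => (1 + x ^ 2)⁻¹), integral_univ_inv_one_add_sq]

lemma continuous_horizontal (hh : ContinuousOn h {z | |z.im| < a}) {y : ℝ} (hy : |y| < a) :
    Continuous fun x : ℝ => h (x + y * Complex.I) :=
  hh.comp_continuous (by fun_prop) fun x => by simpa using hy

lemma integrable_horizontal (hh : ContinuousOn h {z | |z.im| < a})
    (hb : ∀ z : ℂ, |z.im| < a → ‖h z‖ ≤ B * (1 + (z.re - t₀) ^ 2)⁻¹) {y : ℝ} (hy : |y| < a) :
    Integrable fun x : ℝ => h (x + y * Complex.I) := by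
  refine ((integrable_inv_one_add_sq_sub t₀).const_mul B).mono'
    (continuous_horizontal hh hy).aestronglyMeasurable (Eventually.of_forall fun x => ?_)
  simpa using hb (x + y * Complex.I) (by simpa using hy)

lemma tendsto_inv_one_add_sq_sub (t₀ : ℝ) {l : Filter ℝ} {u : ℝ → ℝ}
    (hu : Tendsto (fun x => |u x|) l atTop) :
    Tendsto (fun x => (1 + (u x - t₀) ^ 2)⁻¹) l (𝓝 0) := by
  refine tendsto_inv_atTop_zero.comp ?_
  refine tendsto_atTop_mono (f := fun x => |u x| - |t₀|) (fun x => ?_)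
    (tendsto_atTop_add_const_right _ _ hu)
  have := abs_sub_abs_le_abs_sub (u x) t₀
  nlinarith [sq_abs (u x - t₀), sq_nonneg (|u x - t₀| - 1)]

lemma tendsto_vertical (hb : ∀ z : ℂ, |z.im| < a → ‖h z‖ ≤ B * (1 + (z.re - t₀) ^ 2)⁻¹)
    {y : ℝ} (hy : |y| < a) {u : ℝ → ℝ} (hu : Tendsto (fun x => |u x|) atTop atTop) :
    Tendsto (fun T : ℝ => ∫ r in (0 : ℝ)..y, h (u T + r * Complex.I)) atTop (𝓝 0) := by
  refine squeeze_zero_norm (a := fun T => B * (1 + (u T - t₀) ^ 2)⁻¹ * |y - 0|) (fun T => ?_) ?_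
  · refine intervalIntegral.norm_integral_le_of_norm_le_const fun r hr => ?_
    have hr' : |r| < a := by
      refine lt_of_le_of_lt ?_ hy
      rw [Set.mem_uIoc] at hr
      rw [abs_le]
      rcases hr with hr | hr
      · constructor <;> linarith [hr.1, hr.2, le_abs_self y]
      · constructor <;> linarith [hr.1, hr.2, neg_abs_le y, abs_nonneg y]
    simpa using hb (u T + r * Complex.I) (by simpa using hr')
  · simpa using ((tendsto_inv_one_add_sq_sub t₀ hu).const_mul B).mul_const |y - 0|

/-- Shifting the line of integration in a strip. -/
lemma integral_horizontal_eq (hh : DifferentiableOn ℂ h {z | |z.im| < a})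
    (hb : ∀ z : ℂ, |z.im| < a → ‖h z‖ ≤ B * (1 + (z.re - t₀) ^ 2)⁻¹) {y : ℝ} (hy : |y| < a) :
    ∫ x : ℝ, h (x + y * Complex.I) = ∫ x : ℝ, h x := by
  have ha : |(0 : ℝ)| < a := by simpa using (abs_nonneg y).trans_lt hy
  have i0 : Integrable fun x : ℝ => h x := by
    simpa using integrable_horizontal hh.continuousOn hb ha
  have iy := integrable_horizontal hh.continuousOn hb hy
  have l0 := intervalIntegral_tendsto_integral i0 tendsto_neg_atTop_atBot tendsto_id
  have ly := intervalIntegral_tendsto_integral iy tendsto_neg_atTop_atBot tendsto_id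
  have lr := tendsto_vertical hb hy (u := fun T => T) tendsto_abs_atTop_atTop
  have ll := tendsto_vertical hb hy (u := fun T => -T) (by simpa using tendsto_abs_atTop_atTop)
  -- Cauchy's theorem on the rectangle over [-T, T] between heights 0 and y; the quadratic decay
  -- removes the vertical sides as T → ∞.
  have key : ∀ T : ℝ, (∫ x in (-T)..(id T), h x) - (∫ x in (-T)..(id T), h (x + y * Complex.I)) +
      Complex.I • (∫ r in (0 : ℝ)..y, h ((T : ℝ) + r * Complex.I)) -
      Complex.I • (∫ r in (0 : ℝ)..y, h ((-T : ℝ) + r * Complex.I)) = 0 := by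
    intro T
    have := Complex.integral_boundary_rect_eq_zero_of_differentiableOn h (-T : ℝ)
      (T + y * Complex.I) (hh.mono fun z hz => ?_)
    · simpa using this
    · have hz2 := hz.2
      simp only [Complex.ofReal_im, Complex.add_im, Complex.mul_im, Complex.ofReal_re,
        Complex.I_im, mul_one, Complex.I_re, mul_zero, add_zero, zero_add, Set.mem_preimage,
        Set.mem_uIcc] at hz2
      refine lt_of_le_of_lt ?_ hy
      rw [abs_le]
      rcases hz2 with hr | hr
      · constructor <;> linarith [hr.1, hr.2, le_abs_self y]
      · constructor <;> linarith [hr.1, hr.2, neg_abs_le y, abs_nonneg y]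
  have lim := ((l0.sub ly).add (lr.const_smul Complex.I)).sub (ll.const_smul Complex.I)
  simp only [smul_zero, add_zero, sub_zero] at lim
  have := tendsto_nhds_unique (lim.congr key) tendsto_const_nhds
  exact (sub_eq_zero.1 this).symm

/-- Applying the contour shift to h(z) e^{isz}, whose exponential on the line at height y carries
the extra factor e^{-sy}. The formula serves both the exponential decay and, in the limit y → ±ω,
the boundary values. -/
lemma invFourier_horizontal (hh : DifferentiableOn ℂ h {z | |z.im| < a})
    (hb : ∀ z : ℂ, |z.im| < a → ‖h z‖ ≤ B * (1 + (z.re - t₀) ^ 2)⁻¹) {y : ℝ} (hy : |y| < a)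
    (s : ℝ) : invFourier (fun x : ℝ => h (x + y * Complex.I)) s =
      Real.exp (s * y) * invFourier (fun x : ℝ => h x) s := by
  have hB : 0 ≤ B := by
    have := (norm_nonneg _).trans (hb (t₀ : ℂ) (by simpa using (abs_nonneg y).trans_lt hy))
    simpa using this
  have key := integral_horizontal_eq (h := fun z => h z * Complex.exp (Complex.I * s * z))
    (a := a) (B := B * Real.exp (|s| * a)) (t₀ := t₀) (hh.mul (by fun_prop)) (fun z hz => by
      have he : ‖Complex.exp (Complex.I * s * z)‖ ≤ Real.exp (|s| * a) := by
        rw [Complex.norm_exp]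
        refine Real.exp_le_exp.2 ?_
        simp only [Complex.mul_re, Complex.I_re, Complex.ofReal_re, zero_mul, Complex.I_im,
          Complex.ofReal_im, mul_zero, sub_self, Complex.mul_im, one_mul, zero_add, zero_sub]
        calc -(s * z.im) ≤ |s * z.im| := neg_le_abs _
          _ = |s| * |z.im| := abs_mul _ _
          _ ≤ _ := by gcongr
      rw [norm_mul]
      calc _ ≤ (B * (1 + (z.re - t₀) ^ 2)⁻¹) * Real.exp (|s| * a) :=
            mul_le_mul (hb z hz) he (norm_nonneg _) (by positivity)
        _ = _ := by ring) hy
  rw [invFourier, invFourier, ← key, mul_left_comm (Real.exp (s * y) : ℂ),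
    ← integral_const_mul (Real.exp (s * y) : ℂ)]
  congr 2; ext x
  rw [mul_left_comm, Complex.ofReal_exp, ← Complex.exp_add]
  congr 2
  push_cast
  linear_combination (-(s : ℂ) * y) * Complex.I_sq

/-- The constant is (2π)⁻¹ · Bπ. It depends neither on t₀ nor on s, which gives uniformity over
translates. -/
lemma norm_invFourier_le {h : ℝ → ℂ} (hb : ∀ x : ℝ, ‖h x‖ ≤ B * (1 + (x - t₀) ^ 2)⁻¹) (s : ℝ) :
    ‖invFourier h s‖ ≤ B / 2 := by
  have h1 : ‖∫ x : ℝ, h x * Complex.exp (Complex.I * s * x)‖ ≤ B * Real.pi := by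
    rw [← integral_inv_one_add_sq_sub t₀, ← integral_const_mul]
    refine norm_integral_le_of_norm_le ((integrable_inv_one_add_sq_sub t₀).const_mul B)
      (Eventually.of_forall fun x => ?_)
    rw [norm_mul, Complex.norm_exp]
    simpa using hb x
  rw [invFourier, norm_mul]
  have hp : ‖(2 * Real.pi : ℂ)⁻¹‖ = (2 * Real.pi)⁻¹ := by
    rw [norm_inv]; simp [abs_of_pos Real.pi_pos]
  rw [hp]
  calc _ ≤ (2 * Real.pi)⁻¹ * (B * Real.pi) := by gcongr
    _ = B / 2 := by field_simp

/-- Exponential decay of inverse Fourier transforms of holomorphic functions on strips. -/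
lemma norm_invFourier_le_exp (ha : 0 < a) (hh : DifferentiableOn ℂ h {z | |z.im| < a})
    (hb : ∀ z : ℂ, |z.im| < a → ‖h z‖ ≤ B * (1 + (z.re - t₀) ^ 2)⁻¹) (s : ℝ) :
    ‖invFourier (fun x : ℝ => h x) s‖ ≤ B / 2 * Real.exp (-(a * |s|)) := by
  have h1 : ∀ y, |y| < a →
      ‖invFourier (fun x : ℝ => h x) s‖ ≤ B / 2 * Real.exp (-(y * s)) := by
    intro y hy
    have e := invFourier_horizontal hh hb hy s
    have n := norm_invFourier_le (h := fun x : ℝ => h (x + y * Complex.I)) (B := B) (t₀ := t₀)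
      (fun x => by simpa using hb (x + y * Complex.I) (by simpa using hy)) s
    rw [e, norm_mul, Complex.norm_real, Real.norm_of_nonneg (Real.exp_pos _).le] at n
    rw [Real.exp_neg, ← div_eq_mul_inv, le_div_iff₀ (Real.exp_pos _), mul_comm, mul_comm y]
    exact n
  -- The line is moved to the side given by the sign of s. Since h is controlled only on the open
  -- strip, the exponent a itself is reached as the limit b → a.
  have h2 : ∀ b ∈ Set.Ioo 0 a,
      ‖invFourier (fun x : ℝ => h x) s‖ ≤ B / 2 * Real.exp (-(b * |s|)) := by
    intro b hb'
    rcases abs_cases s with ⟨hs, _⟩ | ⟨hs, _⟩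
    · rw [hs]; exact h1 b (by rw [abs_of_pos hb'.1]; exact hb'.2)
    · have := h1 (-b) (by rw [abs_neg, abs_of_pos hb'.1]; exact hb'.2)
      rw [hs]; simpa using this
  have lim : Tendsto (fun b => B / 2 * Real.exp (-(b * |s|))) (𝓝[<] a)
      (𝓝 (B / 2 * Real.exp (-(a * |s|)))) :=
    (Continuous.tendsto (by fun_prop) a).mono_left nhdsWithin_le_nhds
  refine ge_of_tendsto lim ?_
  filter_upwards [Ioo_mem_nhdsLT ha] with b hb'
  exact h2 b hb'

lemma continuous_invFourier {h : ℝ → ℂ} (hh : Integrable h) : Continuous (invFourier h) := by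
  rw [invFourier_eq]
  have : 𝓕⁻ (fun u : ℝ => h (2 * Real.pi * u)) =
      fun x => 𝓕 (fun u : ℝ => h (2 * Real.pi * u)) (-x) := by
    ext x; rw [Real.fourierInv_eq_fourier_neg]
  rw [this]
  exact (continuous_fourier (integrable_comp_two_pi hh)).comp continuous_neg

/-- If a holomorphic function on a strip is on the real line the Fourier transform of a function
with exponential decay, then it is so on the strip. -/
lemma fourierC_eqOn_strip {b : ℝ} (hb0 : 0 < b) {g : ℝ → ℂ} (hg : AEStronglyMeasurable g)
    (hi : Integrable fun s => Real.exp (b * |s|) * ‖g s‖)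
    (hh : DifferentiableOn ℂ h {z | |z.im| < b}) (he : ∀ x : ℝ, fourierC g x = h x) :
    Set.EqOn (fourierC g) h {z | |z.im| < b} :=
  eqOn_strip_of_eq_real hb0 (differentiableOn_fourierC hg hi) hh he

end Contour

/-! ### Cauchy–Schwarz and Minkowski for averages -/

section Averages

/-- Cauchy–Schwarz against a finite measure. -/
lemma sq_lintegral_le {Θ : Type*} [MeasurableSpace Θ] (m : Measure Θ) {f : Θ → ℝ≥0∞}
    (hf : Measurable f) : (∫⁻ θ, f θ ∂m) ^ 2 ≤ m Set.univ * ∫⁻ θ, f θ ^ 2 ∂m := by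
  have h := ENNReal.lintegral_mul_le_Lp_mul_Lq m Real.HolderConjugate.two_two
    (f := fun _ => 1) (g := f) aemeasurable_const hf.aemeasurable
  have hs : ∀ x : ℝ≥0∞, (x ^ (1 / 2 : ℝ)) ^ 2 = x := fun x => by
    rw [← ENNReal.rpow_natCast, ← ENNReal.rpow_mul]; norm_num
  calc (∫⁻ θ, f θ ∂m) ^ 2
      ≤ ((∫⁻ _, (1 : ℝ≥0∞) ^ (2 : ℝ) ∂m) ^ (1 / 2 : ℝ) *
          (∫⁻ θ, f θ ^ (2 : ℝ) ∂m) ^ (1 / 2 : ℝ)) ^ 2 := by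
        gcongr; simpa using h
    _ = _ := by
        rw [mul_pow, hs, hs]
        simp

/-- Minkowski's inequality for averages in `L²`. -/
lemma lintegral_sq_lintegral_le {Θ : Type*} [MeasurableSpace Θ] (m : Measure Θ) [SFinite m]
    {U : ℝ → Θ → ℝ≥0∞} (hU : Measurable (Function.uncurry U)) {D : ℝ≥0∞}
    (hD : ∀ θ, ∫⁻ s, U s θ ^ 2 ≤ D) :
    ∫⁻ s, (∫⁻ θ, U s θ ∂m) ^ 2 ≤ m Set.univ ^ 2 * D := by
  have hU2 : Measurable (Function.uncurry fun s θ => U s θ ^ 2) := hU.pow_const 2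
  calc ∫⁻ s, (∫⁻ θ, U s θ ∂m) ^ 2
      ≤ ∫⁻ s, m Set.univ * ∫⁻ θ, U s θ ^ 2 ∂m :=
        lintegral_mono fun s => sq_lintegral_le m hU.of_uncurry_left
    _ = m Set.univ * ∫⁻ s, ∫⁻ θ, U s θ ^ 2 ∂m :=
        lintegral_const_mul _ hU2.lintegral_prod_right'
    _ = m Set.univ * ∫⁻ θ, (∫⁻ s, U s θ ^ 2) ∂m := by
        rw [lintegral_lintegral_swap hU2.aemeasurable]
    _ ≤ m Set.univ * ∫⁻ _, D ∂m := by gcongr with θ; exact hD θ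
    _ = _ := by rw [lintegral_const]; ring

end Averages

/-! ### The weight v(s) e^{ω|s|} as an extended nonnegative function -/

section WeightFunction

variable {v : ℝ → ℝ} {ω : ℝ}

/-- The weight `v(s) exp(ω|s|)` with values in `[0, ∞]`. -/
def weightFn (v : ℝ → ℝ) (ω : ℝ) (s : ℝ) : ℝ≥0∞ := ENNReal.ofReal (v s * Real.exp (ω * |s|))

lemma measurable_weightFn (hv : IsAdmissible v) : Measurable (weightFn v ω) := by
  have := hv.measurable
  unfold weightFn
  fun_prop

lemma weightedNorm_sq (hv : IsAdmissible v) (g : ℝ → ℂ) :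
    weightedNorm v ω g ^ 2 = ∫⁻ s, (weightFn v ω s * ‖g s‖ₑ) ^ 2 := by
  have h := eLpNorm_nnreal_pow_eq_lintegral (f := weighted v ω g) (μ := volume) (p := 2)
    (by norm_num)
  simp only [NNReal.coe_ofNat, ENNReal.rpow_ofNat, ENNReal.coe_ofNat] at h
  rw [weightedNorm, h]
  simp_rw [enorm_weighted hv]
  rfl

lemma weightedNorm_le_of_sq (hv : IsAdmissible v) {g : ℝ → ℂ} {D : ℝ≥0∞}
    (h : ∫⁻ s, (weightFn v ω s * ‖g s‖ₑ) ^ 2 ≤ D ^ 2) : weightedNorm v ω g ≤ D := by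
  rw [← weightedNorm_sq hv] at h
  exact (ENNReal.pow_le_pow_left_iff two_ne_zero).1 h

lemma exp_abs_add_le (hω : 0 ≤ ω) (s t : ℝ) :
    Real.exp (ω * |s + t|) ≤ Real.exp (ω * |s|) * Real.exp (ω * |t|) := by
  rw [← Real.exp_add, ← mul_add]
  gcongr
  exact abs_add_le s t

lemma exists_weightFn_submultiplicative (hv : IsAdmissible v) (hω : 0 ≤ ω) :
    ∃ M : ℝ≥0∞, M < ∞ ∧ ∀ s t, weightFn v ω (s + t) ≤ M * (weightFn v ω s * weightFn v ω t) := by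
  obtain ⟨M, hM1, hM⟩ := hv.exists_submultiplicative
  refine ⟨ENNReal.ofReal M, ENNReal.ofReal_lt_top, fun s t => ?_⟩
  have h1 := hv.pos s
  have h2 := hv.pos t
  have h3 := hv.pos (s + t)
  rw [weightFn, weightFn, weightFn, ← ENNReal.ofReal_mul (by positivity),
    ← ENNReal.ofReal_mul (by positivity)]
  refine ENNReal.ofReal_le_ofReal ?_
  calc _ ≤ (M * (v s * v t)) * (Real.exp (ω * |s|) * Real.exp (ω * |t|)) :=
        mul_le_mul (hM s t) (exp_abs_add_le hω s t) (Real.exp_pos _).le (by positivity)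
    _ = _ := by ring

end WeightFunction

/-! ### Products and convolutions -/

section Products

/-- The inverse Fourier transform of a product with a Fourier transform is a convolution. -/
lemma invFourier_mul_fourierC {h g : ℝ → ℂ} (hh : Integrable h) (hg : Integrable g) (s : ℝ) :
    invFourier (fun x => h x * fourierC g x) s = ∫ r, g r * invFourier h (s - r) := by
  have e1 : ∀ x : ℝ, h x * fourierC g x * Complex.exp (Complex.I * s * x) =
      ∫ r : ℝ, (h x * g r) * Complex.exp (Complex.I * (s - r : ℝ) * x) := by
    intro x
    rw [fourierC, ← integral_const_mul, ← integral_mul_const]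
    congr 1; ext r
    have : Complex.exp (Complex.I * (s - r : ℝ) * x) =
        Complex.exp (-Complex.I * r * x) * Complex.exp (Complex.I * s * x) := by
      rw [← Complex.exp_add]; congr 1; push_cast; ring
    rw [this]; ring
  have hi : Integrable (Function.uncurry fun x r : ℝ =>
      (h x * g r) * Complex.exp (Complex.I * (s - r : ℝ) * x)) (volume.prod volume) := by
    refine (hh.mul_prod hg).mul_bdd (c := 1)
      (g := fun p : ℝ × ℝ => Complex.exp (Complex.I * (s - p.2 : ℝ) * p.1))
      (by fun_prop : Continuous _).aestronglyMeasurable (Eventually.of_forall fun p => ?_)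
    rw [Complex.norm_exp]; simp
  rw [invFourier]
  simp_rw [e1]
  rw [integral_integral_swap hi, ← integral_const_mul]
  congr 1; ext r
  rw [invFourier, mul_left_comm (g r), ← integral_const_mul (g r)]
  congr 2; ext x
  ring

end Products

/-! ### Explicit local transforms -/

section Reconstruction

variable {v : ℝ → ℝ} {ω : ℝ}

/-- A function on the closed strip that on the real line is the Fourier transform of
`g ∈ L²_{v,ω}` is so on the closed strip. -/
lemma fourierC_eqOn_closedStrip (hv : IsStronglyAdmissible v) (hω : 0 ≤ ω) {g : ℝ → ℂ}
    (hg : MemWeightedL2 v ω g) {H : ℂ → ℂ} (hc : ContinuousOn H (closedStrip ω))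
    (hd : DifferentiableOn ℂ H {z | |z.im| < ω}) (he : ∀ x : ℝ, fourierC g x = H x) :
    Set.EqOn (fourierC g) H (closedStrip ω) := by
  refine eqOn_closedStrip hω (continuousOn_fourierC hv hg) hc ?_
  rcases hω.eq_or_lt with rfl | hpos
  · rw [stripFilter, if_pos rfl, EventuallyEq, eventually_map]
    exact Eventually.of_forall he
  · rw [stripFilter_eq hpos, EventuallyEq, eventually_principal]
    exact fourierC_eqOn_strip hpos hg.memLp.1 (integrable_exp_mul hv hg) hd he

lemma fourierC_invFourier_eqOn_closedStrip (hv : IsStronglyAdmissible v) (hω : 0 ≤ ω)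
    {H : ℂ → ℂ} (hc : ContinuousOn H (closedStrip ω))
    (hd : DifferentiableOn ℂ H {z | |z.im| < ω}) (hi : Integrable fun x : ℝ => H x)
    (hg : MemWeightedL2 v ω (invFourier fun x : ℝ => H x)) :
    Set.EqOn (fourierC (invFourier fun x : ℝ => H x)) H (closedStrip ω) :=
  fourierC_eqOn_closedStrip hv hω hg hc hd
    (fourierC_invFourier (continuous_comp_ofReal hω hc) hi (hg.integrable hv hω))

lemma IsHorFamily.differentiableOn (hv : IsStronglyAdmissible v) {F : ℂ → ℂ} {g : ℝ → ℝ → ℂ}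
    (hF : IsHorFamily v ω F g) : DifferentiableOn ℂ F {z | |z.im| < ω} := by
  have h := differentiableOn_fourierC (hF.memWeightedL2 0).memLp.1
    (integrable_exp_mul hv (hF.memWeightedL2 0))
  have h2 : DifferentiableOn ℂ (fun z => Complex.exp ((z - (0 : ℝ)) ^ 2) * fourierC (g 0) z)
      {z | |z.im| < ω} := (by fun_prop : Differentiable ℂ fun z : ℂ =>
      Complex.exp ((z - (0 : ℝ)) ^ 2)).differentiableOn.mul h
  exact h2.congr fun z hz => hF.eq_exp_mul 0 (show |z.im| < ω from hz).le

lemma norm_gaussian_ofReal (x : ℝ) : ‖gaussian x‖ = Real.exp (-x ^ 2) := by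
  rw [gaussian, Complex.norm_exp]
  congr 1
  rw [← Complex.ofReal_pow, ← Complex.ofReal_neg, Complex.ofReal_re]

lemma exp_neg_sq_le (u : ℝ) : Real.exp (-u ^ 2) ≤ (1 + u ^ 2)⁻¹ := by
  rw [Real.exp_neg]
  gcongr
  linarith [Real.add_one_le_exp (u ^ 2)]

lemma norm_gaussian_le (z : ℂ) :
    ‖gaussian z‖ = Real.exp (z.im ^ 2) * Real.exp (-z.re ^ 2) := by
  rw [gaussian, Complex.norm_exp, ← Real.exp_add]
  congr 1
  simp [sq]; ring

lemma integrable_mul_of_decay {Φ : ℝ → ℂ} (hΦ : Continuous Φ) {A t₀ : ℝ}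
    (hA : ∀ x, ‖Φ x‖ ≤ A * (1 + (x - t₀) ^ 2)⁻¹) {F : ℝ → ℂ} (hF : Continuous F) {K : ℝ}
    (hK : ∀ x, ‖F x‖ ≤ K) : Integrable fun x => Φ x * F x := by
  refine ((integrable_inv_one_add_sq_sub t₀).const_mul (A * K)).mono'
    (hΦ.mul hF).aestronglyMeasurable (Eventually.of_forall fun x => ?_)
  rw [norm_mul]
  calc _ ≤ (A * (1 + (x - t₀) ^ 2)⁻¹) * K :=
        mul_le_mul (hA x) (hK x) (norm_nonneg _) ((norm_nonneg _).trans (hA x))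
    _ = _ := by ring

lemma norm_gaussian_sub_le (t x : ℝ) : ‖gaussian (x - t)‖ ≤ 1 * (1 + (x - t) ^ 2)⁻¹ := by
  rw [one_mul, ← Complex.ofReal_sub, norm_gaussian_ofReal]
  exact exp_neg_sq_le _

/-- The local inverse Fourier transforms `(τ_t G · F)^∨`. -/
def localTransform (F : ℂ → ℂ) (t : ℝ) : ℝ → ℂ :=
  invFourier fun x : ℝ => gaussian (x - t) * F x

lemma IsHorFamily.exists_bound (hv : IsStronglyAdmissible v) {F : ℂ → ℂ}
    {g : ℝ → ℝ → ℂ} (hF : IsHorFamily v ω F g) {B : ℝ≥0∞} (hBt : B < ∞)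
    (hB : ∀ t, weightedNorm v ω (g t) ≤ B) :
    ∀ z ∈ closedStrip ω, ‖F z‖ ≤ (invWeightNorm v * B).toReal := by
  intro z hz
  have h := hF.enorm_le hv hB hz
  rw [← toReal_enorm]
  exact ENNReal.toReal_mono (ENNReal.mul_ne_top hv.invWeightNorm_lt_top.ne hBt.ne) h

lemma integrable_gaussian_mul {F : ℝ → ℂ} (hF : Continuous F) {K : ℝ} (hK : ∀ x, ‖F x‖ ≤ K)
    (t : ℝ) : Integrable fun x : ℝ => gaussian (x - t) * F x :=
  integrable_mul_of_decay (continuous_gaussian.comp (by fun_prop)) (norm_gaussian_sub_le t) hF hK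

/-- The extension is bounded, so the Gaussian times F is integrable on ℝ and Fourier inversion
recovers g_t. -/
lemma IsHorFamily.localTransform_ae_eq (hv : IsStronglyAdmissible v) (hω : 0 ≤ ω) {F : ℂ → ℂ}
    {g : ℝ → ℝ → ℂ} (hF : IsHorFamily v ω F g) {B : ℝ≥0∞} (hBt : B < ∞)
    (hB : ∀ t, weightedNorm v ω (g t) ≤ B) (t : ℝ) : localTransform F t =ᵐ[volume] g t := by
  have hK := hF.exists_bound hv hBt hB
  have e : (fun x : ℝ => gaussian (x - t) * F x) = fun x : ℝ => fourierC (g t) x := by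
    ext x; exact hF.eqOn t x (ofReal_mem_closedStrip hω x)
  have hi := integrable_gaussian_mul (continuous_comp_ofReal hω hF.continuousOn)
    (fun x => hK x (ofReal_mem_closedStrip hω x)) t
  rw [localTransform, e]
  rw [e] at hi
  exact invFourier_fourierC_ae_eq ((hF.memWeightedL2 t).integrable hv hω) hi

lemma IsHorFamily.localTransform (hv : IsStronglyAdmissible v) (hω : 0 ≤ ω) {F : ℂ → ℂ}
    {g : ℝ → ℝ → ℂ} (hF : IsHorFamily v ω F g) {B : ℝ≥0∞} (hBt : B < ∞)
    (hB : ∀ t, weightedNorm v ω (g t) ≤ B) : IsHorFamily v ω F (localTransform F) := by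
  have h := hF.localTransform_ae_eq hv hω hBt hB
  refine ⟨hF.continuousOn, fun t => (hF.memWeightedL2 t).congr (h t).symm, fun t z hz => ?_⟩
  rw [hF.eqOn t z hz, fourierC_congr (h t)]

/-- The extension to the closed strip, with the canonical local transforms. -/
lemma MemHor.exists_localTransform (hv : IsStronglyAdmissible v) (hω : 0 ≤ ω) {f : ℂ → ℂ}
    (hf : MemHor v ω f) :
    ∃ F, IsHorFamily v ω F (localTransform F) ∧ f =ᶠ[stripFilter ω] F := by
  obtain ⟨F, g, hF, e⟩ := hf.exists_family hv hω
  exact ⟨F, hF.localTransform hv hω hf.horENorm_lt_top (hF.weightedNorm_le hv hω e), e⟩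

/-- Joint measurability in (t, s), needed for Tonelli in the change of localizers, is the reason for
replacing arbitrarily chosen transforms by the explicit integral. -/
lemma measurable_localTransform {F : ℂ → ℂ} (hF : Continuous fun x : ℝ => F x) :
    Measurable (Function.uncurry (HorStrip.localTransform F)) := by
  have h : StronglyMeasurable fun p : ℝ × ℝ => ∫ x : ℝ, gaussian (x - p.1) * F x *
      Complex.exp (Complex.I * p.2 * x) := by
    apply StronglyMeasurable.integral_prod_right
    refine Continuous.stronglyMeasurable ?_
    have h1 : Continuous fun p : (ℝ × ℝ) × ℝ => gaussian (p.2 - p.1.1) :=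
      continuous_gaussian.comp (by fun_prop)
    have h2 : Continuous fun p : (ℝ × ℝ) × ℝ => F p.2 := hF.comp continuous_snd
    exact (h1.mul h2).mul (by fun_prop)
  exact h.measurable.const_mul _

end Reconstruction

/-! ### Change of localizers -/

section Localizer

variable {v : ℝ → ℝ} {ω ε : ℝ}

/-- The constant `∫ G(t)² dt`. -/
def gaussianConst : ℝ := Real.sqrt (Real.pi / 2)

lemma gaussianConst_pos : 0 < gaussianConst := Real.sqrt_pos.2 (by positivity)

lemma integral_gaussian_sub_sq (x : ℝ) : ∫ t : ℝ, gaussian (x - t) ^ 2 = gaussianConst := by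
  have h1 : ∀ t : ℝ, gaussian (x - t) ^ 2 = ((Real.exp (-2 * (x - t) ^ 2) : ℝ) : ℂ) := by
    intro t
    rw [gaussian, ← Complex.exp_nat_mul, Complex.ofReal_exp]
    congr 1; push_cast; ring
  simp_rw [h1]
  rw [integral_complex_ofReal, integral_sub_left_eq_self (fun t => Real.exp (-2 * t ^ 2)),
    integral_gaussian, gaussianConst]

lemma integrable_gaussian_sq : Integrable fun t : ℝ => gaussian t ^ 2 := by
  refine (integrable_inv_one_add_sq).mono'
    ((continuous_gaussian.comp Complex.continuous_ofReal).pow 2).aestronglyMeasurable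
    (Eventually.of_forall fun t => ?_)
  rw [norm_pow, norm_gaussian_ofReal]
  have h1 := exp_neg_sq_le t
  have h2 : Real.exp (-t ^ 2) ≤ 1 := Real.exp_le_one_iff.2 (by nlinarith [sq_nonneg t])
  have h3 := Real.exp_pos (-t ^ 2)
  nlinarith

lemma gaussian_neg (z : ℂ) : gaussian (-z) = gaussian z := by simp [gaussian]

/-- Decomposition of an inverse Fourier transform by means of the Gaussian localizers. -/
lemma gaussianConst_mul_invFourier {H : ℝ → ℂ} (hH : Integrable H) (s : ℝ) :
    gaussianConst * invFourier H s =
      ∫ t : ℝ, invFourier (fun x => gaussian (x - t) ^ 2 * H x) s := by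
  have hHs : Integrable fun x : ℝ => H x * Complex.exp (Complex.I * s * x) := by
    refine hH.mul_bdd (c := 1) (by fun_prop : Continuous _).aestronglyMeasurable
      (Eventually.of_forall fun x => ?_)
    rw [Complex.norm_exp]; simp
  -- Fubini is justified because the integrand is that of the convolution of two integrable
  -- functions. The Gaussian is squared so that one copy can go to each factor of a product.
  have hi : Integrable (Function.uncurry fun t x : ℝ => gaussian (x - t) ^ 2 * H x *
      Complex.exp (Complex.I * s * x)) (volume.prod volume) := by
    refine (hHs.convolution_integrand (ContinuousLinearMap.mul ℂ ℂ)
      integrable_gaussian_sq).congr (Eventually.of_forall fun p => ?_)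
    simp only [ContinuousLinearMap.mul_apply', Function.uncurry]
    rw [← gaussian_neg]
    push_cast
    ring_nf
  simp_rw [invFourier]
  rw [integral_const_mul, integral_integral_swap hi, mul_left_comm, ← integral_const_mul]
  congr 2; ext x
  simp_rw [mul_assoc]
  rw [integral_mul_const, integral_gaussian_sub_sq]

/-- A Peetre-type inequality: it turns decay about t together with decay about t₀ into decay in t -
t₀. -/
lemma one_add_sq_sub_le (x t t₀ : ℝ) :
    1 + (t - t₀) ^ 2 ≤ 2 * ((1 + (x - t) ^ 2) * (1 + (x - t₀) ^ 2)) := by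
  nlinarith [sq_nonneg ((x - t) + (x - t₀)), mul_nonneg (sq_nonneg (x - t)) (sq_nonneg (x - t₀))]

lemma exp_neg_sq_le_sq (u : ℝ) : Real.exp (-u ^ 2) ≤ 2 * ((1 + u ^ 2)⁻¹ * (1 + u ^ 2)⁻¹) := by
  have h := Real.quadratic_le_exp_of_nonneg (sq_nonneg u)
  rw [Real.exp_neg, ← mul_inv, ← div_eq_mul_inv, inv_eq_one_div,
    div_le_div_iff₀ (Real.exp_pos _) (by positivity)]
  nlinarith

/-- The Gaussian supplies two factors (1 + (Re z - t)²)⁻¹. One is traded, together with the decay of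
Φ, for decay in t - t₀, which makes the average over t finite. The other keeps the decay in Re z
needed for contour shifts. -/
lemma norm_gaussian_mul_le {a A t₀ : ℝ} {Φ : ℂ → ℂ}
    (hA : ∀ z : ℂ, |z.im| < a → ‖Φ z‖ ≤ A * (1 + (z.re - t₀) ^ 2)⁻¹) (t : ℝ) {z : ℂ}
    (hz : |z.im| < a) :
    ‖gaussian (z - t) * Φ z‖ ≤
      (4 * Real.exp (a ^ 2) * A * (1 + (t - t₀) ^ 2)⁻¹) * (1 + (z.re - t) ^ 2)⁻¹ := by
  have hA0 : 0 ≤ A := by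
    have := (norm_nonneg _).trans (hA (t₀ : ℂ) (by simpa using (abs_nonneg _).trans_lt hz))
    simpa using this
  set u := z.re - t
  set p := (1 + u ^ 2)⁻¹
  set q := (1 + (z.re - t₀) ^ 2)⁻¹
  have h1 : p * q ≤ 2 * (1 + (t - t₀) ^ 2)⁻¹ := by
    rw [← mul_inv, ← div_eq_mul_inv, inv_eq_one_div,
      div_le_div_iff₀ (by positivity) (by positivity), one_mul]
    exact one_add_sq_sub_le z.re t t₀
  have h2 : ‖gaussian (z - t)‖ ≤ Real.exp (a ^ 2) * (2 * (p * p)) := by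
    rw [norm_gaussian_le]
    refine mul_le_mul (Real.exp_le_exp.2 ?_) ?_ (Real.exp_pos _).le (Real.exp_pos _).le
    · simp only [Complex.sub_im, Complex.ofReal_im, sub_zero]
      exact sq_le_sq' (by linarith [(abs_lt.1 hz).1]) (abs_lt.1 hz).2.le
    · simp only [Complex.sub_re, Complex.ofReal_re]
      exact exp_neg_sq_le_sq u
  rw [norm_mul]
  have hp : 0 ≤ p := by positivity
  calc _ ≤ (Real.exp (a ^ 2) * (2 * (p * p))) * (A * q) :=
        mul_le_mul h2 (hA z hz) (norm_nonneg _) (by positivity)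
    _ = Real.exp (a ^ 2) * 2 * A * p * (p * q) := by ring
    _ ≤ Real.exp (a ^ 2) * 2 * A * p * (2 * (1 + (t - t₀) ^ 2)⁻¹) := by gcongr
    _ = _ := by ring

/-- Used with a = ω + ε: the decay in r then beats the weight v(r) e^{ω|r|} and leaves the
integrable function v(r) e^{-ε|r|}. -/
lemma norm_localTransform_le {a A t₀ : ℝ} (ha : 0 < a) {Φ : ℂ → ℂ}
    (hd : DifferentiableOn ℂ Φ {z | |z.im| < a})
    (hA : ∀ z : ℂ, |z.im| < a → ‖Φ z‖ ≤ A * (1 + (z.re - t₀) ^ 2)⁻¹) (t r : ℝ) :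
    ‖localTransform Φ t r‖ ≤
      2 * Real.exp (a ^ 2) * A * (1 + (t - t₀) ^ 2)⁻¹ * Real.exp (-(a * |r|)) := by
  have h := norm_invFourier_le_exp ha (h := fun z => gaussian (z - t) * Φ z)
    (((differentiable_gaussian.comp (differentiable_id.sub_const (t : ℂ))).differentiableOn).mul hd)
    (fun z hz => norm_gaussian_mul_le hA t hz) r
  refine h.trans (le_of_eq (by ring))

/-- The weights `ρ(t) κ(r)` in the estimate of the change of localizers. -/
def averagingMeasure (v : ℝ → ℝ) (ε t₀ : ℝ) : Measure (ℝ × ℝ) :=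
  (volume.withDensity fun t => ENNReal.ofReal ((1 + (t - t₀) ^ 2)⁻¹)).prod
    (volume.withDensity fun r => ENNReal.ofReal (v r * Real.exp (-(ε * |r|))))

/-- The integral of `v(r) exp(-ε|r|)`. -/
def expWeightIntegral (v : ℝ → ℝ) (ε : ℝ) : ℝ≥0∞ :=
  ∫⁻ r, ENNReal.ofReal (v r * Real.exp (-(ε * |r|)))

lemma expWeightIntegral_lt_top (hv : IsAdmissible v) (hε : 0 < ε) :
    expWeightIntegral v ε < ∞ := (hv.integrable_mul_exp hε).lintegral_lt_top

lemma averagingMeasure_univ (v : ℝ → ℝ) (ε t₀ : ℝ) :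
    averagingMeasure v ε t₀ Set.univ = ENNReal.ofReal Real.pi * expWeightIntegral v ε := by
  rw [averagingMeasure, ← Set.univ_prod_univ, Measure.prod_prod,
    withDensity_apply _ MeasurableSet.univ, withDensity_apply _ MeasurableSet.univ,
    Measure.restrict_univ]
  congr 1
  rw [← ofReal_integral_eq_lintegral_ofReal (integrable_inv_one_add_sq_sub t₀)
    (Eventually.of_forall fun t => by positivity), integral_inv_one_add_sq_sub]

lemma lintegral_averagingMeasure (hv : IsAdmissible v) (ε t₀ : ℝ) {U : ℝ × ℝ → ℝ≥0∞}
    (hU : Measurable U) :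
    ∫⁻ θ, U θ ∂(averagingMeasure v ε t₀) = ∫⁻ t, ∫⁻ r,
      ENNReal.ofReal ((1 + (t - t₀) ^ 2)⁻¹) *
        (ENNReal.ofReal (v r * Real.exp (-(ε * |r|))) * U (t, r)) := by
  have m1 : Measurable fun r => ENNReal.ofReal (v r * Real.exp (-(ε * |r|))) := by
    have := hv.measurable
    fun_prop
  rw [averagingMeasure, lintegral_prod _ hU.aemeasurable,
    lintegral_withDensity_eq_lintegral_mul _ (by fun_prop) hU.lintegral_prod_right']
  congr 1; ext t
  rw [Pi.mul_apply, lintegral_withDensity_eq_lintegral_mul _ m1 (by fun_prop),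
    lintegral_const_mul]
  · rfl
  · fun_prop

/-- The pointwise estimate behind the change of localizers. -/
lemma weightFn_mul_enorm_invFourier_le (hv : IsStronglyAdmissible v) (hω : 0 ≤ ω) (hε : 0 < ε)
    {M : ℝ≥0∞} (hM : ∀ s t, weightFn v ω (s + t) ≤ M * (weightFn v ω s * weightFn v ω t))
    {F : ℂ → ℂ} (hF : IsHorFamily v ω F (localTransform F)) {K : ℝ}
    (hK : ∀ z ∈ closedStrip ω, ‖F z‖ ≤ K)
    {Φ : ℂ → ℂ} (hd : DifferentiableOn ℂ Φ {z | |z.im| < ω + ε}) {A t₀ : ℝ}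
    (hA : ∀ z : ℂ, |z.im| < ω + ε → ‖Φ z‖ ≤ A * (1 + (z.re - t₀) ^ 2)⁻¹) (s : ℝ) :
    weightFn v ω s * ‖invFourier (fun x : ℝ => Φ x * F x) s‖ₑ ≤
      (ENNReal.ofReal gaussianConst⁻¹ * M * ENNReal.ofReal (2 * Real.exp ((ω + ε) ^ 2)) *
        ENNReal.ofReal A) * ∫⁻ θ, weightFn v ω (s - θ.2) * ‖localTransform F θ.1 (s - θ.2)‖ₑ
          ∂(averagingMeasure v ε t₀) := by
  have ha : 0 < ω + ε := by linarith
  have hA0 : 0 ≤ A := by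
    have := (norm_nonneg _).trans (hA (t₀ : ℂ) (by simpa using ha))
    simpa using this
  have hFc := continuous_comp_ofReal hω hF.continuousOn
  have hΦc : Continuous fun x : ℝ => Φ x := by
    simpa using continuous_horizontal hd.continuousOn (y := 0) (by simpa using ha)
  have hKx : ∀ x : ℝ, ‖F x‖ ≤ K := fun x => hK x (ofReal_mem_closedStrip hω x)
  have hAx : ∀ x : ℝ, ‖Φ x‖ ≤ A * (1 + (x - t₀) ^ 2)⁻¹ := fun x => by
    simpa using hA x (by simpa using ha)
  have hi : Integrable fun x : ℝ => Φ x * F x := integrable_mul_of_decay hΦc hAx hFc hKx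
  have hΦb : ∀ x : ℝ, ‖Φ x‖ ≤ A := fun x => (hAx x).trans
    (mul_le_of_le_one_right hA0 (inv_le_one_of_one_le₀ (by nlinarith [sq_nonneg (x - t₀)])))
  -- the convolution formula
  have e1 : ∀ t : ℝ, invFourier (fun x : ℝ => gaussian (x - t) ^ 2 * (Φ x * F x)) s =
      ∫ r, localTransform F t r * localTransform Φ t (s - r) := by
    intro t
    have : (fun x : ℝ => gaussian (x - t) ^ 2 * (Φ x * F x)) = fun x : ℝ =>
        (gaussian (x - t) * Φ x) * fourierC (localTransform F t) x := by
      ext x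
      rw [← hF.eqOn t x (ofReal_mem_closedStrip hω x)]; ring
    rw [this, invFourier_mul_fourierC (integrable_gaussian_mul hΦc hΦb t)
      ((hF.memWeightedL2 t).integrable hv hω)]
    rfl
  have e2 : invFourier (fun x : ℝ => Φ x * F x) s = (gaussianConst⁻¹ : ℝ) *
      ∫ t : ℝ, ∫ r, localTransform F t r * localTransform Φ t (s - r) := by
    simp_rw [← e1]
    rw [← gaussianConst_mul_invFourier hi, ← mul_assoc, ← Complex.ofReal_mul,
      inv_mul_cancel₀ gaussianConst_pos.ne', Complex.ofReal_one, one_mul]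
  have e3 : ‖invFourier (fun x : ℝ => Φ x * F x) s‖ₑ ≤ ENNReal.ofReal gaussianConst⁻¹ *
      ∫⁻ t : ℝ, ∫⁻ r, ‖localTransform F t (s - r)‖ₑ * ‖localTransform Φ t r‖ₑ := by
    rw [e2, enorm_mul, ← ofReal_norm, Complex.norm_real,
      Real.norm_of_nonneg (inv_nonneg.2 gaussianConst_pos.le)]
    gcongr
    refine (enorm_integral_le_lintegral_enorm _).trans (lintegral_mono fun t => ?_)
    refine (enorm_integral_le_lintegral_enorm _).trans (le_of_eq ?_)
    rw [← lintegral_sub_left_eq_self _ s]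
    simp_rw [enorm_mul, sub_sub_cancel]
  have hm : Measurable fun θ : ℝ × ℝ =>
      weightFn v ω (s - θ.2) * ‖localTransform F θ.1 (s - θ.2)‖ₑ := by
    refine Measurable.mul ((measurable_weightFn hv.toIsAdmissible).comp (by fun_prop)) ?_
    exact ((measurable_localTransform hFc).comp
      (by fun_prop : Measurable fun θ : ℝ × ℝ => (θ.1, s - θ.2))).enorm
  have hm2 : ∀ t : ℝ, Measurable fun r : ℝ => ENNReal.ofReal ((1 + (t - t₀) ^ 2)⁻¹) *
        (ENNReal.ofReal (v r * Real.exp (-(ε * |r|))) *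
          (weightFn v ω (s - r) * ‖localTransform F t (s - r)‖ₑ)) := by
    intro t
    have h1 : Measurable fun r => ENNReal.ofReal (v r * Real.exp (-(ε * |r|))) := by
      have := hv.measurable
      fun_prop
    exact (h1.mul (hm.comp (by fun_prop : Measurable fun r : ℝ => (t, r)))).const_mul _
  rw [lintegral_averagingMeasure hv.toIsAdmissible ε t₀ hm]
  set D := 2 * Real.exp ((ω + ε) ^ 2) with hD
  have hD0 : 0 ≤ D := by positivity
  -- Submultiplicativity splits the weight at s = (s - r) + r: the part at s - r goes to the local
  -- transform of F, the part at r is absorbed by the exponential decay of that of Φ.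
  have key : ∀ t r : ℝ, weightFn v ω s *
      (‖localTransform F t (s - r)‖ₑ * ‖localTransform Φ t r‖ₑ) ≤
      (M * ENNReal.ofReal D * ENNReal.ofReal A) * (ENNReal.ofReal ((1 + (t - t₀) ^ 2)⁻¹) *
        (ENNReal.ofReal (v r * Real.exp (-(ε * |r|))) *
          (weightFn v ω (s - r) * ‖localTransform F t (s - r)‖ₑ))) := by
    intro t r
    have h0 := hv.pos r
    have h1 : weightFn v ω r * ‖localTransform Φ t r‖ₑ ≤ ENNReal.ofReal D * ENNReal.ofReal A *
        ENNReal.ofReal ((1 + (t - t₀) ^ 2)⁻¹) * ENNReal.ofReal (v r * Real.exp (-(ε * |r|))) := by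
      rw [weightFn, ← ofReal_norm, ← ENNReal.ofReal_mul (by positivity),
        ← ENNReal.ofReal_mul (by positivity), ← ENNReal.ofReal_mul (by positivity),
        ← ENNReal.ofReal_mul (by positivity)]
      refine ENNReal.ofReal_le_ofReal ?_
      calc _ ≤ v r * Real.exp (ω * |r|) *
            (D * A * (1 + (t - t₀) ^ 2)⁻¹ * Real.exp (-((ω + ε) * |r|))) := by
            gcongr
            exact norm_localTransform_le ha hd hA t r
        _ = D * A * (1 + (t - t₀) ^ 2)⁻¹ *
            (v r * (Real.exp (ω * |r|) * Real.exp (-((ω + ε) * |r|)))) := by ring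
        _ = _ := by rw [← Real.exp_add]; ring_nf
    calc _ ≤ (M * (weightFn v ω (s - r) * weightFn v ω r)) *
          (‖localTransform F t (s - r)‖ₑ * ‖localTransform Φ t r‖ₑ) := by
          gcongr
          simpa using hM (s - r) r
      _ = M * (weightFn v ω (s - r) * ‖localTransform F t (s - r)‖ₑ) *
          (weightFn v ω r * ‖localTransform Φ t r‖ₑ) := by ring
      _ ≤ M * (weightFn v ω (s - r) * ‖localTransform F t (s - r)‖ₑ) *
          (ENNReal.ofReal D * ENNReal.ofReal A *
        ENNReal.ofReal ((1 + (t - t₀) ^ 2)⁻¹) * ENNReal.ofReal (v r * Real.exp (-(ε * |r|)))) := by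
          gcongr
      _ = _ := by ring
  calc weightFn v ω s * ‖invFourier (fun x : ℝ => Φ x * F x) s‖ₑ
      ≤ weightFn v ω s * (ENNReal.ofReal gaussianConst⁻¹ *
        ∫⁻ t : ℝ, ∫⁻ r, ‖localTransform F t (s - r)‖ₑ * ‖localTransform Φ t r‖ₑ) := by gcongr
    _ = ENNReal.ofReal gaussianConst⁻¹ * (∫⁻ t : ℝ, ∫⁻ r, weightFn v ω s *
        (‖localTransform F t (s - r)‖ₑ * ‖localTransform Φ t r‖ₑ)) := by
        rw [mul_left_comm, ← lintegral_const_mul' (weightFn v ω s) _ ENNReal.ofReal_ne_top]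
        simp_rw [← lintegral_const_mul' (weightFn v ω s) _ ENNReal.ofReal_ne_top]
    _ ≤ ENNReal.ofReal gaussianConst⁻¹ * (∫⁻ t : ℝ, ∫⁻ r,
        (M * ENNReal.ofReal D * ENNReal.ofReal A) * (ENNReal.ofReal ((1 + (t - t₀) ^ 2)⁻¹) *
        (ENNReal.ofReal (v r * Real.exp (-(ε * |r|))) *
          (weightFn v ω (s - r) * ‖localTransform F t (s - r)‖ₑ)))) := by
        exact mul_le_mul' le_rfl (lintegral_mono fun t => lintegral_mono fun r => key t r)
    _ = _ := by
        simp_rw [lintegral_const_mul _ (hm2 _)]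
        rw [lintegral_const_mul]
        · ring
        · have h1 : Measurable fun r => ENNReal.ofReal (v r * Real.exp (-(ε * |r|))) := by
            have := hv.measurable
            fun_prop
          exact Measurable.lintegral_prod_right' (f := fun p : ℝ × ℝ =>
            ENNReal.ofReal ((1 + (p.1 - t₀) ^ 2)⁻¹) *
            (ENNReal.ofReal (v p.2 * Real.exp (-(ε * |p.2|))) *
              (weightFn v ω (s - p.2) * ‖localTransform F p.1 (s - p.2)‖ₑ)))
            (Measurable.mul (by fun_prop) ((h1.comp measurable_snd).mul hm))

/-- **Change of localizers**: holomorphic localizers with quadratic decay are admitted in the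
definition of the Hörmander space. -/
theorem exists_localizer_bound (hv : IsStronglyAdmissible v) (hω : 0 ≤ ω) (hε : 0 < ε) :
    ∃ C : ℝ≥0∞, C < ∞ ∧ ∀ (F : ℂ → ℂ) (B : ℝ≥0∞), IsHorFamily v ω F (localTransform F) →
      B < ∞ → (∀ t, weightedNorm v ω (localTransform F t) ≤ B) →
      ∀ (Φ : ℂ → ℂ) (A t₀ : ℝ), DifferentiableOn ℂ Φ {z | |z.im| < ω + ε} →
      (∀ z : ℂ, |z.im| < ω + ε → ‖Φ z‖ ≤ A * (1 + (z.re - t₀) ^ 2)⁻¹) →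
      MemWeightedL2 v ω (invFourier fun x : ℝ => Φ x * F x) ∧
      weightedNorm v ω (invFourier fun x : ℝ => Φ x * F x) ≤ C * ENNReal.ofReal A * B ∧
      Set.EqOn (fourierC (invFourier fun x : ℝ => Φ x * F x)) (fun z => Φ z * F z)
        (closedStrip ω) := by
  obtain ⟨M, hMt, hM⟩ := exists_weightFn_submultiplicative (ω := ω) hv.toIsAdmissible hω
  refine ⟨ENNReal.ofReal gaussianConst⁻¹ * M * ENNReal.ofReal (2 * Real.exp ((ω + ε) ^ 2)) *
    (ENNReal.ofReal Real.pi * expWeightIntegral v ε), ?_, ?_⟩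
  · exact ENNReal.mul_lt_top (ENNReal.mul_lt_top (ENNReal.mul_lt_top ENNReal.ofReal_lt_top hMt)
      ENNReal.ofReal_lt_top) (ENNReal.mul_lt_top ENNReal.ofReal_lt_top
      (expWeightIntegral_lt_top hv.toIsAdmissible hε))
  intro F B hF hBt hB Φ A t₀ hd hA
  have ha : 0 < ω + ε := by linarith
  have hK := hF.exists_bound hv hBt hB
  have hFc := continuous_comp_ofReal hω hF.continuousOn
  have hΦc : Continuous fun x : ℝ => Φ x := by
    simpa using continuous_horizontal hd.continuousOn (y := 0) (by simpa using ha)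
  have hi : Integrable fun x : ℝ => Φ x * F x := integrable_mul_of_decay hΦc
    (fun x => by simpa using hA x (by simpa using ha)) hFc
    (fun x => hK x (ofReal_mem_closedStrip hω x))
  have hpt := weightFn_mul_enorm_invFourier_le hv hω hε hM hF hK hd hA
  set C₁ := ENNReal.ofReal gaussianConst⁻¹ * M * ENNReal.ofReal (2 * Real.exp ((ω + ε) ^ 2))
  have hU : Measurable (Function.uncurry fun (s : ℝ) (θ : ℝ × ℝ) =>
      weightFn v ω (s - θ.2) * ‖localTransform F θ.1 (s - θ.2)‖ₑ) := by
    refine Measurable.mul ((measurable_weightFn hv.toIsAdmissible).comp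
      (by fun_prop : Measurable fun p : ℝ × (ℝ × ℝ) => p.1 - p.2.2)) ?_
    exact ((measurable_localTransform hFc).comp
      (by fun_prop : Measurable fun p : ℝ × (ℝ × ℝ) => (p.2.1, p.1 - p.2.2))).enorm
  have hnorm : weightedNorm v ω (invFourier fun x : ℝ => Φ x * F x) ≤
      C₁ * (ENNReal.ofReal Real.pi * expWeightIntegral v ε) * ENNReal.ofReal A * B := by
    refine weightedNorm_le_of_sq hv.toIsAdmissible ?_
    have : SFinite (averagingMeasure v ε t₀) := by unfold averagingMeasure; infer_instance
    -- For each θ = (t, r) the slice is a translate of the weighted local transform of F at t, hence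
    -- has L² norm at most B. The averaging measure has a total mass independent of t₀, and so is
    -- the final constant.
    have hmink := lintegral_sq_lintegral_le (averagingMeasure v ε t₀) hU (D := B ^ 2) (by
      intro θ
      rw [lintegral_sub_right_eq_self
        (fun s => (weightFn v ω s * ‖localTransform F θ.1 s‖ₑ) ^ 2) θ.2,
        ← weightedNorm_sq hv.toIsAdmissible]
      gcongr
      exact hB θ.1)
    rw [averagingMeasure_univ] at hmink
    calc _ ≤ ∫⁻ s, (C₁ * ENNReal.ofReal A * ∫⁻ θ, weightFn v ω (s - θ.2) *
          ‖localTransform F θ.1 (s - θ.2)‖ₑ ∂(averagingMeasure v ε t₀)) ^ 2 := by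
          exact lintegral_mono fun s => pow_le_pow_left' (hpt s) 2
      _ = (C₁ * ENNReal.ofReal A) ^ 2 * ∫⁻ s, (∫⁻ θ, weightFn v ω (s - θ.2) *
          ‖localTransform F θ.1 (s - θ.2)‖ₑ ∂(averagingMeasure v ε t₀)) ^ 2 := by
          simp_rw [mul_pow]
          rw [lintegral_const_mul]
          exact (hU.lintegral_prod_right').pow_const 2
      _ ≤ (C₁ * ENNReal.ofReal A) ^ 2 *
          ((ENNReal.ofReal Real.pi * expWeightIntegral v ε) ^ 2 * B ^ 2) := by gcongr
      _ = _ := by ring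
  have hmem : MemWeightedL2 v ω (invFourier fun x : ℝ => Φ x * F x) := by
    refine memWeightedL2_of_lt_top hv.toIsAdmissible hω
      (continuous_invFourier hi).aestronglyMeasurable (hnorm.trans_lt ?_)
    exact ENNReal.mul_lt_top (ENNReal.mul_lt_top (ENNReal.mul_lt_top (ENNReal.mul_lt_top
      (ENNReal.mul_lt_top ENNReal.ofReal_lt_top hMt) ENNReal.ofReal_lt_top)
      (ENNReal.mul_lt_top ENNReal.ofReal_lt_top (expWeightIntegral_lt_top hv.toIsAdmissible hε)))
      ENNReal.ofReal_lt_top) hBt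
  refine ⟨hmem, hnorm, ?_⟩
  refine fourierC_invFourier_eqOn_closedStrip hv hω (H := fun z => Φ z * F z) ?_ ?_ hi hmem
  · refine ContinuousOn.mul (hd.continuousOn.mono fun z hz => ?_) hF.continuousOn
    have : |z.im| ≤ ω := hz
    show |z.im| < ω + ε
    linarith
  · refine (hd.mono fun z hz => ?_).mul (hF.differentiableOn hv)
    have : |z.im| < ω := hz
    show |z.im| < ω + ε
    linarith

end Localizer

/-! ### Weighted L² as a convolution algebra -/

section Convolution

variable {v : ℝ → ℝ} {ω : ℝ}

/-- The weight `exp(ω|s|)` with values in `[0, ∞]`. -/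
def expFn (ω s : ℝ) : ℝ≥0∞ := ENNReal.ofReal (Real.exp (ω * |s|))

lemma measurable_expFn (ω : ℝ) : Measurable (expFn ω) := by unfold expFn; fun_prop

/-- Subadditivity of v lets the full weight fall on one factor only. The other carries just e^{ω|·|}
and needs only to be in L¹, as Young's inequality requires. -/
lemma exists_weightFn_subadditive (hv : IsAdmissible v) (hω : 0 ≤ ω) :
    ∃ M : ℝ≥0∞, M < ∞ ∧ ∀ s t, weightFn v ω (s + t) ≤
      M * (weightFn v ω s * expFn ω t + expFn ω s * weightFn v ω t) := by
  obtain ⟨M, hM1, hM⟩ := hv.exists_subadditive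
  refine ⟨ENNReal.ofReal M, ENNReal.ofReal_lt_top, fun s t => ?_⟩
  have h1 := hv.pos s
  have h2 := hv.pos t
  have h3 := hv.pos (s + t)
  rw [weightFn, weightFn, weightFn, expFn, expFn, ← ENNReal.ofReal_mul (by positivity),
    ← ENNReal.ofReal_mul (by positivity), ← ENNReal.ofReal_add (by positivity) (by positivity),
    ← ENNReal.ofReal_mul (by positivity)]
  refine ENNReal.ofReal_le_ofReal ?_
  calc _ ≤ (M * (v s + v t)) * (Real.exp (ω * |s|) * Real.exp (ω * |t|)) :=
        mul_le_mul (hM s t) (exp_abs_add_le hω s t) (Real.exp_pos _).le (by positivity)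
    _ = _ := by ring

lemma ENNReal_add_sq_le (a b : ℝ≥0∞) : (a + b) ^ 2 ≤ 4 * (a ^ 2 + b ^ 2) := by
  rcases le_total a b with h | h
  · calc (a + b) ^ 2 ≤ (b + b) ^ 2 := by gcongr
      _ = 4 * b ^ 2 := by ring
      _ ≤ _ := by gcongr; exact le_add_self
  · calc (a + b) ^ 2 ≤ (a + a) ^ 2 := by gcongr
      _ = 4 * a ^ 2 := by ring
      _ ≤ _ := by gcongr; exact le_self_add

/-- Young's inequality `L¹ * L² ⊆ L²` with weights. -/
lemma lintegral_sq_convolution_le (hv : IsAdmissible v) {p q : ℝ → ℂ} (hp : Measurable p)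
    (hq : Measurable q) :
    ∫⁻ s, (∫⁻ r, (expFn ω r * ‖p r‖ₑ) * (weightFn v ω (s - r) * ‖q (s - r)‖ₑ)) ^ 2 ≤
      (invWeightNorm v * weightedNorm v ω p * weightedNorm v ω q) ^ 2 := by
  have hP : Measurable fun r => expFn ω r * ‖p r‖ₑ := (measurable_expFn ω).mul hp.enorm
  have hQ : Measurable fun s => weightFn v ω s * ‖q s‖ₑ := (measurable_weightFn hv).mul hq.enorm
  set m := (volume : Measure ℝ).withDensity fun r => expFn ω r * ‖p r‖ₑ with hm
  have hU : Measurable (Function.uncurry fun s r : ℝ =>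
      weightFn v ω (s - r) * ‖q (s - r)‖ₑ) :=
    hQ.comp (by fun_prop : Measurable fun p : ℝ × ℝ => p.1 - p.2)
  have h := lintegral_sq_lintegral_le m hU (D := weightedNorm v ω q ^ 2) (by
    intro r
    rw [lintegral_sub_right_eq_self (fun s => (weightFn v ω s * ‖q s‖ₑ) ^ 2) r,
      ← weightedNorm_sq hv])
  have e : ∀ s, ∫⁻ r, weightFn v ω (s - r) * ‖q (s - r)‖ₑ ∂m =
      ∫⁻ r, (expFn ω r * ‖p r‖ₑ) * (weightFn v ω (s - r) * ‖q (s - r)‖ₑ) := fun s => by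
    rw [hm, lintegral_withDensity_eq_lintegral_mul _ hP hU.of_uncurry_left]
    rfl
  simp_rw [e] at h
  refine h.trans ?_
  rw [← mul_pow]
  gcongr
  rw [hm, withDensity_apply _ MeasurableSet.univ, Measure.restrict_univ]
  exact lintegral_exp_mul_le' hv hp.aestronglyMeasurable

/-- The weighted `L²` space is an algebra under convolution. -/
lemma exists_weightedNorm_invFourier_mul_le (hv : IsAdmissible v) (hω : 0 ≤ ω) :
    ∃ M : ℝ≥0∞, M < ∞ ∧ ∀ (h q : ℝ → ℂ), Integrable h → Integrable q → Measurable q →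
      weightedNorm v ω (invFourier fun x => h x * fourierC q x) ≤
        M * (invWeightNorm v * weightedNorm v ω (invFourier h) * weightedNorm v ω q) := by
  obtain ⟨M, hMt, hM⟩ := exists_weightFn_subadditive (ω := ω) hv hω
  -- The estimate below produces M²·8 times a square; rounding 8 up to 9 makes the constant the
  -- square of 3M.
  refine ⟨M * 3, ENNReal.mul_lt_top hMt (by norm_num), fun h q hh hq hqm => ?_⟩
  have hp : Measurable (invFourier h) := (continuous_invFourier hh).measurable
  set p := invFourier h
  set N := invWeightNorm v * weightedNorm v ω p * weightedNorm v ω q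
  set A₁ : ℝ → ℝ≥0∞ := fun s =>
    ∫⁻ r, (expFn ω r * ‖q r‖ₑ) * (weightFn v ω (s - r) * ‖p (s - r)‖ₑ) with hA₁
  set A₂ : ℝ → ℝ≥0∞ := fun s =>
    ∫⁻ r, (expFn ω r * ‖p r‖ₑ) * (weightFn v ω (s - r) * ‖q (s - r)‖ₑ) with hA₂
  have mq : Measurable fun r => expFn ω r * ‖q r‖ₑ := (measurable_expFn ω).mul hqm.enorm
  have mp : Measurable fun r => expFn ω r * ‖p r‖ₑ := (measurable_expFn ω).mul hp.enorm
  have Mq : Measurable fun r => weightFn v ω r * ‖q r‖ₑ := (measurable_weightFn hv).mul hqm.enorm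
  have Mp : Measurable fun r => weightFn v ω r * ‖p r‖ₑ := (measurable_weightFn hv).mul hp.enorm
  have hpt : ∀ s, weightFn v ω s * ‖invFourier (fun x => h x * fourierC q x) s‖ₑ ≤
      M * (A₁ s + A₂ s) := by
    intro s
    rw [invFourier_mul_fourierC hh hq]
    have e2 : A₂ s = ∫⁻ r, (expFn ω (s - r) * ‖p (s - r)‖ₑ) * (weightFn v ω r * ‖q r‖ₑ) := by
      rw [hA₂, ← lintegral_sub_left_eq_self _ s]
      simp_rw [sub_sub_cancel]
    have m1 : Measurable fun r =>
        (expFn ω r * ‖q r‖ₑ) * (weightFn v ω (s - r) * ‖p (s - r)‖ₑ) :=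
      mq.mul (Mp.comp (by fun_prop : Measurable fun r : ℝ => s - r))
    rw [e2, hA₁, ← lintegral_add_left m1, ← lintegral_const_mul' M _ hMt.ne]
    calc weightFn v ω s * ‖∫ r, q r * p (s - r)‖ₑ
        ≤ weightFn v ω s * ∫⁻ r, ‖q r‖ₑ * ‖p (s - r)‖ₑ := by
          refine mul_le_mul' le_rfl ((enorm_integral_le_lintegral_enorm _).trans (le_of_eq ?_))
          simp_rw [enorm_mul]
      _ = ∫⁻ r, weightFn v ω s * (‖q r‖ₑ * ‖p (s - r)‖ₑ) :=
          (lintegral_const_mul' _ _ ENNReal.ofReal_ne_top).symm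
      _ ≤ _ := by
          refine lintegral_mono fun r => ?_
          have := hM (s - r) r
          rw [sub_add_cancel] at this
          calc _ ≤ (M * (weightFn v ω (s - r) * expFn ω r + expFn ω (s - r) * weightFn v ω r)) *
                (‖q r‖ₑ * ‖p (s - r)‖ₑ) := mul_le_mul' this le_rfl
            _ = _ := by ring
  refine weightedNorm_le_of_sq hv ?_
  have mA₁ : Measurable A₁ := Measurable.lintegral_prod_right'
    (f := fun x : ℝ × ℝ => (expFn ω x.2 * ‖q x.2‖ₑ) *
      (weightFn v ω (x.1 - x.2) * ‖p (x.1 - x.2)‖ₑ))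
    ((mq.comp measurable_snd).mul (Mp.comp (by fun_prop : Measurable fun x : ℝ × ℝ => x.1 - x.2)))
  calc _ ≤ ∫⁻ s, (M * (A₁ s + A₂ s)) ^ 2 := lintegral_mono fun s => pow_le_pow_left' (hpt s) 2
    _ ≤ ∫⁻ s, (M ^ 2 * 4) * (A₁ s ^ 2 + A₂ s ^ 2) := by
        refine lintegral_mono fun s => ?_
        rw [mul_pow, mul_assoc]
        exact mul_le_mul' le_rfl (ENNReal_add_sq_le _ _)
    _ = (M ^ 2 * 4) * ((∫⁻ s, A₁ s ^ 2) + ∫⁻ s, A₂ s ^ 2) := by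
        rw [lintegral_const_mul' _ _ (ENNReal.mul_ne_top (ENNReal.pow_ne_top hMt.ne) (by norm_num)),
          lintegral_add_left (mA₁.pow_const 2)]
    _ ≤ (M ^ 2 * 4) * (N ^ 2 + N ^ 2) := by
        gcongr
        · refine (lintegral_sq_convolution_le hv hqm hp).trans (le_of_eq ?_)
          ring
        · exact lintegral_sq_convolution_le hv hp hqm
    _ = M ^ 2 * 8 * N ^ 2 := by ring
    _ ≤ M ^ 2 * 9 * N ^ 2 := by gcongr; norm_num
    _ = _ := by ring

end Convolution

/-! ### Closure under products -/

section Multiplication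

variable {v : ℝ → ℝ} {ω : ℝ}

/-- The square root of the Gaussian localizer. -/
def halfGaussian (t : ℝ) (z : ℂ) : ℂ := Complex.exp (-(z - t) ^ 2 / 2)

lemma halfGaussian_mul_self (t : ℝ) (z : ℂ) :
    halfGaussian t z * halfGaussian t z = gaussian (z - t) := by
  rw [halfGaussian, gaussian, ← Complex.exp_add]; congr 1; ring

lemma norm_halfGaussian_le {a : ℝ} (t : ℝ) {z : ℂ} (hz : |z.im| < a) :
    ‖halfGaussian t z‖ ≤ 2 * Real.exp (a ^ 2) * (1 + (z.re - t) ^ 2)⁻¹ := by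
  have e : ‖halfGaussian t z‖ =
      Real.exp (z.im ^ 2 / 2) * Real.exp (-((z.re - t) ^ 2 / 2)) := by
    rw [halfGaussian, Complex.norm_exp, ← Real.exp_add]
    congr 1
    simp [sq]; ring
  have h1 : Real.exp (z.im ^ 2 / 2) ≤ Real.exp (a ^ 2) := by
    refine Real.exp_le_exp.2 ?_
    have := sq_le_sq' (by linarith [(abs_lt.1 hz).1]) (abs_lt.1 hz).2.le
    nlinarith [sq_nonneg z.im]
  have h2 : Real.exp (-((z.re - t) ^ 2 / 2)) ≤ 2 * (1 + (z.re - t) ^ 2)⁻¹ := by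
    rw [Real.exp_neg, ← div_eq_mul_inv, inv_eq_one_div, div_le_div_iff₀ (Real.exp_pos _)
      (by positivity)]
    linarith [Real.add_one_le_exp ((z.re - t) ^ 2 / 2)]
  rw [e]
  calc _ ≤ Real.exp (a ^ 2) * (2 * (1 + (z.re - t) ^ 2)⁻¹) :=
        mul_le_mul h1 h2 (Real.exp_pos _).le (Real.exp_pos _).le
    _ = _ := by ring

lemma differentiable_halfGaussian (t : ℝ) : Differentiable ℂ (halfGaussian t) := by
  unfold halfGaussian; fun_prop

/-- The Hörmander space is closed under products, with an estimate. -/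
theorem exists_horENorm_mul_le (hv : IsStronglyAdmissible v) (hω : 0 ≤ ω) :
    ∃ C : ℝ≥0∞, C < ∞ ∧ ∀ f h : ℂ → ℂ, MemHor v ω f → MemHor v ω h →
      MemHor v ω (f * h) ∧ horENorm v ω (f * h) ≤ C * (horENorm v ω f * horENorm v ω h) := by
  -- The half Gaussians are entire, so any ε > 0 would do here.
  obtain ⟨C, hCt, hC⟩ := exists_localizer_bound hv hω one_pos
  obtain ⟨M, hMt, hM⟩ := exists_weightedNorm_invFourier_mul_le hv.toIsAdmissible hω
  set A := 2 * Real.exp ((ω + 1) ^ 2) with hA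
  set D : ℝ≥0∞ := M * (invWeightNorm v * (C * ENNReal.ofReal A) * (C * ENNReal.ofReal A))
  have hD : D < ∞ := ENNReal.mul_lt_top hMt (ENNReal.mul_lt_top (ENNReal.mul_lt_top
    hv.invWeightNorm_lt_top (ENNReal.mul_lt_top hCt ENNReal.ofReal_lt_top))
    (ENNReal.mul_lt_top hCt ENNReal.ofReal_lt_top))
  refine ⟨D, hD, fun f h hf hh => ?_⟩
  obtain ⟨F, hF, hfF⟩ := hf.exists_localTransform hv hω
  obtain ⟨H, hH, hhH⟩ := hh.exists_localTransform hv hω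
  have hBf := hF.weightedNorm_le hv hω hfF
  have hBh := hH.weightedNorm_le hv hω hhH
  have hKf := hF.exists_bound hv hf.horENorm_lt_top hBf
  refine memHor_of_forall hv hω (ENNReal.mul_lt_top hD (ENNReal.mul_lt_top hf.horENorm_lt_top
    hh.horENorm_lt_top)) fun t => ?_
  have hloc : ∀ z : ℂ, |z.im| < ω + 1 → ‖halfGaussian t z‖ ≤ A * (1 + (z.re - t) ^ 2)⁻¹ :=
    fun z hz => norm_halfGaussian_le t hz
  obtain ⟨hq1, hn1, he1⟩ := hC F _ hF hf.horENorm_lt_top hBf (halfGaussian t) A t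
    (differentiable_halfGaussian t).differentiableOn hloc
  obtain ⟨hq2, hn2, he2⟩ := hC H _ hH hh.horENorm_lt_top hBh (halfGaussian t) A t
    (differentiable_halfGaussian t).differentiableOn hloc
  have hFc := continuous_comp_ofReal hω hF.continuousOn
  have hHc := continuous_comp_ofReal hω hH.continuousOn
  have hψc : Continuous fun x : ℝ => halfGaussian t x :=
    (differentiable_halfGaussian t).continuous.comp Complex.continuous_ofReal
  have hψb : ∀ x : ℝ, ‖halfGaussian t x‖ ≤ A * (1 + (x - t) ^ 2)⁻¹ := fun x => by
    simpa using hloc x (by simpa using (by linarith : 0 < ω + 1))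
  have hKh := hH.exists_bound hv hh.horENorm_lt_top hBh
  have hi1 : Integrable fun x : ℝ => halfGaussian t x * F x :=
    integrable_mul_of_decay hψc hψb hFc (fun x => hKf x (ofReal_mem_closedStrip hω x))
  have hi2 : Integrable fun x : ℝ => halfGaussian t x * H x :=
    integrable_mul_of_decay hψc hψb hHc (fun x => hKh x (ofReal_mem_closedStrip hω x))
  set q₂ := invFourier fun x : ℝ => halfGaussian t x * H x
  have hb := hM (fun x : ℝ => halfGaussian t x * F x) q₂ hi1 (hq2.integrable hv hω)
    (continuous_invFourier hi2).measurable
  -- One square root of the Gaussian localizes F, the other H. Their product restores the Gaussian,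
  -- and the transform of the product is a convolution of two elements of L²_{v,ω}.
  have e : (fun x : ℝ => halfGaussian t x * F x * fourierC q₂ x) =
      fun x : ℝ => gaussian (x - t) * (F x * H x) := by
    ext x
    rw [he2 (ofReal_mem_closedStrip hω x), ← halfGaussian_mul_self]; ring
  rw [e] at hb
  have hnorm : weightedNorm v ω (invFourier fun x : ℝ => gaussian (x - t) * (F x * H x)) ≤
      D * (horENorm v ω f * horENorm v ω h) := by
    refine hb.trans ?_
    calc _ ≤ M * (invWeightNorm v * (C * ENNReal.ofReal A * horENorm v ω f) *
          (C * ENNReal.ofReal A * horENorm v ω h)) := by gcongr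
      _ = _ := by simp only [D]; ring
  have hi : Integrable fun x : ℝ => gaussian (x - t) * (F x * H x) := by
    rw [← e]
    have hc2 := (continuous_comp_ofReal hω (continuousOn_fourierC hv hq2))
    refine hi1.mul_bdd (c := (invWeightNorm v * weightedNorm v ω q₂).toReal)
      hc2.aestronglyMeasurable (Eventually.of_forall fun x => ?_)
    rw [← toReal_enorm]
    exact ENNReal.toReal_mono (ENNReal.mul_ne_top hv.invWeightNorm_lt_top.ne
      hq2.weightedNorm_lt_top.ne) (enorm_fourierC_le hv hq2 (ofReal_mem_closedStrip hω x))
  have hmem : MemWeightedL2 v ω (invFourier fun x : ℝ => gaussian (x - t) * (F x * H x)) :=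
    memWeightedL2_of_lt_top hv.toIsAdmissible hω (continuous_invFourier hi).aestronglyMeasurable
      (hnorm.trans_lt (ENNReal.mul_lt_top hD (ENNReal.mul_lt_top hf.horENorm_lt_top
    hh.horENorm_lt_top)))
  refine ⟨_, ?_, hnorm⟩
  rw [isSobolevTransform_iff hv hω]
  refine ⟨hmem, ?_⟩
  have hG : Differentiable ℂ fun z : ℂ => gaussian (z - t) :=
    differentiable_gaussian.comp (differentiable_id.sub_const (t : ℂ))
  have heq := fourierC_invFourier_eqOn_closedStrip hv hω
    (H := fun z => gaussian (z - t) * (F z * H z))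
    (hG.continuous.continuousOn.mul (hF.continuousOn.mul hH.continuousOn))
    (hG.differentiableOn.mul ((hF.differentiableOn hv).mul (hH.differentiableOn hv))) hi hmem
  filter_upwards [hfF, hhH, eventuallyEq_of_eqOn hω heq] with z h1 h2 h3
  rw [h3, Pi.mul_apply, Pi.mul_apply, h1, h2]; rfl

end Multiplication

/-! ### Linear structure -/

section Linear

variable {v : ℝ → ℝ} {ω : ℝ} {F H : ℂ → ℂ} {g k : ℝ → ℝ → ℂ}

lemma MemWeightedL2.add (hv : IsAdmissible v) (hω : 0 ≤ ω) {g h : ℝ → ℂ}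
    (hg : MemWeightedL2 v ω g) (hh : MemWeightedL2 v ω h) : MemWeightedL2 v ω (g + h) :=
  memWeightedL2_of_lt_top hv hω (hg.memLp.1.add hh.memLp.1)
    ((weightedNorm_add_le hv hg.memLp.1 hh.memLp.1).trans_lt
      (ENNReal.add_lt_top.2 ⟨hg.weightedNorm_lt_top, hh.weightedNorm_lt_top⟩))

lemma MemWeightedL2.smul (hv : IsAdmissible v) (hω : 0 ≤ ω) (c : ℂ) {g : ℝ → ℂ}
    (hg : MemWeightedL2 v ω g) : MemWeightedL2 v ω (c • g) :=
  memWeightedL2_of_lt_top hv hω (hg.memLp.1.const_smul c)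
    (by rw [weightedNorm_smul]; exact ENNReal.mul_lt_top enorm_lt_top hg.weightedNorm_lt_top)

lemma IsHorFamily.add (hv : IsStronglyAdmissible v) (hω : 0 ≤ ω) (hF : IsHorFamily v ω F g)
    (hH : IsHorFamily v ω H k) : IsHorFamily v ω (F + H) (g + k) := by
  refine ⟨hF.continuousOn.add hH.continuousOn, fun t => (hF.memWeightedL2 t).add
    hv.toIsAdmissible hω (hH.memWeightedL2 t), fun t z hz => ?_⟩
  rw [Pi.add_apply g k t, fourierC_add (hF.memWeightedL2 t).memLp.1
    (integrable_exp_mul hv (hF.memWeightedL2 t))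
    (hH.memWeightedL2 t).memLp.1 (integrable_exp_mul hv (hH.memWeightedL2 t)) hz,
    ← hF.eqOn t z hz, ← hH.eqOn t z hz, Pi.add_apply]
  ring

lemma IsHorFamily.smul (hv : IsStronglyAdmissible v) (hω : 0 ≤ ω) (c : ℂ)
    (hF : IsHorFamily v ω F g) : IsHorFamily v ω (c • F) (c • g) := by
  refine ⟨hF.continuousOn.const_smul c, fun t => (hF.memWeightedL2 t).smul
    hv.toIsAdmissible hω c, fun t z hz => ?_⟩
  rw [Pi.smul_apply c g t, fourierC_smul, ← hF.eqOn t z hz, Pi.smul_apply, smul_eq_mul]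
  ring

lemma MemHor.add (hv : IsStronglyAdmissible v) (hω : 0 ≤ ω) {f h : ℂ → ℂ} (hf : MemHor v ω f)
    (hh : MemHor v ω h) : MemHor v ω (f + h) ∧
      horENorm v ω (f + h) ≤ horENorm v ω f + horENorm v ω h := by
  obtain ⟨F, g, hF, hfF⟩ := hf.exists_family hv hω
  obtain ⟨H, k, hH, hhH⟩ := hh.exists_family hv hω
  refine memHor_of_forall hv hω (ENNReal.add_lt_top.2 ⟨hf.horENorm_lt_top, hh.horENorm_lt_top⟩)
    fun t => ⟨_, (hF.add hv hω hH).isSobolevTransform hv hω (hfF.add hhH) t, ?_⟩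
  refine (weightedNorm_add_le hv.toIsAdmissible (hF.memWeightedL2 t).memLp.1
    (hH.memWeightedL2 t).memLp.1).trans ?_
  exact add_le_add (hF.weightedNorm_le hv hω hfF t) (hH.weightedNorm_le hv hω hhH t)

lemma MemHor.smul (hv : IsStronglyAdmissible v) (hω : 0 ≤ ω) (c : ℂ) {f : ℂ → ℂ}
    (hf : MemHor v ω f) : MemHor v ω (c • f) ∧
      horENorm v ω (c • f) = ‖c‖ₑ * horENorm v ω f := by
  obtain ⟨F, g, hF, hfF⟩ := hf.exists_family hv hω
  have hcF := hF.smul hv hω c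
  have e : c • f =ᶠ[stripFilter ω] c • F := hfF.const_smul c
  have hn : horENorm v ω (c • f) = ‖c‖ₑ * horENorm v ω f := by
    rw [hcF.horENorm_eq hv hω e, hF.horENorm_eq hv hω hfF, ENNReal.mul_iSup]
    exact iSup_congr fun t => weightedNorm_smul c (g t)
  refine ⟨⟨fun t => ⟨_, hcF.isSobolevTransform hv hω e t⟩, ?_⟩, hn⟩
  exact hn.trans_lt (ENNReal.mul_lt_top enorm_lt_top hf.horENorm_lt_top)

lemma MemHor.sub (hv : IsStronglyAdmissible v) (hω : 0 ≤ ω) {f h : ℂ → ℂ} (hf : MemHor v ω f)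
    (hh : MemHor v ω h) : MemHor v ω (f - h) := by
  have := (hf.add hv hω (hh.smul hv hω (-1)).1).1
  rwa [neg_one_smul, ← sub_eq_add_neg] at this

lemma IsHorFamily.sub (hv : IsStronglyAdmissible v) (hω : 0 ≤ ω) (hF : IsHorFamily v ω F g)
    (hH : IsHorFamily v ω H k) : IsHorFamily v ω (F - H) (g - k) := by
  have := hF.add hv hω (hH.smul hv hω (-1))
  rwa [neg_one_smul, neg_one_smul, ← sub_eq_add_neg, ← sub_eq_add_neg] at this

lemma memHor_zero (hv : IsStronglyAdmissible v) (hω : 0 ≤ ω) : MemHor v ω 0 := by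
  have h0 : weightedNorm v ω 0 = 0 := by
    have : weighted v ω 0 = 0 := by ext s; simp [weighted]
    rw [weightedNorm, this, eLpNorm_zero]
  have hm : MemWeightedL2 v ω 0 := memWeightedL2_of_lt_top hv.toIsAdmissible hω
    aestronglyMeasurable_zero (by rw [h0]; simp)
  refine (memHor_of_forall hv hω (B := 0) (by simp) fun t => ⟨0, ?_, h0.le⟩).1
  rw [isSobolevTransform_iff hv hω]
  refine ⟨hm, Eventually.of_forall fun z => ?_⟩
  simp [fourierC]

lemma eventuallyEq_zero_of_horENorm (hv : IsStronglyAdmissible v) (hω : 0 ≤ ω) {f : ℂ → ℂ}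
    (hf : MemHor v ω f) (h0 : horENorm v ω f = 0) : f =ᶠ[stripFilter ω] 0 := by
  obtain ⟨F, g, hF, hfF⟩ := hf.exists_family hv hω
  refine hfF.trans (eventuallyEq_of_eqOn hω fun z hz => ?_)
  have := hF.enorm_le hv (hF.weightedNorm_le hv hω hfF) hz
  rw [h0, mul_zero] at this
  simpa using this

end Linear

/-! ### Completeness -/

section Completeness

variable {v : ℝ → ℝ} {ω : ℝ}

lemma invFourier_sub {h k : ℝ → ℂ} (hh : Integrable h) (hk : Integrable k) (s : ℝ) :
    invFourier (fun x => h x - k x) s = invFourier h s - invFourier k s := by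
  have hb : ∀ {h : ℝ → ℂ}, Integrable h →
      Integrable fun x : ℝ => h x * Complex.exp (Complex.I * s * x) := fun {h} hh => by
    refine hh.mul_bdd (c := 1) (by fun_prop : Continuous _).aestronglyMeasurable
      (Eventually.of_forall fun x => ?_)
    rw [Complex.norm_exp]; simp
  simp_rw [invFourier, sub_mul]
  rw [integral_sub (hb hh) (hb hk), mul_sub]

/-- Uniform convergence on ℝ thus forces convergence of the local transforms at every t and s, which
identifies their limit in the completeness proof. -/
lemma norm_localTransform_sub_le {F H : ℂ → ℂ} (hF : Continuous fun x : ℝ => F x)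
    (hH : Continuous fun x : ℝ => H x) {K L δ : ℝ} (hK : ∀ x : ℝ, ‖F x‖ ≤ K)
    (hL : ∀ x : ℝ, ‖H x‖ ≤ L) (hδ : ∀ x : ℝ, ‖F x - H x‖ ≤ δ) (t s : ℝ) :
    ‖localTransform F t s - localTransform H t s‖ ≤ δ / 2 := by
  rw [localTransform, localTransform, ← invFourier_sub (integrable_gaussian_mul hF hK t)
    (integrable_gaussian_mul hH hL t)]
  refine norm_invFourier_le (t₀ := t) (fun x => ?_) s
  rw [← mul_sub, norm_mul, mul_comm]
  have := norm_gaussian_sub_le t x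
  rw [one_mul] at this
  exact mul_le_mul (hδ x) this (norm_nonneg _) ((norm_nonneg _).trans (hδ x))

/-- The Hörmander space is complete. -/
theorem horENorm_complete (hv : IsStronglyAdmissible v) (hω : 0 ≤ ω) {u : ℕ → ℂ → ℂ}
    (hu : ∀ n, MemHor v ω (u n))
    (hc : ∀ ε : ℝ≥0∞, 0 < ε → ∃ n₀, ∀ m ≥ n₀, ∀ n ≥ n₀, horENorm v ω (u m - u n) ≤ ε) :
    ∃ f, MemHor v ω f ∧ ∀ ε : ℝ≥0∞, 0 < ε → ∃ n₀, ∀ n ≥ n₀, horENorm v ω (u n - f) ≤ ε := by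
  choose F hF hfF using fun n => (hu n).exists_localTransform hv hω
  have hsub : ∀ m n, IsHorFamily v ω (F m - F n) (localTransform (F m) - localTransform (F n)) :=
    fun m n => (hF m).sub hv hω (hF n)
  have hw : ∀ m n t, weightedNorm v ω (localTransform (F m) t - localTransform (F n) t) ≤
      horENorm v ω (u m - u n) := fun m n t =>
    (hsub m n).weightedNorm_le hv hω ((hfF m).sub (hfF n)) t
  have hd : ∀ m n, ∀ z ∈ closedStrip ω,
      ‖F m z - F n z‖ₑ ≤ invWeightNorm v * horENorm v ω (u m - u n) := fun m n z hz =>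
    (hsub m n).enorm_le hv (hw m n) hz
  have hI : invWeightNorm v + 1 ≠ ∞ := by simp [hv.invWeightNorm_lt_top.ne]
  -- uniform Cauchy property
  have huc : ∀ δ : ℝ, 0 < δ → ∃ n₀, ∀ m ≥ n₀, ∀ n ≥ n₀, ∀ z ∈ closedStrip ω,
      ‖F m z - F n z‖ ≤ δ := by
    intro δ hδ
    obtain ⟨n₀, h⟩ := hc (ENNReal.ofReal δ / (invWeightNorm v + 1))
      (ENNReal.div_pos (by simpa using hδ) hI)
    refine ⟨n₀, fun m hm n hn z hz => ?_⟩
    have h1 : ‖F m z - F n z‖ₑ ≤ ENNReal.ofReal δ := by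
      calc _ ≤ (invWeightNorm v + 1) * (ENNReal.ofReal δ / (invWeightNorm v + 1)) :=
            (hd m n z hz).trans (mul_le_mul' le_self_add (h m hm n hn))
        _ = _ := ENNReal.mul_div_cancel (by simp) hI
    rw [← ofReal_norm] at h1
    exact (ENNReal.ofReal_le_ofReal_iff hδ.le).1 h1
  have hlim : ∀ z, ∃ w, z ∈ closedStrip ω → Tendsto (fun n => F n z) atTop (𝓝 w) := by
    intro z
    by_cases hz : z ∈ closedStrip ω
    · have : CauchySeq fun n => F n z := by
        rw [Metric.cauchySeq_iff]
        intro δ hδ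
        obtain ⟨n₀, h⟩ := huc (δ / 2) (by positivity)
        refine ⟨n₀, fun m hm n hn => ?_⟩
        rw [dist_eq_norm]
        exact (h m hm n hn z hz).trans_lt (by linarith)
      obtain ⟨w, hw⟩ := cauchySeq_tendsto_of_complete this
      exact ⟨w, fun _ => hw⟩
    · exact ⟨0, fun h => absurd h hz⟩
  choose G hG using hlim
  have hunif : ∀ δ : ℝ, 0 < δ → ∃ n₀, ∀ n ≥ n₀, ∀ z ∈ closedStrip ω, ‖F n z - G z‖ ≤ δ := by
    intro δ hδ
    obtain ⟨n₀, h⟩ := huc δ hδ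
    refine ⟨n₀, fun n hn z hz => ?_⟩
    refine le_of_tendsto ((hG z hz).const_sub (F n z)).norm ?_
    filter_upwards [eventually_ge_atTop n₀] with m hm
    exact h n hn m hm z hz
  have hGc : ContinuousOn G (closedStrip ω) := by
    refine TendstoUniformlyOn.continuousOn (F := F) (p := atTop) ?_
      (Eventually.of_forall fun n => (hF n).continuousOn).frequently
    rw [Metric.tendstoUniformlyOn_iff]
    intro δ hδ
    obtain ⟨n₀, h⟩ := hunif (δ / 2) (by positivity)
    filter_upwards [eventually_ge_atTop n₀] with n hn z hz
    rw [dist_comm, dist_eq_norm]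
    exact (h n hn z hz).trans_lt (by linarith)
  have hFK : ∀ n, ∀ x : ℝ, ‖F n x‖ ≤ (invWeightNorm v * horENorm v ω (u n)).toReal := fun n x =>
    (hF n).exists_bound hv (hu n).horENorm_lt_top ((hF n).weightedNorm_le hv hω (hfF n)) x
      (ofReal_mem_closedStrip hω x)
  have hGr := continuous_comp_ofReal hω hGc
  obtain ⟨K, hK⟩ : ∃ K : ℝ, ∀ x : ℝ, ‖G x‖ ≤ K := by
    obtain ⟨n₀, h⟩ := hunif 1 one_pos
    refine ⟨1 + (invWeightNorm v * horENorm v ω (u n₀)).toReal, fun x => ?_⟩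
    have h1 := h n₀ le_rfl x (ofReal_mem_closedStrip hω x)
    have h2 := norm_sub_norm_le (G x) (F n₀ x)
    rw [norm_sub_rev] at h2
    linarith [hFK n₀ x]
  -- convergence of the local transforms
  have hloc : ∀ t s, Tendsto (fun n => localTransform (F n) t s) atTop
      (𝓝 (localTransform G t s)) := by
    intro t s
    rw [Metric.tendsto_atTop]
    intro δ hδ
    obtain ⟨n₀, h⟩ := hunif δ hδ
    refine ⟨n₀, fun n hn => ?_⟩
    rw [dist_eq_norm]
    have := norm_localTransform_sub_le (continuous_comp_ofReal hω (hF n).continuousOn) hGr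
      (hFK n) hK (fun x => h n hn x (ofReal_mem_closedStrip hω x)) t s
    linarith
  have hmeas : ∀ n t, AEStronglyMeasurable (localTransform (F n) t) volume := fun n t =>
    ((hF n).memWeightedL2 t).memLp.1
  have hGmeas : ∀ t, AEStronglyMeasurable (localTransform G t) volume := fun t =>
    (continuous_invFourier (integrable_gaussian_mul hGr hK t)).aestronglyMeasurable
  have hlimw : ∀ ε : ℝ≥0∞, 0 < ε → ∃ n₀, ∀ n ≥ n₀, ∀ t,
      weightedNorm v ω (localTransform (F n) t - localTransform G t) ≤ ε := by
    intro ε hε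
    obtain ⟨n₀, h⟩ := hc ε hε
    refine ⟨n₀, fun n hn t => ?_⟩
    -- Fatou's lemma as m → ∞. The index n₀ comes from the Cauchy property of the Hörmander norm, so
    -- it is independent of t.
    refine Lp.eLpNorm_le_of_ae_tendsto (u := atTop)
      (f := fun m => weighted v ω (localTransform (F n) t - localTransform (F m) t)) ?_
      (fun m => aestronglyMeasurable_weighted hv.toIsAdmissible ((hmeas n t).sub (hmeas m t)))
      (Eventually.of_forall fun s => ?_)
    · filter_upwards [eventually_ge_atTop n₀] with m hm
      exact (hw n m t).trans (h n hn m hm)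
    · exact ((hloc t s).const_sub _).const_mul _
  have hGw : ∀ t, MemWeightedL2 v ω (localTransform G t) := by
    intro t
    obtain ⟨n₀, h⟩ := hlimw 1 one_pos
    refine memWeightedL2_of_lt_top hv.toIsAdmissible hω (hGmeas t) ?_
    have e : localTransform G t = localTransform (F n₀) t +
        (-1 : ℂ) • (localTransform (F n₀) t - localTransform G t) := by
      rw [neg_one_smul]; abel
    rw [e]
    refine (weightedNorm_add_le hv.toIsAdmissible (hmeas n₀ t)
      (((hmeas n₀ t).sub (hGmeas t)).const_smul _)).trans_lt ?_
    rw [weightedNorm_smul]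
    exact ENNReal.add_lt_top.2 ⟨((hF n₀).memWeightedL2 t).weightedNorm_lt_top,
      ENNReal.mul_lt_top enorm_lt_top ((h n₀ le_rfl t).trans_lt (by simp))⟩
  have hGF : IsHorFamily v ω G (localTransform G) := by
    refine ⟨hGc, hGw, fun t z hz => ?_⟩
    -- Both sides are limits of the same sequence: the left by pointwise convergence of the
    -- extensions, the right because convergence in L²_{v,ω} implies convergence of the Fourier
    -- integrals on the closed strip.
    refine tendsto_nhds_unique ((hG z hz).const_mul (gaussian (z - t))) ?_
    have e : ∀ n, gaussian (z - t) * F n z = fourierC (localTransform (F n) t) z :=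
      fun n => (hF n).eqOn t z hz
    simp_rw [e]
    rw [EMetric.tendsto_atTop]
    intro ε hε
    obtain ⟨η, hη0, hη⟩ := exists_between (ENNReal.div_pos hε.ne' hI)
    obtain ⟨n₀, h⟩ := hlimw η hη0
    refine ⟨n₀, fun n hn => ?_⟩
    have hs : MemWeightedL2 v ω (localTransform (F n) t - localTransform G t) :=
      memWeightedL2_of_lt_top hv.toIsAdmissible hω ((hmeas n t).sub (hGmeas t))
        ((h n hn t).trans_lt hη.lt_top)
    rw [edist_eq_enorm_sub, ← fourierC_sub (hmeas n t)
      (integrable_exp_mul hv ((hF n).memWeightedL2 t)) (hGmeas t)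
      (integrable_exp_mul hv (hGw t)) hz]
    calc _ ≤ (invWeightNorm v + 1) * η := (enorm_fourierC_le hv hs hz).trans
            (mul_le_mul' le_self_add (h n hn t))
      _ < ε := by
        rw [mul_comm]
        exact (ENNReal.lt_div_iff_mul_lt (Or.inl (by simp)) (Or.inl hI)).1 hη
  have hest : ∀ ε : ℝ≥0∞, 0 < ε → ∃ n₀, ∀ n ≥ n₀, horENorm v ω (u n - G) ≤ ε := by
    intro ε hε
    obtain ⟨n₀, h⟩ := hlimw ε hε
    refine ⟨n₀, fun n hn => ?_⟩
    rw [((hF n).sub hv hω hGF).horENorm_eq hv hω ((hfF n).sub (EventuallyEq.refl _ G))]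
    exact iSup_le fun t => h n hn t
  refine ⟨G, ⟨fun t => ⟨_, hGF.isSobolevTransform hv hω (EventuallyEq.refl _ G) t⟩, ?_⟩, hest⟩
  change horENorm v ω G < ∞
  obtain ⟨n₀, h⟩ := hlimw 1 one_pos
  rw [hGF.horENorm_eq hv hω (EventuallyEq.refl _ G)]
  refine lt_of_le_of_lt (b := horENorm v ω (u n₀) + 1) (iSup_le fun t => ?_)
    (ENNReal.add_lt_top.2 ⟨(hu n₀).horENorm_lt_top, by simp⟩)
  have e : localTransform G t = localTransform (F n₀) t +
      (-1 : ℂ) • (localTransform (F n₀) t - localTransform G t) := by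
    rw [neg_one_smul]; abel
  rw [e]
  refine (weightedNorm_add_le hv.toIsAdmissible (hmeas n₀ t)
    (((hmeas n₀ t).sub (hGmeas t)).const_smul _)).trans ?_
  rw [weightedNorm_smul]
  refine add_le_add ((hF n₀).weightedNorm_le hv hω (hfF n₀) t) ?_
  simpa using h n₀ le_rfl t

end Completeness

/-! ### The Banach algebra -/

section BanachAlgebra

variable {v : ℝ → ℝ} {ω : ℝ}

lemma horNorm_eq (v : ℝ → ℝ) (ω : ℝ) (f : ℂ → ℂ) : horNorm v ω f = (horENorm v ω f).toReal := rfl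

/-- The Hörmander space is a Banach algebra for a multiple of its norm. -/
theorem exists_isBanachFunctionAlgebra (hv : IsStronglyAdmissible v) (hω : 0 ≤ ω) :
    ∃ c : ℝ, 0 < c ∧ IsBanachFunctionAlgebra (stripFilter ω) {f | MemHor v ω f}
      (fun f => c * horNorm v ω f) := by
  obtain ⟨C, hCt, hC⟩ := exists_horENorm_mul_le hv hω
  have hc : 0 < C.toReal + 1 := by positivity
  -- Scaling the norm by a factor c ≥ C turns N(fh) ≤ C N(f) N(h) into submultiplicativity; the
  -- summand 1 ensures c > 0.
  refine ⟨C.toReal + 1, hc, ?_⟩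
  constructor
  · intro f hf h e
    obtain ⟨h1, h2⟩ := MemHor.congr hv hω hf e
    exact ⟨h1, by simp only [horNorm_eq, h2]⟩
  · exact memHor_zero hv hω
  · exact fun f hf h hh => (MemHor.add hv hω hf hh).1
  · exact fun c f hf => (MemHor.smul hv hω c hf).1
  · exact fun f hf h hh => (hC f h hf hh).1
  · exact fun f _ => mul_nonneg hc.le ENNReal.toReal_nonneg
  · intro f hf h0
    have h1 : horNorm v ω f = 0 := (mul_eq_zero.1 h0).resolve_left hc.ne'
    rw [horNorm_eq, ENNReal.toReal_eq_zero_iff] at h1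
    exact eventuallyEq_zero_of_horENorm hv hω hf (h1.resolve_right
      (MemHor.horENorm_lt_top hf).ne)
  · intro f hf h hh
    have hf' := MemHor.horENorm_lt_top hf
    have hh' := MemHor.horENorm_lt_top hh
    have h1 := ENNReal.toReal_mono (ENNReal.add_lt_top.2 ⟨hf', hh'⟩).ne
      (MemHor.add hv hω hf hh).2
    rw [ENNReal.toReal_add hf'.ne hh'.ne] at h1
    simp only [horNorm_eq]
    rw [← mul_add]
    gcongr
  · intro c f hf
    simp only [horNorm_eq, (MemHor.smul hv hω c hf).2, ENNReal.toReal_mul, toReal_enorm]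
    ring
  · intro f hf h hh
    have hf' := MemHor.horENorm_lt_top hf
    have hh' := MemHor.horENorm_lt_top hh
    have h1 := ENNReal.toReal_mono (ENNReal.mul_lt_top hCt (ENNReal.mul_lt_top hf' hh')).ne
      (hC f h hf hh).2
    rw [ENNReal.toReal_mul, ENNReal.toReal_mul] at h1
    simp only [horNorm_eq]
    calc _ ≤ (C.toReal + 1) * ((C.toReal + 1) *
          ((horENorm v ω f).toReal * (horENorm v ω h).toReal)) := by
          gcongr
          refine h1.trans ?_
          gcongr
          linarith
      _ = _ := by ring
  · intro u hu hcau
    have hsub : ∀ m n, MemHor v ω (u m - u n) := fun m n => MemHor.sub hv hω (hu m) (hu n)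
    obtain ⟨f, hf, hlim⟩ := horENorm_complete hv hω hu (fun ε hε => by
      rcases eq_or_ne ε ∞ with rfl | hεt
      · exact ⟨0, fun _ _ _ _ => le_top⟩
      · have hε' : 0 < (C.toReal + 1) * ε.toReal := mul_pos hc (ENNReal.toReal_pos hε.ne' hεt)
        obtain ⟨n₀, h⟩ := hcau _ hε'
        refine ⟨n₀, fun m hm n hn => ?_⟩
        have := (mul_lt_mul_iff_right₀ hc).1 (h m hm n hn)
        rw [horNorm_eq] at this
        exact ((ENNReal.toReal_le_toReal (hsub m n).horENorm_lt_top.ne hεt).1 this.le))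
    refine ⟨f, hf, ?_⟩
    have h1 : Tendsto (fun n => horENorm v ω (u n - f)) atTop (𝓝 0) := by
      rw [ENNReal.tendsto_atTop_zero]
      exact hlim
    have h2 := (ENNReal.tendsto_toReal ENNReal.zero_ne_top).comp h1
    simpa [horNorm_eq] using h2.const_mul (C.toReal + 1)

end BanachAlgebra

/-! ### Passing to a horizontal line -/

section Shifts

variable {v : ℝ → ℝ} {ω : ℝ}

/-- Translations are bounded on weighted `L²`. -/
lemma exists_weightedNorm_translate_le (hv : IsAdmissible v) (τ : ℝ) :
    ∃ C : ℝ≥0∞, C < ∞ ∧ ∀ q : ℝ → ℂ,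
      weightedNorm v 0 (fun s => q (s + τ)) ≤ C * weightedNorm v 0 q := by
  obtain ⟨M, hMt, hM⟩ := exists_weightFn_submultiplicative (ω := 0) hv le_rfl
  have hW : M * weightFn v 0 (-τ) < ∞ := ENNReal.mul_lt_top hMt ENNReal.ofReal_lt_top
  refine ⟨M * weightFn v 0 (-τ), hW, fun q => ?_⟩
  refine weightedNorm_le_of_sq hv ?_
  rw [mul_pow, weightedNorm_sq hv, ← lintegral_const_mul' _ _ (ENNReal.pow_ne_top hW.ne),
    ← lintegral_add_right_eq_self
      (fun s => (M * weightFn v 0 (-τ)) ^ 2 * (weightFn v 0 s * ‖q s‖ₑ) ^ 2) τ]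
  refine lintegral_mono fun s => ?_
  rw [← mul_pow]
  refine pow_le_pow_left' ?_ 2
  have h := hM (s + τ) (-τ)
  rw [add_neg_cancel_right] at h
  calc _ ≤ (M * (weightFn v 0 (s + τ) * weightFn v 0 (-τ))) * ‖q (s + τ)‖ₑ := mul_le_mul' h le_rfl
    _ = _ := by ring

/-- The function `exp(σ s) g(s)`. -/
def expMul (σ : ℝ) (g : ℝ → ℂ) : ℝ → ℂ := fun s => (Real.exp (σ * s) : ℂ) * g s

lemma enorm_expMul (σ : ℝ) (g : ℝ → ℂ) (s : ℝ) :
    ‖expMul σ g s‖ₑ = ENNReal.ofReal (Real.exp (σ * s)) * ‖g s‖ₑ := by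
  rw [expMul, enorm_mul, ← ofReal_norm, Complex.norm_real, Real.norm_of_nonneg (Real.exp_pos _).le]

lemma aestronglyMeasurable_expMul (σ : ℝ) {g : ℝ → ℂ} (hg : AEStronglyMeasurable g) :
    AEStronglyMeasurable (expMul σ g) :=
  AEStronglyMeasurable.mul (Continuous.aestronglyMeasurable (by fun_prop)) hg

lemma weightFn_zero_mul (hv : IsAdmissible v) (σ s : ℝ) :
    weightFn v 0 s * ENNReal.ofReal (Real.exp (σ * s)) =
      ENNReal.ofReal (v s * Real.exp (σ * s)) := by
  have := hv.pos s
  rw [weightFn, ← ENNReal.ofReal_mul (by positivity)]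
  simp

lemma weightedNorm_expMul_le (hv : IsAdmissible v) {σ : ℝ} (hσ : |σ| ≤ ω) (g : ℝ → ℂ) :
    weightedNorm v 0 (expMul σ g) ≤ weightedNorm v ω g := by
  refine weightedNorm_le_of_sq hv ?_
  rw [weightedNorm_sq hv]
  refine lintegral_mono fun s => pow_le_pow_left' ?_ 2
  rw [enorm_expMul, ← mul_assoc, weightFn_zero_mul hv, weightFn]
  have := hv.pos s
  refine mul_le_mul' (ENNReal.ofReal_le_ofReal ?_) le_rfl
  refine mul_le_mul_of_nonneg_left (Real.exp_le_exp.2 ?_) this.le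
  calc σ * s ≤ |σ * s| := le_abs_self _
    _ = |σ| * |s| := abs_mul _ _
    _ ≤ _ := by gcongr

/-- Since e^{ω|s|} ≤ e^{ωs} + e^{-ωs}, the norm on the strip is controlled by the two edges. -/
lemma weightedNorm_le_expMul_add (hv : IsAdmissible v) {g : ℝ → ℂ} (hg : AEStronglyMeasurable g) :
    weightedNorm v ω g ≤
      weightedNorm v 0 (expMul ω g) + weightedNorm v 0 (expMul (-ω) g) := by
  have h : weightedNorm v ω g ≤ eLpNorm (fun s => ‖weighted v 0 (expMul ω g) s‖ +
      ‖weighted v 0 (expMul (-ω) g) s‖) 2 volume := by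
    refine eLpNorm_mono_real fun s => ?_
    have := hv.pos s
    rw [norm_weighted hv, norm_weighted hv, norm_weighted hv, expMul, expMul, norm_mul, norm_mul,
      Complex.norm_real, Complex.norm_real, Real.norm_of_nonneg (Real.exp_pos _).le,
      Real.norm_of_nonneg (Real.exp_pos _).le, zero_mul, Real.exp_zero, mul_one, ← mul_add,
      ← add_mul, mul_assoc]
    gcongr
    have h1 := Real.exp_pos (ω * s)
    have h2 := Real.exp_pos (-ω * s)
    rcases abs_cases s with ⟨hs, _⟩ | ⟨hs, _⟩
    · rw [hs]; linarith
    · rw [hs, mul_neg, ← neg_mul]; linarith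
  refine h.trans ((eLpNorm_add_le
    (aestronglyMeasurable_weighted hv (aestronglyMeasurable_expMul _ hg)).norm
    (aestronglyMeasurable_weighted hv (aestronglyMeasurable_expMul _ hg)).norm
    (by norm_num)).trans (le_of_eq ?_))
  rw [eLpNorm_norm, eLpNorm_norm]; rfl

/-- The inverse Fourier transform of `τ_t G · F_{|σ}` in terms of the one of `τ_t G · F`. -/
def sideTransform (σ t : ℝ) (g : ℝ → ℂ) : ℝ → ℂ :=
  Complex.exp (-σ ^ 2 - 2 * Complex.I * σ * t) • fun s => expMul σ g (s + 2 * σ)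

/-- Expanding the square, Gaussians centred at t and t - iσ differ by a constant and the exponential
e^{2iσx}. On the transform side the latter is a translation by 2σ, and the constant has modulus
e^{-σ²} for every t. -/
lemma gaussian_shift (σ t x : ℝ) : gaussian (x - t) =
    Complex.exp (-σ ^ 2 - 2 * Complex.I * σ * t) *
      (gaussian (x + σ * Complex.I - t) * Complex.exp (2 * Complex.I * σ * x)) := by
  rw [gaussian, gaussian, ← Complex.exp_add, ← Complex.exp_add]
  congr 1
  linear_combination ((σ : ℂ) ^ 2) * Complex.I_sq

lemma fourierC_sideTransform (σ t x : ℝ) (g : ℝ → ℂ) :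
    fourierC (sideTransform σ t g) x = Complex.exp (-σ ^ 2 - 2 * Complex.I * σ * t) *
      (fourierC g (x + σ * Complex.I) * Complex.exp (2 * Complex.I * σ * x)) := by
  rw [sideTransform, fourierC_smul]
  congr 1
  rw [fourierC, fourierC, ← integral_mul_const, ← integral_sub_right_eq_self _ (2 * σ)]
  congr 1; ext s
  have h : (Real.exp (σ * s) : ℂ) * Complex.exp (-Complex.I * (s - 2 * σ : ℝ) * x) =
      Complex.exp (-Complex.I * s * (x + σ * Complex.I)) *
        Complex.exp (2 * Complex.I * σ * x) := by
    rw [Complex.ofReal_exp, ← Complex.exp_add, ← Complex.exp_add]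
    congr 1
    push_cast
    linear_combination ((s : ℂ) * σ) * Complex.I_sq
  rw [sub_add_cancel, expMul]
  linear_combination (g s) * h

lemma weightedNorm_sideTransform (σ t : ℝ) (g : ℝ → ℂ) :
    weightedNorm v 0 (sideTransform σ t g) = ENNReal.ofReal (Real.exp (-σ ^ 2)) *
      weightedNorm v 0 (fun s => expMul σ g (s + 2 * σ)) := by
  rw [sideTransform, weightedNorm_smul, ← ofReal_norm, Complex.norm_exp]
  congr 3
  simp [sq]

lemma exists_weightedNorm_sideTransform_le (hv : IsAdmissible v) (σ : ℝ) :
    ∃ C : ℝ≥0∞, C < ∞ ∧ ∀ t g,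
      weightedNorm v 0 (sideTransform σ t g) ≤ C * weightedNorm v 0 (expMul σ g) ∧
      weightedNorm v 0 (expMul σ g) ≤ C * weightedNorm v 0 (sideTransform σ t g) := by
  obtain ⟨C₁, hC₁t, hC₁⟩ := exists_weightedNorm_translate_le hv (2 * σ)
  obtain ⟨C₂, hC₂t, hC₂⟩ := exists_weightedNorm_translate_le hv (-(2 * σ))
  set E := ENNReal.ofReal (Real.exp (-σ ^ 2))
  set E' := ENNReal.ofReal (Real.exp (σ ^ 2))
  have hE : E' * E = 1 := by
    rw [← ENNReal.ofReal_mul (Real.exp_pos _).le, ← Real.exp_add]; simp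
  refine ⟨E * C₁ + C₂ * E', ENNReal.add_lt_top.2
    ⟨ENNReal.mul_lt_top ENNReal.ofReal_lt_top hC₁t,
    ENNReal.mul_lt_top hC₂t ENNReal.ofReal_lt_top⟩, fun t g => ⟨?_, ?_⟩⟩
  · rw [weightedNorm_sideTransform]
    calc _ ≤ E * (C₁ * weightedNorm v 0 (expMul σ g)) := mul_le_mul' le_rfl (hC₁ _)
      _ = (E * C₁) * weightedNorm v 0 (expMul σ g) := by ring
      _ ≤ _ := mul_le_mul' le_self_add le_rfl
  · have h := hC₂ (fun s => expMul σ g (s + 2 * σ))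
    simp only [neg_add_cancel_right] at h
    calc _ ≤ C₂ * weightedNorm v 0 (fun s => expMul σ g (s + 2 * σ)) := h
      _ = C₂ * (E' * E) * weightedNorm v 0 (fun s => expMul σ g (s + 2 * σ)) := by
          rw [hE, mul_one]
      _ = (C₂ * E') * weightedNorm v 0 (sideTransform σ t g) := by
          rw [weightedNorm_sideTransform]; ring
      _ ≤ _ := mul_le_mul' le_add_self le_rfl

end Shifts

/-! ### Boundary functions and equivalence of norms -/

section BoundaryFunctions

variable {v : ℝ → ℝ} {ω : ℝ}

lemma add_mul_I_mem_closedStrip {σ : ℝ} (hσ : |σ| ≤ ω) (x : ℝ) :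
    (x + σ * Complex.I : ℂ) ∈ closedStrip ω := by
  simpa [closedStrip] using hσ

lemma IsHorFamily.isSobolevTransform_side (hv : IsStronglyAdmissible v) {σ : ℝ} (hσ : |σ| ≤ ω)
    {F : ℂ → ℂ} {g : ℝ → ℝ → ℂ} (hF : IsHorFamily v ω F g) (t : ℝ) :
    IsSobolevTransform v 0 (translate t gaussian * ofLine (ordinate F σ))
      (sideTransform σ t (g t)) := by
  obtain ⟨C, hCt, hC⟩ := exists_weightedNorm_sideTransform_le hv.toIsAdmissible σ
  rw [isSobolevTransform_iff hv le_rfl]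
  constructor
  · refine memWeightedL2_of_lt_top hv.toIsAdmissible le_rfl ?_ (((hC t (g t)).1).trans_lt
      (ENNReal.mul_lt_top hCt ((weightedNorm_expMul_le hv.toIsAdmissible hσ _).trans_lt
        (hF.memWeightedL2 t).weightedNorm_lt_top)))
    refine AEStronglyMeasurable.const_smul ?_ _
    exact (aestronglyMeasurable_expMul σ (hF.memWeightedL2 t).memLp.1).comp_quasiMeasurePreserving
      (quasiMeasurePreserving_add_right volume (2 * σ))
  · rw [stripFilter, if_pos rfl, EventuallyEq, eventually_map]
    refine Eventually.of_forall fun x => ?_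
    rw [fourierC_sideTransform, ← hF.eqOn t _ (add_mul_I_mem_closedStrip hσ x)]
    simp only [Pi.mul_apply, translate, ofLine, ordinate, Complex.ofReal_re]
    rw [gaussian_shift σ t x]
    ring

/-- The restriction to a horizontal line is bounded from the Hörmander space on the strip to the
one on the line. -/
lemma exists_horENorm_ordinate_le (hv : IsStronglyAdmissible v) {σ : ℝ} (hσ : |σ| ≤ ω) :
    ∃ C : ℝ≥0∞, C < ∞ ∧ ∀ f F, MemHor v ω f → ∀ g, IsHorFamily v ω F g → f =ᶠ[stripFilter ω] F →
      MemHor v 0 (ofLine (ordinate F σ)) ∧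
      horENorm v 0 (ofLine (ordinate F σ)) ≤ C * horENorm v ω f ∧
      ∀ t, weightedNorm v 0 (expMul σ (g t)) ≤ C * horENorm v 0 (ofLine (ordinate F σ)) := by
  obtain ⟨C, hCt, hC⟩ := exists_weightedNorm_sideTransform_le hv.toIsAdmissible σ
  have hω : 0 ≤ ω := (abs_nonneg σ).trans hσ
  refine ⟨C, hCt, fun f F hf g hF e => ?_⟩
  have hs := hF.isSobolevTransform_side hv hσ
  obtain ⟨h1, h2⟩ := memHor_of_forall hv le_rfl (ENNReal.mul_lt_top hCt hf.horENorm_lt_top)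
    fun t => ⟨_, hs t, ((hC t (g t)).1).trans (mul_le_mul' le_rfl
      ((weightedNorm_expMul_le hv.toIsAdmissible hσ _).trans (hF.weightedNorm_le hv hω e t)))⟩
  refine ⟨h1, h2, fun t => ((hC t (g t)).2).trans (mul_le_mul' le_rfl ?_)⟩
  rw [← sobolevENorm_eq hv le_rfl (hs t)]
  exact le_iSup (fun t : ℝ => sobolevENorm v 0 (translate t gaussian * ofLine (ordinate F σ))) t

lemma horNormLine_eq (v : ℝ → ℝ) (b : ℝ → ℂ) :
    horNormLine v b = (horENorm v 0 (ofLine b)).toReal := rfl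

/-- Equivalence of the norm of the Hörmander space on the strip with the norms of the boundary
functions. -/
theorem exists_boundary_equivalence (hv : IsStronglyAdmissible v) (hω : 0 < ω) :
    ∃ c C : ℝ, 0 < c ∧ 0 < C ∧ ∀ f F g, MemHor v ω f → IsHorFamily v ω F g →
      f =ᶠ[stripFilter ω] F →
      MemHorLine v (ordinate F ω) ∧ MemHorLine v (ordinate F (-ω)) ∧
      c * (horNormLine v (ordinate F ω) + horNormLine v (ordinate F (-ω))) ≤ horNorm v ω f ∧
      horNorm v ω f ≤ C * (horNormLine v (ordinate F ω) + horNormLine v (ordinate F (-ω))) := by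
  obtain ⟨C₁, hC₁t, hC₁⟩ := exists_horENorm_ordinate_le (ω := ω) hv (σ := ω) (abs_of_pos hω).le
  obtain ⟨C₂, hC₂t, hC₂⟩ := exists_horENorm_ordinate_le (ω := ω) hv (σ := -ω)
    (by rw [abs_neg, abs_of_pos hω])
  -- One constant serves both directions, inverted for the lower bound; the summand 1 makes it
  -- positive.
  set D := C₁.toReal + C₂.toReal + 1
  have h1' : 0 ≤ C₁.toReal := ENNReal.toReal_nonneg
  have h2' : 0 ≤ C₂.toReal := ENNReal.toReal_nonneg
  have hD : 0 < D := by positivity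
  refine ⟨D⁻¹, D, by positivity, hD, fun f F g hf hF e => ?_⟩
  obtain ⟨m1, b1, r1⟩ := hC₁ f F hf g hF e
  obtain ⟨m2, b2, r2⟩ := hC₂ f F hf g hF e
  have n0 := hf.horENorm_lt_top
  have n1 := m1.horENorm_lt_top
  have n2 := m2.horENorm_lt_top
  refine ⟨m1, m2, ?_, ?_⟩
  · have e1 := ENNReal.toReal_mono (ENNReal.mul_lt_top hC₁t n0).ne b1
    have e2 := ENNReal.toReal_mono (ENNReal.mul_lt_top hC₂t n0).ne b2
    rw [ENNReal.toReal_mul] at e1 e2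
    rw [inv_mul_le_iff₀ hD, horNormLine_eq, horNormLine_eq, horNorm_eq]
    have : 0 ≤ (horENorm v ω f).toReal := ENNReal.toReal_nonneg
    calc _ ≤ C₁.toReal * (horENorm v ω f).toReal + C₂.toReal * (horENorm v ω f).toReal :=
          add_le_add e1 e2
      _ ≤ _ := by simp only [D]; nlinarith
  · have hle : horENorm v ω f ≤ C₁ * horENorm v 0 (ofLine (ordinate F ω)) +
        C₂ * horENorm v 0 (ofLine (ordinate F (-ω))) := by
      rw [hF.horENorm_eq hv hω.le e]
      exact iSup_le fun t => (weightedNorm_le_expMul_add hv.toIsAdmissible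
        (hF.memWeightedL2 t).memLp.1).trans (add_le_add (r1 t) (r2 t))
    have t1 := ENNReal.mul_lt_top hC₁t n1
    have t2 := ENNReal.mul_lt_top hC₂t n2
    have h := ENNReal.toReal_mono (ENNReal.add_lt_top.2 ⟨t1, t2⟩).ne hle
    rw [ENNReal.toReal_add t1.ne t2.ne, ENNReal.toReal_mul, ENNReal.toReal_mul] at h
    rw [horNormLine_eq, horNormLine_eq, horNorm_eq]
    have p1 : 0 ≤ (horENorm v 0 (ofLine (ordinate F ω))).toReal := ENNReal.toReal_nonneg
    have p2 : 0 ≤ (horENorm v 0 (ofLine (ordinate F (-ω)))).toReal := ENNReal.toReal_nonneg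
    refine h.trans ?_
    simp only [D]
    nlinarith [mul_nonneg h1' p2, mul_nonneg h2' p1]

end BoundaryFunctions

/-! ### From boundary values back to the strip -/

section Converse

variable {v : ℝ → ℝ} {ω : ℝ}

/-- Passage to the boundary in the formula for shifted lines of integration. -/
lemma expMul_invFourier_eq {h : ℂ → ℂ} {B t₀ : ℝ} (hh : DifferentiableOn ℂ h {z | |z.im| < ω})
    (hb : ∀ z : ℂ, |z.im| < ω → ‖h z‖ ≤ B * (1 + (z.re - t₀) ^ 2)⁻¹) {σ : ℝ} {l : Filter ℝ}
    [l.NeBot] [l.IsCountablyGenerated] (hl : l ≤ 𝓝 σ) (hl' : ∀ᶠ y in l, |y| < ω)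
    {b : ℝ → ℂ} (hlim : ∀ᵐ x : ℝ, Tendsto (fun y : ℝ => h (x + y * Complex.I)) l (𝓝 (b x)))
    (s : ℝ) : expMul σ (invFourier fun x : ℝ => h x) s = invFourier b s := by
  have h1 : Tendsto (fun y : ℝ => invFourier (fun x : ℝ => h (x + y * Complex.I)) s) l
      (𝓝 (invFourier b s)) := by
    refine Tendsto.const_mul _ ?_
    refine tendsto_integral_filter_of_dominated_convergence
      (fun x => B * (1 + (x - t₀) ^ 2)⁻¹) ?_ ?_ ((integrable_inv_one_add_sq_sub t₀).const_mul B) ?_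
    · filter_upwards [hl'] with y hy
      exact (continuous_horizontal hh.continuousOn hy).aestronglyMeasurable.mul
        (Continuous.aestronglyMeasurable (by fun_prop))
    · filter_upwards [hl'] with y hy
      refine Eventually.of_forall fun x => ?_
      rw [norm_mul, Complex.norm_exp]
      simpa using hb (x + y * Complex.I) (by simpa using hy)
    · filter_upwards [hlim] with x hx
      exact hx.mul_const _
  -- On interior lines the contour shift equates this expression with the transform along the line.
  -- Its limit at the edge is elementary, while the transforms converge by dominated convergence.
  have h2 : Tendsto (fun y : ℝ => (Real.exp (s * y) : ℂ) * invFourier (fun x : ℝ => h x) s) l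
      (𝓝 ((Real.exp (s * σ) : ℂ) * invFourier (fun x : ℝ => h x) s)) := by
    refine Tendsto.mono_left ?_ hl
    exact Continuous.tendsto (by fun_prop) σ
  have h3 := h1.congr' (by
    filter_upwards [hl'] with y hy
    exact invFourier_horizontal hh hb hy s)
  rw [expMul, mul_comm σ]
  exact tendsto_nhds_unique h2 h3

lemma invFourier_gaussian_shift (σ t s : ℝ) (b : ℝ → ℂ) :
    invFourier (fun x : ℝ => gaussian (x + σ * Complex.I - t) * b x) s =
      Complex.exp (σ ^ 2 + 2 * Complex.I * σ * t) *
        invFourier (fun x : ℝ => gaussian (x - t) * b x) (s + -(2 * σ)) := by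
  rw [invFourier, invFourier, mul_left_comm (Complex.exp (σ ^ 2 + 2 * Complex.I * σ * t)),
    ← integral_const_mul (Complex.exp (σ ^ 2 + 2 * Complex.I * σ * t))]
  congr 2; ext x
  rw [gaussian, gaussian, mul_right_comm, mul_right_comm (Complex.exp _) (b x), ← mul_assoc,
    ← mul_assoc, ← Complex.exp_add, ← Complex.exp_add, ← Complex.exp_add]
  congr 2
  push_cast
  linear_combination (-(σ : ℂ) ^ 2) * Complex.I_sq

/-- The bound on one boundary line. -/
lemma exists_weightedNorm_expMul_le (hv : IsStronglyAdmissible v) (σ : ℝ) :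
    ∃ C : ℝ≥0∞, C < ∞ ∧ ∀ (f : ℂ → ℂ) (b : ℝ → ℂ) (K t : ℝ) (l : Filter ℝ) [l.NeBot]
      [l.IsCountablyGenerated], l ≤ 𝓝 σ → (∀ᶠ y in l, |y| < ω) →
      DifferentiableOn ℂ f {z | |z.im| < ω} → (∀ z : ℂ, |z.im| < ω → ‖f z‖ ≤ K) →
      (∀ᵐ s : ℝ, Tendsto (fun y : ℝ => ordinate f y s) l (𝓝 (b s))) → MemHorLine v b →
      weightedNorm v 0 (expMul σ (localTransform f t)) ≤ C * horENorm v 0 (ofLine b) := by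
  obtain ⟨C, hCt, hC⟩ := exists_weightedNorm_translate_le hv.toIsAdmissible (-(2 * σ))
  refine ⟨ENNReal.ofReal (Real.exp (σ ^ 2)) * C, ENNReal.mul_lt_top ENNReal.ofReal_lt_top hCt, ?_⟩
  intro f b K t l _ _ hl hl' hd hK hlim hb
  obtain ⟨H, hH, e⟩ := MemHor.exists_localTransform hv le_rfl hb
  have hG : Differentiable ℂ fun z : ℂ => gaussian (z - t) :=
    differentiable_gaussian.comp (differentiable_id.sub_const (t : ℂ))
  rw [stripFilter, if_pos rfl, EventuallyEq, eventually_map] at e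
  -- Multiplying by e^{σs} moves to the edge Im z = σ, where the boundary function is multiplied by
  -- a Gaussian centred at t - iσ. Recentring it at t costs a translation by 2σ and a constant of
  -- modulus e^{σ²}.
  have key : expMul σ (localTransform f t) =
      Complex.exp (σ ^ 2 + 2 * Complex.I * σ * t) •
        fun s => localTransform H t (s + -(2 * σ)) := by
    ext s
    rw [localTransform, expMul_invFourier_eq (h := fun z => gaussian (z - t) * f z)
      (B := Real.exp (ω ^ 2) * K) (t₀ := t) (hG.differentiableOn.mul hd) (fun z hz => ?_) hl hl'
      (b := fun x => gaussian (x + σ * Complex.I - t) * H x)]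
    · exact invFourier_gaussian_shift σ t s fun x => H x
    · filter_upwards [hlim, e] with x hx hxe
      simp only [ofLine, Complex.ofReal_re] at hxe
      rw [← hxe]
      refine Tendsto.mul ?_ hx
      refine Tendsto.mono_left ?_ hl
      have : Continuous fun y : ℝ => gaussian (x + y * Complex.I - t) :=
        continuous_gaussian.comp (by fun_prop)
      exact this.tendsto σ
    · rw [norm_mul, norm_gaussian_le]
      have hK0 := (norm_nonneg _).trans (hK z hz)
      have h1 : Real.exp ((z - t).im ^ 2) ≤ Real.exp (ω ^ 2) := by
        refine Real.exp_le_exp.2 ?_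
        simp only [Complex.sub_im, Complex.ofReal_im, sub_zero]
        exact sq_le_sq' (by linarith [(abs_lt.1 hz).1]) (abs_lt.1 hz).2.le
      have h2 : Real.exp (-(z - t).re ^ 2) ≤ (1 + (z.re - t) ^ 2)⁻¹ := by
        simpa using exp_neg_sq_le (z.re - t)
      calc _ ≤ (Real.exp (ω ^ 2) * (1 + (z.re - t) ^ 2)⁻¹) * K :=
            mul_le_mul (mul_le_mul h1 h2 (Real.exp_pos _).le (Real.exp_pos _).le) (hK z hz)
              (norm_nonneg _) (by positivity)
        _ = _ := by ring
  rw [key, weightedNorm_smul, mul_assoc (ENNReal.ofReal _)]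
  refine mul_le_mul' (le_of_eq ?_) ((hC _).trans (mul_le_mul' le_rfl ?_))
  · rw [← ofReal_norm, Complex.norm_exp]
    congr 2
    simp [sq]
  · refine hH.weightedNorm_le hv le_rfl ?_ t
    rw [stripFilter, if_pos rfl, EventuallyEq, eventually_map]
    exact e

/-- A bounded holomorphic function with boundary values in the Hörmander space on the line belongs
to the Hörmander space on the strip. -/
theorem memHor_of_boundary (hv : IsStronglyAdmissible v) (hω : 0 < ω) {f : ℂ → ℂ}
    {bp bm : ℝ → ℂ} (hf : MemHInfty ω f) (hbv : HasBoundaryValues ω f bp bm)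
    (hp : MemHorLine v bp) (hm : MemHorLine v bm) : MemHor v ω f := by
  obtain ⟨hd, K, hK⟩ := hf
  rw [strip_eq hω] at hd hK
  obtain ⟨C₁, hC₁t, hC₁⟩ := exists_weightedNorm_expMul_le (ω := ω) hv ω
  obtain ⟨C₂, hC₂t, hC₂⟩ := exists_weightedNorm_expMul_le (ω := ω) hv (-ω)
  refine (memHor_of_forall hv hω.le (B := C₁ * horENorm v 0 (ofLine bp) +
    C₂ * horENorm v 0 (ofLine bm)) (ENNReal.add_lt_top.2
    ⟨ENNReal.mul_lt_top hC₁t (MemHor.horENorm_lt_top hp),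
      ENNReal.mul_lt_top hC₂t (MemHor.horENorm_lt_top hm)⟩) fun t => ?_).1
  have b1 := hC₁ f bp K t (𝓝[<] ω) nhdsWithin_le_nhds (by
    filter_upwards [Ioo_mem_nhdsLT (show -ω < ω by linarith)] with y hy
    exact abs_lt.2 hy) hd (fun z hz => hK z hz) hbv.1 hp
  have b2 := hC₂ f bm K t (𝓝[>] (-ω)) nhdsWithin_le_nhds (by
    filter_upwards [Ioo_mem_nhdsGT (show -ω < ω by linarith)] with y hy
    exact abs_lt.2 hy) hd (fun z hz => hK z hz) hbv.2 hm
  have hfc : Continuous fun x : ℝ => f x := by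
    simpa using continuous_horizontal hd.continuousOn (y := 0) (by simpa using hω)
  have hi := integrable_gaussian_mul hfc (fun x => hK x (by simpa using hω)) t
  have hmeas : AEStronglyMeasurable (localTransform f t) volume :=
    (continuous_invFourier hi).aestronglyMeasurable
  have hn := (weightedNorm_le_expMul_add (ω := ω) hv.toIsAdmissible hmeas).trans (add_le_add b1 b2)
  have hmem : MemWeightedL2 v ω (localTransform f t) := memWeightedL2_of_lt_top hv.toIsAdmissible
    hω.le hmeas (hn.trans_lt (ENNReal.add_lt_top.2
    ⟨ENNReal.mul_lt_top hC₁t (MemHor.horENorm_lt_top hp),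
      ENNReal.mul_lt_top hC₂t (MemHor.horENorm_lt_top hm)⟩))
  refine ⟨localTransform f t, ?_, hn⟩
  rw [isSobolevTransform_iff hv hω.le]
  refine ⟨hmem, ?_⟩
  have hG : Differentiable ℂ fun z : ℂ => gaussian (z - t) :=
    differentiable_gaussian.comp (differentiable_id.sub_const (t : ℂ))
  have heq := fourierC_eqOn_strip (h := fun z => gaussian (z - t) * f z) hω hmeas
    (integrable_exp_mul hv hmem) (hG.differentiableOn.mul hd)
    (fourierC_invFourier ((hG.continuous.comp Complex.continuous_ofReal).mul hfc) hi
      (hmem.integrable hv hω.le))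
  rw [stripFilter_eq hω, EventuallyEq, eventually_principal]
  intro z hz
  exact (heq hz).symm

/-- A limit along a vertical line must agree with the continuous extension at its endpoint. The
norms of given boundary values are thus those of the edges of the extension, and the equivalence
proved for the latter applies. -/
lemma ordinate_ae_eq (hω : 0 < ω) {f F : ℂ → ℂ} (hF : IsContinuousExtension ω f F) {σ : ℝ}
    (hσ : |σ| ≤ ω) {l : Filter ℝ} [l.NeBot] (hl : l ≤ 𝓝 σ) (hl' : ∀ᶠ y in l, |y| < ω)
    {b : ℝ → ℂ} (hlim : ∀ᵐ s : ℝ, Tendsto (fun y : ℝ => ordinate f y s) l (𝓝 (b s))) :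
    ofLine b =ᶠ[stripFilter 0] ofLine (ordinate F σ) := by
  rw [stripFilter, if_pos rfl, EventuallyEq, eventually_map]
  filter_upwards [hlim] with x hx
  simp only [ofLine, Complex.ofReal_re]
  refine tendsto_nhds_unique hx ?_
  have hc := (hF.continuousOn (x + σ * Complex.I) (add_mul_I_mem_closedStrip hσ x)).tendsto
  have ht : Tendsto (fun y : ℝ => (x + y * Complex.I : ℂ)) l
      (𝓝[closedStrip ω] (x + σ * Complex.I)) := by
    refine tendsto_nhdsWithin_of_tendsto_nhds_of_eventually_within _ ?_ ?_
    · exact (Continuous.tendsto (by fun_prop) σ).mono_left hl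
    · filter_upwards [hl'] with y hy
      exact add_mul_I_mem_closedStrip hy.le x
  refine (hc.comp ht).congr' ?_
  have he := hF.eq_on
  rw [stripFilter_eq hω, EventuallyEq, eventually_principal] at he
  filter_upwards [hl'] with y hy
  exact (he _ (by simpa using hy)).symm

end Converse

/-! ### Representation formula and embedding -/

section Representation

variable {v : ℝ → ℝ} {ω : ℝ}

/-- The representation formula for functions in the Hörmander space. -/
theorem representation_formula (hv : IsStronglyAdmissible v) (hω : 0 ≤ ω) {θ : ℝ} (hθ : 0 < θ)
    {φ : ℂ → ℂ} (hφ : IsHolSchwartz (θ + ω) φ) {f F : ℂ → ℂ} (hf : MemHor v ω f)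
    (hF : IsContinuousExtension ω f F) {z : ℂ} (hz : z ∈ strip θ ∩ closedStrip ω) :
    MemSobolev v ω (translate z φ * f) ∧
      ∀ g : ℝ → ℂ, IsSobolevTransform v ω (translate z φ * f) g →
        Integrable (fun s : ℝ => g s * Complex.exp (-Complex.I * s * z)) ∧
        φ 0 * F z = ∫ s : ℝ, g s * Complex.exp (-Complex.I * s * z) := by
  obtain ⟨hz1, hz2⟩ := hz
  rw [strip_eq hθ] at hz1
  have hz1' : |z.im| < θ := hz1
  obtain ⟨hd, hα⟩ := hφ
  rw [strip_eq (by linarith)] at hd hα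
  -- The exponent 2 is the quadratic decay required of a localizer, since 1 + x² ≤ (1 + |x|)².
  obtain ⟨A, hA⟩ := hα 2 two_pos
  -- This is the room left by translating φ: if |Im w| < ω + ε, then w - z stays in the strip of
  -- half-width θ + ω.
  set ε := θ - |z.im| with hε
  have hε0 : 0 < ε := by linarith
  have hsub : ∀ w : ℂ, |w.im| < ω + ε → |(w - z).im| < θ + ω := by
    intro w hw
    have := abs_sub w.im z.im
    rw [Complex.sub_im]
    linarith
  obtain ⟨F₀, hF₀, e₀⟩ := hf.exists_localTransform hv hω
  have hFF : Set.EqOn F F₀ (closedStrip ω) :=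
    eqOn_closedStrip hω hF.continuousOn hF₀.continuousOn (hF.eq_on.symm.trans e₀)
  obtain ⟨C, -, hC⟩ := exists_localizer_bound hv hω hε0
  obtain ⟨hm, -, he⟩ := hC F₀ _ hF₀ hf.horENorm_lt_top (hF₀.weightedNorm_le hv hω e₀)
    (translate z φ) A z.re
    (hd.comp (differentiable_id.sub_const z).differentiableOn fun w hw => hsub w hw)
    (fun w hw => by
      refine (hA (w - z) (hsub w hw)).trans ?_
      have hA0 : 0 ≤ A := by
        have := (norm_nonneg _).trans (hA 0 (by simpa using (by linarith : 0 < θ + ω)))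
        simpa using this
      rw [← div_eq_mul_inv, Real.rpow_two, Complex.sub_re]
      gcongr
      nlinarith [abs_nonneg (w.re - z.re), sq_abs (w.re - z.re)])
  have hs : IsSobolevTransform v ω (translate z φ * f)
      (invFourier fun x : ℝ => translate z φ x * F₀ x) := by
    rw [isSobolevTransform_iff hv hω]
    refine ⟨hm, ?_⟩
    filter_upwards [e₀, eventuallyEq_of_eqOn hω he] with w h1 h2
    rw [h2, Pi.mul_apply, h1]
  refine ⟨⟨_, hs⟩, fun g hg => ⟨integrable_kernel hg.1.memLp.1 (integrable_exp_mul hv hg.1) hz2, ?_⟩⟩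
  change _ = fourierC g z
  -- The Fourier integral represents τ_z φ · F on the whole closed strip, in particular at w = z,
  -- where the localizer takes the value φ(0).
  rw [fourierC_congr (hg.ae_eq hv hω hs), he hz2, hFF hz2]
  simp [translate]

/-- The embedding of the Hörmander space into the bounded uniformly continuous functions. -/
theorem exists_uniformContinuousOn (hv : IsStronglyAdmissible v) (hω : 0 ≤ ω) {f : ℂ → ℂ}
    (hf : MemHor v ω f) : ∃ F : ℂ → ℂ, IsContinuousExtension ω f F ∧
      UniformContinuousOn F (closedStrip ω) ∧
      ∀ z ∈ closedStrip ω, ‖F z‖ ≤ (invWeightNorm v).toReal * horNorm v ω f := by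
  obtain ⟨F, g, hF, e⟩ := hf.exists_family hv hω
  have hB := hF.weightedNorm_le hv hω e
  refine ⟨F, ⟨hF.continuousOn, e⟩, hF.uniformContinuousOn hv hf.horENorm_lt_top hB, fun z hz => ?_⟩
  rw [horNorm_eq, ← ENNReal.toReal_mul]
  exact hF.exists_bound hv hf.horENorm_lt_top hB z hz

end Representation

end

end HorStrip

/-! ### Assembly of the theorem -/

theorem mainTheorem7 (ω : ℝ) (hω : 0 ≤ ω) (v : ℝ → ℝ) (hv : HorStrip.IsStronglyAdmissible v) :
    -- continuous embedding into the bounded uniformly continuous functions on the closed strip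
    (∃ C : ℝ, ∀ f : ℂ → ℂ, HorStrip.MemHor v ω f →
      ∃ F : ℂ → ℂ, HorStrip.IsContinuousExtension ω f F ∧
        UniformContinuousOn F (HorStrip.closedStrip ω) ∧
        ∀ z ∈ HorStrip.closedStrip ω, ‖F z‖ ≤ C * HorStrip.horNorm v ω f) ∧
    -- characterization by boundary values, with equivalence of norms
    (0 < ω →
      ∃ c C : ℝ, 0 < c ∧ 0 < C ∧
        (∀ f : ℂ → ℂ, HorStrip.MemHor v ω f →
          ∃ F : ℂ → ℂ, HorStrip.IsContinuousExtension ω f F ∧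
            HorStrip.MemHorLine v (HorStrip.ordinate F ω) ∧
            HorStrip.MemHorLine v (HorStrip.ordinate F (-ω)) ∧
            c * (HorStrip.horNormLine v (HorStrip.ordinate F ω) +
                HorStrip.horNormLine v (HorStrip.ordinate F (-ω))) ≤ HorStrip.horNorm v ω f ∧
            HorStrip.horNorm v ω f ≤
              C * (HorStrip.horNormLine v (HorStrip.ordinate F ω) +
                HorStrip.horNormLine v (HorStrip.ordinate F (-ω)))) ∧
        (∀ (f : ℂ → ℂ) (bp bm : ℝ → ℂ), HorStrip.MemHInfty ω f →
          HorStrip.HasBoundaryValues ω f bp bm →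
          HorStrip.MemHorLine v bp → HorStrip.MemHorLine v bm →
          HorStrip.MemHor v ω f ∧
            c * (HorStrip.horNormLine v bp + HorStrip.horNormLine v bm) ≤
              HorStrip.horNorm v ω f ∧
            HorStrip.horNorm v ω f ≤
              C * (HorStrip.horNormLine v bp + HorStrip.horNormLine v bm))) ∧
    -- Banach algebra under pointwise multiplication, after scaling the norm
    (∃ c : ℝ, 0 < c ∧
      HorStrip.IsBanachFunctionAlgebra (HorStrip.stripFilter ω) {f | HorStrip.MemHor v ω f}
        (fun f => c * HorStrip.horNorm v ω f)) ∧
    -- representation formula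
    (∀ θ : ℝ, 0 < θ → ∀ φ : ℂ → ℂ, HorStrip.IsHolSchwartz (θ + ω) φ →
      ∀ f F : ℂ → ℂ, HorStrip.MemHor v ω f → HorStrip.IsContinuousExtension ω f F →
        ∀ z ∈ HorStrip.strip θ ∩ HorStrip.closedStrip ω,
          HorStrip.MemSobolev v ω (HorStrip.translate z φ * f) ∧
          ∀ g : ℝ → ℂ, HorStrip.IsSobolevTransform v ω (HorStrip.translate z φ * f) g →
            MeasureTheory.Integrable (fun s : ℝ => g s * Complex.exp (-Complex.I * s * z)) ∧
            φ 0 * F z = ∫ s : ℝ, g s * Complex.exp (-Complex.I * s * z)) := by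
  refine ⟨⟨_, fun f hf => HorStrip.exists_uniformContinuousOn hv hω hf⟩, fun hω' => ?_,
    HorStrip.exists_isBanachFunctionAlgebra hv hω, fun θ hθ φ hφ f F hf hF z hz =>
      HorStrip.representation_formula hv hω hθ hφ hf hF hz⟩
  obtain ⟨c, C, hc, hC, h⟩ := HorStrip.exists_boundary_equivalence hv hω'
  refine ⟨c, C, hc, hC, fun f hf => ?_, fun f bp bm hf hbv hp hm => ?_⟩
  · obtain ⟨F, g, hF, e⟩ := HorStrip.MemHor.exists_family hv hω hf
    exact ⟨F, ⟨hF.continuousOn, e⟩, h f F g hf hF e⟩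
  · have hmem := HorStrip.memHor_of_boundary hv hω' hf hbv hp hm
    obtain ⟨F, g, hF, e⟩ := HorStrip.MemHor.exists_family hv hω hmem
    have hlt : ∀ᶠ y : ℝ in 𝓝[<] ω, |y| < ω := by
      filter_upwards [Ioo_mem_nhdsLT (show -ω < ω by linarith)] with y hy
      exact abs_lt.2 hy
    have hgt : ∀ᶠ y : ℝ in 𝓝[>] (-ω), |y| < ω := by
      filter_upwards [Ioo_mem_nhdsGT (show -ω < ω by linarith)] with y hy
      exact abs_lt.2 hy
    have ep := HorStrip.ordinate_ae_eq hω' ⟨hF.continuousOn, e⟩ (abs_of_pos hω').le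
      nhdsWithin_le_nhds hlt hbv.1
    have em := HorStrip.ordinate_ae_eq hω' ⟨hF.continuousOn, e⟩ (σ := -ω)
      (by rw [abs_neg, abs_of_pos hω']) nhdsWithin_le_nhds hgt hbv.2
    -- The boundary values agree almost everywhere with the edges of the extension, so the constants
    -- from the direct part are valid here too.
    rw [HorStrip.horNormLine_eq v bp, HorStrip.horNormLine_eq v bm,
      ← (HorStrip.MemHor.congr hv le_rfl hp ep).2, ← (HorStrip.MemHor.congr hv le_rfl hm em).2]
    exact ⟨hmem, (h f F g hmem hF e).2.2⟩
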